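/- **Conventions.** A Polish ultrametric space is a complete separable metric space $(U,d)$ with $d(x,z)\le\max\{d(x,y),d(y,z)\}$; $\mathrm{Iso}(U)$ has the topology of pointwise convergence. The homogeneous component $[x]$ of $x\in U$ is its $\mathrm{Iso}(U)$-orbit; $U$ is *exact* if for all $x,y\in U$ the infimum $\inf\{d(x',y') : x'\in[x],\,y'\in[y]\}$ is attained. $U$ is uniformly discrete if there is $r>0$ such that all open balls of radius $r$ are singletons. $\cong$ denotes isomorphism of topological groups. *Trees.* For a linear order $L$, an *$L$-tree* is a partial order $T$ with a surjection $\lambda\colon T\to L$ such that: $t<t'$ implies $\lambda(t)<\lambda(t')$; for all $t$ and $\ell\ge\lambda(t)$ there is a unique $t|_\ell\ge t$ with $\lambda(t|_\ell)=\ell$; any $t,t'$ have $t|_\ell=t'|_\ell$ for some $\ell\ge\max\{\lambda(t),\lambda(t')\}$; and if $t,t'$ are incomparable, then $\{\ell\ge\max\{\lambda(t),\lambda(t')\} : t|_\ell\ne t'|_\ell\}$ has a maximum. It is *pruned* if for every $t\in T$ there is an order-preserving $b\colon L\to T$ with $\lambda(b(\ell))=\ell$ for all $\ell$ and $b(\lambda(t))=t$.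 $\mathrm{Aut}(T)$ is the group of $\lambda$-preserving order automorphisms, with pointwise convergence on the discrete set $T$. The condensed tree $\Delta(T)$ is the set of $\mathrm{Aut}(T)$-orbits $[t]$, with $[t]\le[t']$ iff some elements of $[t]$, $[t']$ are so related, and the induced level map; $T$ is *special* if $\Delta(T)$ is an $L$-tree. $T$ has property $(\star)$ if, whenever $C\subseteq T$ is an upward closed chain that has a strict lower bound in $T$ (i.e. some $s$ with $s<c$ for all $c\in C$), and $t\in T$ satisfies $[t]\le[c]$ for all $c\in C$, there is $\bar t\in[t]$ with $\bar t\le c$ for all $c\in C$. *Skeletons.* A countable treeable skeleton $\langle\Delta,N\rangle$ is a nonempty countable partial order $\Delta$ that is a pruned $L$-tree for some linear order $L$ and some level map, with labels $1\le N_\delta\le\omega$ ($\delta\in\Delta$), each $N_\delta$ being identified with the set of natural numbers below it. For $x\in\prod_\delta N_\delta$ let $x|_\delta$ be the restriction of $x$ to $\{\gamma:\gamma\ge\delta\}$ and $\mathrm{supp}(x)=\{\delta:x(\delta)\ne0\}$. $\mathrm{Max}$ is the family of all $A\subseteq\Delta$ without infinite strictly increasing sequences, $\mathrm{Wsp}$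 the family of those $A\in\mathrm{Max}$ in which no infinite strictly decreasing sequence has a lower bound in $\Delta$, and $\mathrm{LF}$ the family of all $A$ such that $\{\gamma\in A:\gamma\ge\delta\}$ is finite for all $\delta$. *Global domains.* A domain is a set $S\subseteq\prod_\delta N_\delta$ such that for all $x\in S$, $\delta\in\Delta$, $i\in N_\delta$ there is $x^\delta_i\in S$ with $x^\delta_i(\delta)=i$ and $x^\delta_i(\gamma)=x(\gamma)$ for $\gamma>\delta$. $\mathrm{Wr}^S_{\delta\in\Delta}\mathrm{Sym}(N_\delta)$ is the group of all $g\in\mathrm{Sym}(S)$ such that for all $x,y\in S$, $\delta\in\Delta$: $x|_\delta=y|_\delta$ iff $g(x)|_\delta=g(y)|_\delta$, and $i\mapsto g(x^\delta_i)(\delta)$ is a permutation of $N_\delta$. The product $\prod_\delta N_\delta$ has the topology $\tau_\Delta$ generated by the sets $\{y:y|_\gamma=x|_\gamma\}$, and $\mathrm{Wr}^S$ has the topology of pointwise convergence on $S\subseteq(\prod_\delta N_\delta,\tau_\Delta)$. For $\mathscr A\in\{\mathrm{LF},\mathrm{Wsp}\}$ put $S^{\mathscr A}=\{x:\mathrm{supp}(x)\in\mathscr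 A\}$ and $\mathrm{Wr}^{\mathscr A}=\mathrm{Wr}^{S^{\mathscr A}}$. $S$ is *approximately homogeneous* if for all $x,y\in S$ and $\delta$ there is $g\in\mathrm{Wr}^S_{\delta\in\Delta}\mathrm{Sym}(N_\delta)$ with $g(x)|_\delta=y|_\delta$, and *locally determined* if every $x\in\prod_\delta N_\delta$ such that for each $\gamma$ there is $y\in S$ with $x|_\gamma=y|_\gamma$ belongs to $S$. *Local domains and projections.* A system of projections $\langle\mathbf S,\boldsymbol\pi\rangle$ consists of nonempty sets $\mathbf S_\delta\subseteq\prod_{\gamma\ge\delta}N_\gamma$ (with union $\mathbf S$), closed under replacing the value at $\delta$ by any $i\in N_\delta$ ($z\mapsto z^\delta_i$), and surjections $\pi_{\delta\gamma}\colon\mathbf S_\delta\to\mathbf S_\gamma$ ($\delta\le\gamma$) such that $\pi_{\delta\gamma}(z)=\pi_{\delta\gamma}(z')$ iff $z|_\gamma=z'|_\gamma$, and $\pi_{\gamma\beta}\circ\pi_{\delta\gamma}=\pi_{\delta\beta}$. $\mathrm{Wr}^{\mathbf S,\boldsymbol\pi}_{\delta\in\Delta}\mathrm{Sym}(N_\delta)$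 is the group of all $g\in\mathrm{Sym}(\mathbf S)$ with $g(\mathbf S_\delta)=\mathbf S_\delta$, $g\circ\pi_{\delta\gamma}=\pi_{\delta\gamma}\circ g$ on $\mathbf S_\delta$, and $i\mapsto g(z^\delta_i)(\delta)$ a permutation of $N_\delta$ for every $z\in\mathbf S_\delta$, with pointwise convergence on the discrete set $\mathbf S$. The system is *locally homogeneous* if this group is transitive on each $\mathbf S_\delta$, *full* if every $z\in\mathbf S_{\bar\delta}$ is $z_{\bar\delta}$ for some $(z_\delta)_\delta\in\prod_\delta\mathbf S_\delta$ with $\pi_{\delta\gamma}(z_\delta)=z_\gamma$ for all $\delta\le\gamma$, and *countable* if $\mathbf S$ is countable. A *family of local domains* $\mathbf S$ is a system of projections whose projections are the restrictions $z\mapsto z|_\gamma$; its group is written $\mathrm{Wr}^{\mathbf S}$. $\mathbf S\subseteq\mathbf S^{\mathrm{Max}}$ means that each $z\in\mathbf S_\delta$ is $x|_\delta$ for some $x$ with $\mathrm{supp}(x)\in\mathrm{Max}$. **Theorem.** For every topological group $G$ the following are equivalent: 1. $G\cong\mathrm{Iso}(U)$ for some exact Polish ultrametric space $U$; 2. $G\cong\mathrm{Iso}(U)$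 for some exact perfect locally compact Polish ultrametric space $U$; 3. $G\cong\mathrm{Iso}(U)$ for some exact uniformly discrete Polish ultrametric space $U$; 4. $G\cong\mathrm{Aut}(T)$ for some linear order $L$ and some countable pruned $L$-tree $T$ with property $(\star)$; 5. $G\cong\mathrm{Aut}(T)$ for some linear order $L$ with a minimum and some countable pruned special $L$-tree $T$ with property $(\star)$; 6. $G\cong\mathrm{Aut}(T)$ for some countable pruned special $\mathbb Q$-tree $T$ with property $(\star)$; 7. $G\cong\mathrm{Wr}^{\mathrm{LF}}_{\delta\in\Delta}\mathrm{Sym}(N_\delta)$ for some countable treeable skeleton $\langle\Delta,N\rangle$; 8. $G\cong\mathrm{Wr}^{\mathrm{Wsp}}_{\delta\in\Delta}\mathrm{Sym}(N_\delta)$ for some countable treeable skeleton $\langle\Delta,N\rangle$; 9. $G\cong\mathrm{Wr}^{S}_{\delta\in\Delta}\mathrm{Sym}(N_\delta)$ for some countable treeable skeleton $\langle\Delta,N\rangle$ and some approximately homogeneous, closed, locally determined, separable domain $S\subseteq\prod_{\delta}N_\delta$ (closed and separable with respect to $\tau_\Delta$); 10. $G\cong\mathrm{Wr}^{\mathbf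 S}_{\delta\in\Delta}\mathrm{Sym}(N_\delta)$ for some countable treeable skeleton $\langle\Delta,N\rangle$ and some countable locally homogeneous full family of local domains $\mathbf S\subseteq\mathbf S^{\mathrm{Max}}$; 11. $G\cong\mathrm{Wr}^{\mathbf S,\boldsymbol\pi}_{\delta\in\Delta}\mathrm{Sym}(N_\delta)$ for some countable treeable skeleton $\langle\Delta,N\rangle$ and some countable locally homogeneous full system of projections $\langle\mathbf S,\boldsymbol\pi\rangle$ with $\mathbf S\subseteq\mathbf S^{\mathrm{Max}}$. Moreover, $S^{\mathrm{LF}}=S^{\mathrm{Wsp}}$ for every countable treeable skeleton, so that the groups in 7 and 8 coincide. -/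

import Mathlib

namespace UltraIso

theorem perm_apply_inv {X : Type} (f : Equiv.Perm X) (x : X) : f (f⁻¹ x) = x :=
  f.apply_symm_apply x

/-! ### Ultrametric spaces and their isometry groups -/

section Spaces

/-- The isometry group carries the topology of pointwise convergence. -/
instance isoTopology (U : Type) [MetricSpace U] : TopologicalSpace (U ≃ᵢ U) :=
  TopologicalSpace.induced (fun (φ : U ≃ᵢ U) (x : U) => φ x) inferInstance

/-- `U` is a Polish ultrametric space: the metric is complete, second-countable and an
ultrametric. -/
structure IsPolishUltrametric (U : Type) [MetricSpace U] : Prop where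
  ultrametric : IsUltrametricDist U
  complete : CompleteSpace U
  secondCountable : SecondCountableTopology U

/-- The homogeneous component of `x`: its orbit under the isometry group. -/
def component {U : Type} [MetricSpace U] (x : U) : Set U :=
  {y | ∃ φ : U ≃ᵢ U, φ x = y}

/-- Every two homogeneous components have exact distance: the infimum of the distances between
their points is attained. -/
def IsExact (U : Type) [MetricSpace U] : Prop :=
  ∀ x y : U, ∃ x' ∈ component x, ∃ y' ∈ component y,
    dist x' y' = sInf (Set.image2 dist (component x) (component y))

/-- Uniform discreteness: some positive radius makes all open balls singletons. -/
def IsUniformlyDiscrete (U : Type) [MetricSpace U] : Prop :=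
  ∃ r : ℝ, 0 < r ∧ ∀ x : U, Metric.ball x r = {x}

end Spaces

/-! ### `L`-trees -/

section Trees

variable {T L : Type} [LE T] [LinearOrder L]

/-- `t|_ℓ = t'|_ℓ`: the nodes `t` and `t'` have the same node of level `ℓ` above them. -/
def AgreeAt (lev : T → L) (t t' : T) (ℓ : L) : Prop :=
  ∃ s, t ≤ s ∧ t' ≤ s ∧ lev s = ℓ

/-- `(T, ≤, lev)` is a weak `L`-tree. -/
structure IsWeakLTree (lev : T → L) : Prop where
  le_refl : ∀ t : T, t ≤ t
  le_trans : ∀ t t' t'' : T, t ≤ t' → t' ≤ t'' → t ≤ t''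
  le_antisymm : ∀ t t' : T, t ≤ t' → t' ≤ t → t = t'
  lev_surjective : Function.Surjective lev
  lev_lt : ∀ t t' : T, t ≤ t' → t ≠ t' → lev t < lev t'
  existsUnique_above : ∀ (t : T) (ℓ : L), lev t ≤ ℓ → ∃! t'' : T, t ≤ t'' ∧ lev t'' = ℓ
  exists_agree : ∀ t t' : T, ∃ ℓ, max (lev t) (lev t') ≤ ℓ ∧ AgreeAt lev t t' ℓ

/-- `(T, ≤, lev)` is an `L`-tree: for incomparable nodes there is a largest level at which they
still differ. -/
structure IsLTree (lev : T → L) : Prop extends IsWeakLTree lev where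
  exists_split : ∀ t t' : T, ¬ t ≤ t' → ¬ t' ≤ t →
    ∃ ℓ, IsGreatest {ℓ | max (lev t) (lev t') ≤ ℓ ∧ ¬ AgreeAt lev t t' ℓ} ℓ

/-- Every node lies on a branch, a branch being a monotone choice of one node in each level. -/
def IsPruned (lev : T → L) : Prop :=
  ∀ t : T, ∃ b : L → T,
    (∀ ℓ, lev (b ℓ) = ℓ) ∧ (∀ ℓ ℓ', ℓ ≤ ℓ' → b ℓ ≤ b ℓ') ∧ b (lev t) = t

/-- The automorphism group of `(T, ≤, lev)`. -/
def treeAut (lev : T → L) : Subgroup (Equiv.Perm T) where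
  carrier := {f | (∀ t, lev (f t) = lev t) ∧ ∀ t t', t ≤ t' ↔ f t ≤ f t'}
  mul_mem' := by
    rintro f g ⟨hf, hf'⟩ ⟨hg, hg'⟩
    refine ⟨fun t => ?_, fun t t' => ?_⟩
    · rw [Equiv.Perm.mul_apply, hf, hg]
    · rw [Equiv.Perm.mul_apply, Equiv.Perm.mul_apply, hg', hf']
  one_mem' := ⟨fun _ => rfl, fun _ _ => Iff.rfl⟩
  inv_mem' := by
    rintro f ⟨hf, hf'⟩
    refine ⟨fun t => ?_, fun t t' => ?_⟩
    · rw [← hf (f⁻¹ t), perm_apply_inv]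
    · rw [hf' (f⁻¹ t), perm_apply_inv, perm_apply_inv]

/-- Pointwise convergence, the set of nodes being discrete. -/
instance treeAutTopology (lev : T → L) : TopologicalSpace (treeAut lev) :=
  TopologicalSpace.induced (fun (f : treeAut lev) (t : T) => f.1 t)
    (@Pi.topologicalSpace T (fun _ => T) fun _ => ⊥)

/-- The equivalence relation "some automorphism maps `t` to `t'`". -/
def orbitSetoid (lev : T → L) : Setoid T where
  r t t' := ∃ f ∈ treeAut lev, f t = t'
  iseqv :=
    { refl := fun _ => ⟨1, one_mem _, rfl⟩
      symm := by
        rintro t t' ⟨f, hf, rfl⟩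
        exact ⟨f⁻¹, inv_mem hf, f.symm_apply_apply t⟩
      trans := by
        rintro t t' t'' ⟨f, hf, rfl⟩ ⟨g, hg, rfl⟩
        exact ⟨g * f, mul_mem hg hf, rfl⟩ }

/-- The nodes of the condensed tree. -/
def Condensed (lev : T → L) : Type := Quotient (orbitSetoid lev)

/-- The class `[t]` of a node. -/
def Condensed.mk (lev : T → L) (t : T) : Condensed lev := Quotient.mk (orbitSetoid lev) t

/-- `δ ≤ δ'` if and only if `t ≤ t'` for some `t ∈ δ` and `t' ∈ δ'`. -/
instance (lev : T → L) : LE (Condensed lev) where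
  le δ δ' := ∃ t t' : T, Condensed.mk lev t = δ ∧ Condensed.mk lev t' = δ' ∧ t ≤ t'

/-- The level function of the condensed tree. -/
def Condensed.lev (lev : T → L) : Condensed lev → L :=
  Quotient.lift lev (by rintro t t' ⟨f, hf, rfl⟩; exact (hf.1 t).symm)

/-- An `L`-tree is special if its condensed tree is an `L`-tree. -/
def IsSpecial (lev : T → L) : Prop := IsLTree (Condensed.lev lev)

/-- `C` is a proper upward closed chain. -/
structure IsProperUpperChain (C : Set T) : Prop where
  chain : ∀ t ∈ C, ∀ t' ∈ C, t ≤ t' ∨ t' ≤ t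
  upward_closed : ∀ t ∈ C, ∀ t', t ≤ t' → t' ∈ C
  proper : ∃ t, ∀ t' ∈ C, t ≤ t' ∧ t ≠ t'

/-- Property (⋆). -/
def HasStar (lev : T → L) : Prop :=
  ∀ C : Set T, IsProperUpperChain C → ∀ t : T,
    (∀ t' ∈ C, Condensed.mk lev t ≤ Condensed.mk lev t') →
      ∃ s : T, Condensed.mk lev s = Condensed.mk lev t ∧ ∀ t' ∈ C, s ≤ t'

end Trees

/-! ### Skeletons and generalized sequences

All skeletons below have labels `N δ ≤ ω`, and are given by a function `N : Δ → ℕ∞` on a partial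
order `Δ`; the label `N δ` stands for the set of all natural numbers below `N δ`. -/

section Sequences

variable {Δ : Type}

/-- The set `N δ`, i.e. `{0, …, N δ - 1}` or `ℕ`. -/
def Coord (N : Δ → ℕ∞) (δ : Δ) : Type := {n : ℕ // (n : ℕ∞) < N δ}

/-- The product of all sets `N δ`. -/
def GlobalSeq (N : Δ → ℕ∞) : Type := ∀ δ, Coord N δ

/-- The support of a sequence. -/
def supp {N : Δ → ℕ∞} (x : GlobalSeq N) : Set Δ := {δ | (x δ).1 ≠ 0}

variable [PartialOrder Δ]

/-- `⟨Δ, N⟩` is a countable skeleton that is treeable: `Δ` is a pruned `L`-tree for some linear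
order `L` and some level function. -/
structure IsCountableTreeable (N : Δ → ℕ∞) : Prop where
  nonempty : Nonempty Δ
  countable : Countable Δ
  label_ne_zero : ∀ δ, N δ ≠ 0
  treeable : ∃ (L : Type) (_ : LinearOrder L) (lev : Δ → L), IsLTree lev ∧ IsPruned lev

variable (N : Δ → ℕ∞)

/-- The product of the sets `N γ` over the cone `γ ≥ δ`. -/
def LocalSeq (δ : Δ) : Type := ∀ γ : Set.Ici δ, Coord N γ

variable {N}

/-- `x|_δ` -/
def GlobalSeq.restrict (x : GlobalSeq N) (δ : Δ) : LocalSeq N δ := fun γ => x γ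

/-- `z|_γ`, for `z` defined on the cone above `δ` and `γ ≥ δ`. -/
def LocalSeq.restrict {δ γ : Δ} (h : δ ≤ γ) (z : LocalSeq N δ) : LocalSeq N γ :=
  fun β => z ⟨β, h.trans β.2⟩

open Classical in
/-- `z^δ_i`: the value at the vertex `δ` of the cone is replaced by `i`. -/
noncomputable def LocalSeq.perturb {δ : Δ} (z : LocalSeq N δ) (i : Coord N δ) : LocalSeq N δ :=
  Function.update z ⟨δ, le_refl δ⟩ i

/-- The value at the vertex of the cone. -/
def LocalSeq.value {δ : Δ} (z : LocalSeq N δ) : Coord N δ := z ⟨δ, le_refl δ⟩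

/-- The topology `τ_Δ`, generated by the sets of all `y` with `y|_γ = x|_γ`. -/
instance tauTopology : TopologicalSpace (GlobalSeq N) :=
  TopologicalSpace.generateFrom {V | ∃ (x : GlobalSeq N) (γ : Δ), V = {y | y.restrict γ = x.restrict γ}}

/-- The supports satisfying the maximum condition: no strictly increasing infinite sequences. -/
def maxSupports (Δ : Type) [PartialOrder Δ] : Set (Set Δ) :=
  {A | ∀ f : ℕ → Δ, StrictMono f → ¬ ∀ n, f n ∈ A}

/-- The supports satisfying Malicki's condition: moreover, no strictly decreasing infinite
sequence has a lower bound in `Δ`. -/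
def wspSupports (Δ : Type) [PartialOrder Δ] : Set (Set Δ) :=
  {A | A ∈ maxSupports Δ ∧
    ∀ f : ℕ → Δ, StrictAnti f → (∀ n, f n ∈ A) → ¬ BddBelow (Set.range f)}

/-- The locally finite supports. -/
def lfSupports (Δ : Type) [PartialOrder Δ] : Set (Set Δ) :=
  {A | ∀ δ : Δ, (A ∩ Set.Ici δ).Finite}

end Sequences

/-! ### Wreath products over global domains -/

section Global

variable {Δ : Type} [PartialOrder Δ]

/-- A global domain: a set of sequences closed under pointwise perturbations. -/
structure GlobalDomain (N : Δ → ℕ∞) where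
  carrier : Set (GlobalSeq N)
  perturb : ∀ x ∈ carrier, ∀ (δ : Δ) (i : Coord N δ),
    ∃ y ∈ carrier, y δ = i ∧ ∀ γ, δ < γ → y γ = x γ

variable {N : Δ → ℕ∞}

/-- Condition (H1). -/
def CondH1 (S : GlobalDomain N) (g : Equiv.Perm S.carrier) : Prop :=
  ∀ (x y : S.carrier) (δ : Δ),
    x.1.restrict δ = y.1.restrict δ ↔ (g x).1.restrict δ = (g y).1.restrict δ

/-- Condition (H2) for full symmetric groups: for all `x` and `δ` and every choice of elements
`c i = x^δ_i` of the domain, the map `i ↦ g (x^δ_i) (δ)` is a permutation of `N δ`. -/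
def CondH2 (S : GlobalDomain N) (g : Equiv.Perm S.carrier) : Prop :=
  ∀ (x : S.carrier) (δ : Δ) (c : Coord N δ → S.carrier),
    (∀ i, (c i).1 δ = i ∧ ∀ γ, δ < γ → (c i).1 γ = x.1 γ) →
      Function.Bijective fun i => (g (c i)).1 δ

theorem restrict_eq_iff (x y : GlobalSeq N) (δ : Δ) :
    x.restrict δ = y.restrict δ ↔ ∀ γ, δ ≤ γ → x γ = y γ :=
  ⟨fun h γ hγ => congrFun h ⟨γ, hγ⟩, fun h => funext fun γ => h γ.1 γ.2⟩

theorem condH2_of_condH1 {S : GlobalDomain N} {g : Equiv.Perm S.carrier} (hg : CondH1 S g) :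
    CondH2 S g := by
  intro x δ c hc
  have key : ∀ y : S.carrier, (∀ γ, δ < γ → y.1 γ = x.1 γ) ↔
      ∀ γ, δ < γ → (g y).1 γ = (g x).1 γ := by
    intro y
    have aux : ∀ u v : GlobalSeq N, (∀ γ, δ < γ → u γ = v γ) ↔
        ∀ γ, δ < γ → u.restrict γ = v.restrict γ := fun u v =>
      ⟨fun h γ hγ => (restrict_eq_iff _ _ _).2 fun β hβ => h β (hγ.trans_le hβ),
        fun h γ hγ => (restrict_eq_iff _ _ _).1 (h γ hγ) γ le_rfl⟩
    rw [aux, aux]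
    exact forall_congr' fun γ => imp_congr_right fun _ => hg y x γ
  constructor
  · intro i j hij
    have h : (g (c i)).1.restrict δ = (g (c j)).1.restrict δ := by
      rw [restrict_eq_iff]
      intro γ hγ
      rcases hγ.eq_or_lt with rfl | hlt
      · exact hij
      · rw [(key (c i)).1 (hc i).2 γ hlt, (key (c j)).1 (hc j).2 γ hlt]
    have h' := (restrict_eq_iff _ _ _).1 ((hg _ _ _).2 h) δ le_rfl
    rwa [(hc i).1, (hc j).1] at h'
  · intro j
    obtain ⟨y, hy, hyj, hyγ⟩ := S.perturb (g x).1 (g x).2 δ j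
    set w : S.carrier := g.symm ⟨y, hy⟩ with hw
    have hgw : g w = ⟨y, hy⟩ := g.apply_symm_apply _
    have hwx : ∀ γ, δ < γ → w.1 γ = x.1 γ := (key w).2 (by rw [hgw]; exact hyγ)
    refine ⟨w.1 δ, ?_⟩
    have h : (c (w.1 δ)).1.restrict δ = w.1.restrict δ := by
      rw [restrict_eq_iff]
      intro γ hγ
      rcases hγ.eq_or_lt with rfl | hlt
      · exact (hc _).1
      · rw [(hc _).2 γ hlt, hwx γ hlt]
    have h' := (restrict_eq_iff _ _ _).1 ((hg _ _ _).1 h) δ le_rfl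
    rw [hgw] at h'
    exact h'.trans hyj

/-- The generalized wreath product of the full symmetric groups `Sym (N δ)` over the global
domain `S`. -/
def wreath (S : GlobalDomain N) : Subgroup (Equiv.Perm S.carrier) where
  carrier := {g | CondH1 S g ∧ CondH2 S g}
  mul_mem' := by
    rintro f g ⟨hf, -⟩ ⟨hg, -⟩
    have h : CondH1 S (f * g) := fun x y δ => (hg x y δ).trans (hf (g x) (g y) δ)
    exact ⟨h, condH2_of_condH1 h⟩
  one_mem' :=
    have h : CondH1 S 1 := fun _ _ _ => Iff.rfl
    ⟨h, condH2_of_condH1 h⟩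
  inv_mem' := by
    rintro f ⟨hf, -⟩
    have h : CondH1 S f⁻¹ := fun x y δ => by
      rw [hf (f⁻¹ x), perm_apply_inv, perm_apply_inv]
    exact ⟨h, condH2_of_condH1 h⟩

/-- Pointwise convergence with respect to the relative topology `τ_Δ` on `S`. -/
instance wreathTopology (S : GlobalDomain N) : TopologicalSpace (wreath S) :=
  TopologicalSpace.induced (fun (g : wreath S) (x : S.carrier) => g.1 x) inferInstance

/-- Approximate homogeneity of a global domain. -/
def GlobalDomain.IsApproxHomogeneous (S : GlobalDomain N) : Prop :=
  ∀ (x y : S.carrier) (δ : Δ), ∃ g ∈ wreath S, (g x).1.restrict δ = y.1.restrict δ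

/-- `S` consists of all sequences whose restrictions to the cones are restrictions of elements
of `S`. This implies that `S` is closed for `τ_Δ`, and is equivalent to it if `Δ` is linear. -/
def GlobalDomain.IsLocallyDetermined (S : GlobalDomain N) : Prop :=
  ∀ x : GlobalSeq N, (∀ γ : Δ, ∃ y ∈ S.carrier, x.restrict γ = y.restrict γ) → x ∈ S.carrier

open Classical in
/-- The domain of all sequences whose support belongs to a given family of admissible supports,
which has to be closed under changing finitely many elements. -/
def supportDomain (N : Δ → ℕ∞) (𝒜 : Set (Set Δ))
    (h𝒜 : ∀ A ∈ 𝒜, ∀ A' : Set Δ, (symmDiff A A').Finite → A' ∈ 𝒜) : GlobalDomain N where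
  carrier := {x | supp x ∈ 𝒜}
  perturb := by
    intro x hx δ i
    refine ⟨Function.update x δ i, ?_, Function.update_self .., fun γ hγ =>
      Function.update_of_ne hγ.ne' ..⟩
    refine h𝒜 _ hx _ ((Set.finite_singleton δ).subset fun γ hγ => ?_)
    by_contra hne
    have hne' : γ ≠ δ := hne
    have hval : (Function.update x δ i : GlobalSeq N) γ = x γ := Function.update_of_ne hne' ..
    have : γ ∈ supp x ↔ γ ∈ supp (Function.update x δ i : GlobalSeq N) := by
      change (x γ).1 ≠ 0 ↔ _ ≠ 0
      rw [hval]
    rcases hγ with ⟨h1, h2⟩ | ⟨h1, h2⟩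
    · exact h2 (this.1 h1)
    · exact h2 (this.2 h1)

theorem lfSupports_stable (A : Set Δ) (hA : A ∈ lfSupports Δ) (A' : Set Δ)
    (h : (symmDiff A A').Finite) : A' ∈ lfSupports Δ := by
  intro δ
  refine ((hA δ).union h).subset fun γ hγ => ?_
  by_cases hγA : γ ∈ A
  · exact Or.inl ⟨hγA, hγ.2⟩
  · exact Or.inr (Or.inr ⟨hγ.1, hγA⟩)

/-- An injective sequence in `A'` is eventually in `A` if `A` and `A'` differ finitely. -/
theorem exists_tail_mem {Δ : Type} {A A' : Set Δ} (h : (symmDiff A A').Finite) (f : ℕ → Δ)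
    (hf : Function.Injective f) (hfA : ∀ n, f n ∈ A') : ∃ m, ∀ n, f (n + m) ∈ A := by
  have hfin : (f ⁻¹' (symmDiff A A')).Finite := h.preimage hf.injOn
  obtain ⟨m, hm⟩ := hfin.bddAbove
  refine ⟨m + 1, fun n => ?_⟩
  by_contra hn
  have : n + (m + 1) ≤ m := hm (show f (n + (m + 1)) ∈ symmDiff A A' from
    Or.inr ⟨hfA _, hn⟩)
  omega

theorem wspSupports_stable (A : Set Δ) (hA : A ∈ wspSupports Δ) (A' : Set Δ)
    (h : (symmDiff A A').Finite) : A' ∈ wspSupports Δ := by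
  refine ⟨fun f hf hfA => ?_, fun f hf hfA hb => ?_⟩
  · obtain ⟨m, hm⟩ := exists_tail_mem h f hf.injective hfA
    exact hA.1 (fun n => f (n + m)) (fun a b hab => hf (by omega)) hm
  · obtain ⟨m, hm⟩ := exists_tail_mem h f hf.injective hfA
    refine hA.2 (fun n => f (n + m)) (fun a b hab => hf (by omega)) hm (hb.mono ?_)
    rintro _ ⟨n, rfl⟩
    exact ⟨n + m, rfl⟩

/-- The domain of the sequences with locally finite support. -/
def domainLF (N : Δ → ℕ∞) : GlobalDomain N :=
  supportDomain N (lfSupports Δ) lfSupports_stable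

/-- The domain of the sequences satisfying Malicki's condition. -/
def domainWsp (N : Δ → ℕ∞) : GlobalDomain N :=
  supportDomain N (wspSupports Δ) wspSupports_stable

end Global

/-! ### Projective wreath products and wreath products over local domains -/

section Projective

variable {Δ : Type} [PartialOrder Δ]

/-- A system of projections `⟨S, π⟩`. The family `S` is given by its pieces `S δ`, which
consist of sequences on the cone above `δ`. -/
structure ProjectionSystem (N : Δ → ℕ∞) where
  S : ∀ δ, Set (LocalSeq N δ)
  nonempty : ∀ δ, (S δ).Nonempty
  perturb_mem : ∀ δ, ∀ z ∈ S δ, ∀ i, z.perturb i ∈ S δ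
  proj : ∀ {δ γ : Δ}, δ ≤ γ → S δ → S γ
  proj_surjective : ∀ {δ γ : Δ} (h : δ ≤ γ), Function.Surjective (proj h)
  proj_eq_iff : ∀ {δ γ : Δ} (h : δ ≤ γ) (z z' : S δ),
    proj h z = proj h z' ↔ z.1.restrict h = z'.1.restrict h
  proj_comp : ∀ {δ γ β : Δ} (h : δ ≤ γ) (h' : γ ≤ β) (z : S δ),
    proj h' (proj h z) = proj (h.trans h') z

variable {N : Δ → ℕ∞}

/-- Condition (P1), for a permutation of the union of the sets `S δ` that maps each `S δ` onto
itself, given as the family of its restrictions. -/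
def CondP1 (P : ProjectionSystem N) (g : ∀ δ, Equiv.Perm (P.S δ)) : Prop :=
  ∀ (δ γ : Δ) (h : δ ≤ γ) (z : P.S δ), g γ (P.proj h z) = P.proj h (g δ z)

/-- Condition (P2) for full symmetric groups: `i ↦ g (z^δ_i) (δ)` is a permutation of `N δ`. -/
def CondP2 (P : ProjectionSystem N) (g : ∀ δ, Equiv.Perm (P.S δ)) : Prop :=
  ∀ (δ : Δ) (z : P.S δ),
    Function.Bijective fun i => (g δ ⟨z.1.perturb i, P.perturb_mem δ z.1 z.2 i⟩).1.value

theorem LocalSeq.value_perturb {δ : Δ} (z : LocalSeq N δ) (i : Coord N δ) :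
    (z.perturb i).value = i := by
  classical exact Function.update_self ..

theorem LocalSeq.perturb_apply {δ : Δ} (z : LocalSeq N δ) (i : Coord N δ) (γ : Set.Ici δ)
    (h : δ < γ.1) : z.perturb i γ = z γ := by
  classical exact Function.update_of_ne (fun h' => h.ne' (congrArg Subtype.val h')) ..

theorem LocalSeq.ext_lt {δ : Δ} {z w : LocalSeq N δ} (hv : z.value = w.value)
    (h : ∀ γ (hγ : δ < γ), z.restrict hγ.le = w.restrict hγ.le) : z = w := by
  funext ⟨γ, hγ⟩
  rcases (show δ ≤ γ from hγ).eq_or_lt with rfl | hlt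
  · exact hv
  · exact congrFun (h γ hlt) ⟨γ, le_refl γ⟩

theorem LocalSeq.perturb_restrict {δ γ : Δ} (z : LocalSeq N δ) (i : Coord N δ) (h : δ < γ) :
    (z.perturb i).restrict h.le = z.restrict h.le :=
  funext fun β => z.perturb_apply i _ (h.trans_le β.2)

theorem condP2_of_condP1 {P : ProjectionSystem N} {g : ∀ δ, Equiv.Perm (P.S δ)}
    (hg : CondP1 P g) : CondP2 P g := by
  intro δ z
  have key : ∀ (u v : P.S δ) (γ : Δ) (h : δ < γ), u.1.restrict h.le = v.1.restrict h.le ↔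
      (g δ u).1.restrict h.le = (g δ v).1.restrict h.le := by
    intro u v γ h
    rw [← P.proj_eq_iff, ← P.proj_eq_iff, ← hg, ← hg, (g γ).injective.eq_iff]
  constructor
  · intro i j hij
    have h := (g δ).injective (Subtype.ext (LocalSeq.ext_lt hij fun γ hγ =>
      (key _ _ γ hγ).1 ((LocalSeq.perturb_restrict _ _ hγ).trans (LocalSeq.perturb_restrict _ _ hγ).symm)))
    have h' := congrArg LocalSeq.value (congrArg Subtype.val h)
    rwa [LocalSeq.value_perturb, LocalSeq.value_perturb] at h'
  · intro j
    set y : P.S δ := ⟨(g δ z).1.perturb j, P.perturb_mem δ _ (g δ z).2 j⟩ with hy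
    set w : P.S δ := (g δ).symm y with hw
    have hgw : g δ w = y := (g δ).apply_symm_apply _
    have hwz : ∀ γ (hγ : δ < γ), w.1.restrict hγ.le = z.1.restrict hγ.le := fun γ hγ => by
      rw [key w z γ hγ, hgw]
      exact LocalSeq.perturb_restrict _ _ hγ
    refine ⟨w.1.value, ?_⟩
    have hwe : (⟨z.1.perturb w.1.value, P.perturb_mem δ z.1 z.2 _⟩ : P.S δ) = w := by
      refine Subtype.ext (LocalSeq.ext_lt (LocalSeq.value_perturb _ _) fun γ hγ => ?_)
      exact (LocalSeq.perturb_restrict _ _ hγ).trans (hwz γ hγ).symm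
    simp only [hwe, hgw]
    exact LocalSeq.value_perturb _ _

/-- The projective wreath product of the full symmetric groups `Sym (N δ)`. -/
def projWreath (P : ProjectionSystem N) : Subgroup (∀ δ, Equiv.Perm (P.S δ)) where
  carrier := {g | CondP1 P g ∧ CondP2 P g}
  mul_mem' := by
    rintro f g ⟨hf, -⟩ ⟨hg, -⟩
    have h : CondP1 P (f * g) := fun δ γ hδ z => by
      simp only [Pi.mul_apply, Equiv.Perm.mul_apply, hg δ γ hδ z, hf δ γ hδ]
    exact ⟨h, condP2_of_condP1 h⟩
  one_mem' :=
    have h : CondP1 P 1 := fun _ _ _ _ => rfl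
    ⟨h, condP2_of_condP1 h⟩
  inv_mem' := by
    rintro f ⟨hf, -⟩
    have h : CondP1 P f⁻¹ := fun δ γ hδ z => by
      rw [Pi.inv_apply, Pi.inv_apply, Equiv.Perm.inv_eq_iff_eq, hf, perm_apply_inv]
    exact ⟨h, condP2_of_condP1 h⟩

/-- Pointwise convergence, the union of the sets `S δ` being discrete. -/
instance projWreathTopology (P : ProjectionSystem N) : TopologicalSpace (projWreath P) :=
  TopologicalSpace.induced (fun (g : projWreath P) (p : Σ δ, P.S δ) =>
      (⟨p.1, g.1 p.1 p.2⟩ : Σ δ, P.S δ))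
    (@Pi.topologicalSpace (Σ δ, P.S δ) (fun _ => Σ δ, P.S δ) fun _ => ⊥)

/-- Countability of the union of the sets `S δ`. -/
def ProjectionSystem.IsCountable (P : ProjectionSystem N) : Prop := Countable (Σ δ, P.S δ)

/-- Local homogeneity of a system of projections. -/
def ProjectionSystem.IsLocallyHomogeneous (P : ProjectionSystem N) : Prop :=
  ∀ (δ : Δ) (z z' : P.S δ), ∃ g ∈ projWreath P, g δ z = z'

/-- Fullness: every `z ∈ S δ₀` belongs to a coherent family. -/
def ProjectionSystem.IsFull (P : ProjectionSystem N) : Prop :=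
  ∀ (δ₀ : Δ) (z : P.S δ₀), ∃ c : ∀ δ, P.S δ,
    c δ₀ = z ∧ ∀ (δ γ : Δ) (h : δ ≤ γ), P.proj h (c δ) = c γ

/-- Every element is a restriction of a sequence satisfying the maximum condition. -/
def SubsetMax (S : ∀ δ, Set (LocalSeq N δ)) : Prop :=
  ∀ δ, ∀ z ∈ S δ, ∃ x : GlobalSeq N, supp x ∈ maxSupports Δ ∧ x.restrict δ = z

/-- A family of local domains. -/
structure LocalDomains (N : Δ → ℕ∞) where
  S : ∀ δ, Set (LocalSeq N δ)
  nonempty : ∀ δ, (S δ).Nonempty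
  restrict_eq : ∀ {δ γ : Δ} (h : δ ≤ γ), S γ = LocalSeq.restrict h '' S δ
  perturb_mem : ∀ δ, ∀ z ∈ S δ, ∀ i, z.perturb i ∈ S δ

/-- A family of local domains with the trivial projections, i.e. the restrictions. -/
def LocalDomains.toProjectionSystem (D : LocalDomains N) : ProjectionSystem N where
  S := D.S
  nonempty := D.nonempty
  perturb_mem := D.perturb_mem
  proj := fun h z => ⟨z.1.restrict h, by rw [D.restrict_eq h]; exact ⟨z.1, z.2, rfl⟩⟩
  proj_surjective := by
    rintro δ γ h ⟨w, hw⟩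
    obtain ⟨z, hz, rfl⟩ := D.restrict_eq h ▸ hw
    exact ⟨⟨z, hz⟩, rfl⟩
  proj_eq_iff := fun _ _ _ => Subtype.ext_iff
  proj_comp := fun _ _ _ => rfl

/-- The generalized wreath product of the full symmetric groups `Sym (N δ)` over a family of local
domains: coherence is preservation of restrictions. -/
abbrev localWreath (D : LocalDomains N) := projWreath D.toProjectionSystem

/-- Countability of a family of local domains. -/
def LocalDomains.IsCountable (D : LocalDomains N) : Prop := Countable (Σ δ, D.S δ)

/-- Local homogeneity of a family of local domains. -/
def LocalDomains.IsLocallyHomogeneous (D : LocalDomains N) : Prop :=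
  ∀ (δ : Δ) (z z' : D.S δ), ∃ g ∈ localWreath D, g δ z = z'

/-- Fullness: every element of the family is a restriction of a sequence whose restrictions to
the cones all belong to the family. -/
def LocalDomains.IsFull (D : LocalDomains N) : Prop :=
  ∀ (δ₀ : Δ), ∀ z ∈ D.S δ₀, ∃ x : GlobalSeq N,
    x.restrict δ₀ = z ∧ ∀ γ, x.restrict γ ∈ D.S γ

end Projective

end UltraIso

/-! From spaces to trees: a Polish ultrametric space is encoded by the tree of its open balls with
radii in a countable scale. Completeness makes every tree automorphism come from an isometry
(`BallNode.nonempty_equiv`). Exactness yields property (⋆): a point of one orbit at minimal distance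
from a given point lies in all the balls of a chain at once (`BallNode.hasStar`).

From trees to wreath products: the skeleton is the condensed tree, an `L`-tree by (⋆)
(`IsLTree.isSpecial`), and the label of a class is the number of siblings of its nodes. The heart of
the proof is to give the nodes coordinates with locally finite support. By countability and (⋆),
every node lies on a section of the condensation map (`exists_section`). Enumerate enough sections
to cover the tree, and in each set of siblings give the label 0 to the node on the first section
that meets this set. A node on the `n`-th section then has at most `n + 1` nonzero labels above it
(`IsLabelling.finite_support`), and every finite pattern of labels above a class belongs to exactly
one node of the class (`IsLabelling.exists_node`, `IsLabelling.eq_of_labels_eq`). So the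
automorphism group is the wreath product over the restrictions of the sequences with locally finite
support. Since that domain is locally determined, coherent families of restrictions can be glued,
and the local and global wreath products agree (`GlobalDomain.nonempty_localWreath_equiv`).

From wreath products to spaces: the elements of a system of projections get distances that measure
the set of levels at which their projections do not coincide. Each element is blown up to a fibre
with a rigid ultrametric that codes its index in the skeleton, so that the isometries are exactly
the elements of the wreath product (`FibreSpace.nonempty_equiv`). Local homogeneity and fullness
make the space exact (`FibreSpace.isExact`). Discrete fibres give a uniformly discrete space, Cantor
fibres a perfect locally compact one.

The two support conditions agree because cones are chains, and an infinite chain contains a strictly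
monotone sequence (`lfSupports_eq_wspSupports`). -/

set_option linter.unusedSectionVars false

namespace UltraIso

/-! ### Cones of trees -/

section Cones

variable {T L : Type} [LE T] [LinearOrder L] {lev : T → L}

theorem IsWeakLTree.lev_mono (h : IsWeakLTree lev) {t t' : T} (htt : t ≤ t') :
    lev t ≤ lev t' := by
  by_cases hne : t = t'
  · rw [hne]
  · exact (h.lev_lt t t' htt hne).le

theorem IsWeakLTree.le_of_lev_le (h : IsWeakLTree lev) {t s s' : T} (hs : t ≤ s) (hs' : t ≤ s')
    (hl : lev s ≤ lev s') : s ≤ s' := by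
  obtain ⟨u, ⟨hu, hul⟩, -⟩ := h.existsUnique_above s _ hl
  have := (h.existsUnique_above t (lev s') (h.lev_mono hs')).unique
    ⟨h.le_trans _ _ _ hs hu, hul⟩ ⟨hs', rfl⟩
  exact this ▸ hu

theorem IsWeakLTree.eq_of_lev_eq (h : IsWeakLTree lev) {t s s' : T} (hs : t ≤ s) (hs' : t ≤ s')
    (hl : lev s = lev s') : s = s' :=
  h.le_antisymm _ _ (h.le_of_lev_le hs hs' hl.le) (h.le_of_lev_le hs' hs hl.ge)

theorem IsWeakLTree.le_total_of_le (h : IsWeakLTree lev) {t s s' : T} (hs : t ≤ s)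
    (hs' : t ≤ s') : s ≤ s' ∨ s' ≤ s :=
  (le_total (lev s) (lev s')).imp (h.le_of_lev_le hs hs') (h.le_of_lev_le hs' hs)

end Cones

/-! ### Locally finite supports and Malicki's condition -/

section Supports

variable {Δ : Type} [PartialOrder Δ]

theorem lfSupports_subset_maxSupports : lfSupports Δ ⊆ maxSupports Δ := by
  intro A hA f hf hfA
  refine Set.infinite_of_injective_forall_mem hf.injective (fun n => ?_) (hA (f 0))
  exact ⟨hfA n, hf.monotone (Nat.zero_le n)⟩

theorem lfSupports_eq_wspSupports {N : Δ → ℕ∞} (hN : IsCountableTreeable N) :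
    lfSupports Δ = wspSupports Δ := by
  ext A
  constructor
  · refine fun hA => ⟨lfSupports_subset_maxSupports hA, ?_⟩
    rintro f hf hfA ⟨δ, hδ⟩
    refine Set.infinite_of_injective_forall_mem hf.injective (fun n => ?_) (hA δ)
    exact ⟨hfA n, hδ ⟨n, rfl⟩⟩
  · rintro ⟨hmax, hmin⟩ δ
    obtain ⟨L, _, lev, hT, -⟩ := hN.treeable
    by_contra hinf
    set f := Set.Infinite.natEmbedding _ hinf with hf
    -- Ramsey's theorem for the relation `<`. The cone above `δ` is a chain and the terms are
    -- distinct, so "never increasing" means strictly decreasing, with lower bound `δ`.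
    obtain ⟨g, hg⟩ := exists_increasing_or_nonincreasing_subseq (· < ·) (fun n => (f n).1)
    rcases hg with hg | hg
    · exact hmax (fun n => (f (g n)).1) (fun m n => hg m n) fun n => (f (g n)).2.1
    · refine hmin (fun n => (f (g n)).1) (fun m n hmn => ?_) (fun n => (f (g n)).2.1)
        ⟨δ, by rintro _ ⟨n, rfl⟩; exact (f (g n)).2.2⟩
      have hne : (f (g m)).1 ≠ (f (g n)).1 := fun h =>
        hmn.ne (g.injective (f.injective (Subtype.ext h)))
      rcases hT.le_total_of_le (f (g m)).2.2 (f (g n)).2.2 with h | h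
      · exact absurd (lt_of_le_of_ne h hne) (hg m n hmn)
      · exact lt_of_le_of_ne h hne.symm

theorem domainLF_eq_domainWsp {N : Δ → ℕ∞} (hN : IsCountableTreeable N) :
    domainLF N = domainWsp N := by
  simp only [domainLF, domainWsp, supportDomain, lfSupports_eq_wspSupports hN]

end Supports

/-! ### Continuity of maps into and out of the groups -/

section Continuity

theorem continuous_treeAut {T L : Type} [LE T] [LinearOrder L] {lev : T → L} {X : Type*}
    [TopologicalSpace X] {k : X → treeAut lev}
    (h : ∀ t s, IsOpen {x | (k x).1 t = s}) : Continuous k := by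
  let _ : TopologicalSpace T := ⊥
  have : DiscreteTopology T := ⟨rfl⟩
  refine continuous_induced_rng.2 (continuous_pi fun t => ?_)
  exact continuous_discrete_rng.2 fun s => h t s

theorem isOpen_treeAut {T L : Type} [LE T] [LinearOrder L] (lev : T → L) (t s : T) :
    IsOpen {f : treeAut lev | f.1 t = s} := by
  let _ : TopologicalSpace T := ⊥
  have : DiscreteTopology T := ⟨rfl⟩
  have h : Continuous fun f : treeAut lev => f.1 t :=
    (continuous_apply t).comp continuous_induced_dom
  exact continuous_discrete_rng.1 h s

theorem continuous_projWreath {Δ : Type} [PartialOrder Δ] {N : Δ → ℕ∞} {P : ProjectionSystem N}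
    {X : Type*} [TopologicalSpace X] {k : X → projWreath P}
    (h : ∀ δ (z w : P.S δ), IsOpen {x | (k x).1 δ z = w}) : Continuous k := by
  let _ : TopologicalSpace (Σ δ, P.S δ) := ⊥
  have : DiscreteTopology (Σ δ, P.S δ) := ⟨rfl⟩
  refine continuous_induced_rng.2 (continuous_pi fun p => ?_)
  refine continuous_discrete_rng.2 ?_
  rintro ⟨γ, w⟩
  by_cases hγ : p.1 = γ
  · subst hγ
    convert h p.1 p.2 w using 1
    ext x
    simp
  -- The permutations preserve the pieces of the family, so a value in another piece is never taken.
  · convert isOpen_empty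
    ext x
    simp [hγ]

theorem isOpen_projWreath {Δ : Type} [PartialOrder Δ] {N : Δ → ℕ∞} (P : ProjectionSystem N)
    (δ : Δ) (z w : P.S δ) : IsOpen {g : projWreath P | g.1 δ z = w} := by
  let _ : TopologicalSpace (Σ δ, P.S δ) := ⊥
  have : DiscreteTopology (Σ δ, P.S δ) := ⟨rfl⟩
  have h : Continuous fun g : projWreath P => (⟨δ, g.1 δ z⟩ : Σ δ, P.S δ) :=
    (continuous_apply (A := fun _ : Σ δ, P.S δ => Σ δ, P.S δ) ⟨δ, z⟩).comp
      (continuous_induced_dom (f := fun (g : projWreath P) (p : Σ δ, P.S δ) =>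
        (⟨p.1, g.1 p.1 p.2⟩ : Σ δ, P.S δ)))
  convert continuous_discrete_rng.1 h ⟨δ, w⟩ using 1
  ext g
  simp

theorem continuous_wreath {Δ : Type} [PartialOrder Δ] {N : Δ → ℕ∞} {S : GlobalDomain N}
    {X : Type*} [TopologicalSpace X] {k : X → wreath S}
    (h : ∀ (x : S.carrier) (w : GlobalSeq N) (γ : Δ),
      IsOpen {a | ((k a).1 x).1.restrict γ = w.restrict γ}) : Continuous k := by
  refine continuous_induced_rng.2 (continuous_pi fun x => continuous_induced_rng.2 ?_)
  refine continuous_generateFrom_iff.2 ?_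
  rintro _ ⟨w, γ, rfl⟩
  exact h x w γ

theorem isOpen_restrict_eq {Δ : Type} [PartialOrder Δ] {N : Δ → ℕ∞} (w : GlobalSeq N) (γ : Δ) :
    IsOpen {y : GlobalSeq N | y.restrict γ = w.restrict γ} :=
  TopologicalSpace.isOpen_generateFrom_of_mem ⟨w, γ, rfl⟩

theorem isOpen_wreath {Δ : Type} [PartialOrder Δ] {N : Δ → ℕ∞} (S : GlobalDomain N)
    (x : S.carrier) (w : GlobalSeq N) (γ : Δ) :
    IsOpen {g : wreath S | (g.1 x).1.restrict γ = w.restrict γ} := by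
  have h : Continuous fun g : wreath S => (g.1 x).1 :=
    continuous_subtype_val.comp ((continuous_apply x).comp continuous_induced_dom)
  exact (isOpen_restrict_eq w γ).preimage h

theorem continuous_iso {U : Type} [MetricSpace U] {X : Type*} [TopologicalSpace X]
    {k : X → (U ≃ᵢ U)} (h : ∀ u, Continuous fun x => k x u) : Continuous k :=
  continuous_induced_rng.2 (continuous_pi h)

theorem continuous_iso_apply {U : Type} [MetricSpace U] (u : U) :
    Continuous fun φ : U ≃ᵢ U => φ u :=
  (continuous_apply u).comp continuous_induced_dom

/-- A bijective homomorphism that is continuous in both directions. -/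
theorem nonempty_continuousMulEquiv {G H : Type*} [Group G] [Group H] [TopologicalSpace G]
    [TopologicalSpace H] (Φ : G →* H) (hΦ : Function.Bijective Φ) (hc : Continuous Φ)
    (hc' : Continuous (MulEquiv.ofBijective Φ hΦ).symm) : Nonempty (G ≃ₜ* H) :=
  ⟨{ MulEquiv.ofBijective Φ hΦ with
      continuous_toFun := hc
      continuous_invFun := hc' }⟩

theorem ofBijective_symm_eq {G H : Type*} [Group G] [Group H] {Φ : G →* H}
    {hΦ : Function.Bijective Φ} (h : H) : Φ ((MulEquiv.ofBijective Φ hΦ).symm h) = h :=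
  (MulEquiv.ofBijective Φ hΦ).apply_symm_apply h

end Continuity

/-! ### Locally determined global domains -/

section LocallyDetermined

variable {Δ : Type} [PartialOrder Δ] {N : Δ → ℕ∞}

/-- The family of all restrictions of elements of a global domain. -/
def GlobalDomain.localDomains (S : GlobalDomain N) (hS : S.carrier.Nonempty) :
    LocalDomains N where
  S δ := (fun x => x.restrict δ) '' S.carrier
  nonempty _ := hS.image _
  restrict_eq h := by rw [Set.image_image]; rfl
  perturb_mem := by
    rintro δ _ ⟨x, hx, rfl⟩ i
    obtain ⟨y, hy, hi, hγ⟩ := S.perturb x hx δ i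
    refine ⟨y, hy, LocalSeq.ext_lt ?_ fun γ hlt => ?_⟩
    · rw [LocalSeq.value_perturb]
      exact hi
    · rw [LocalSeq.perturb_restrict _ _ hlt]
      exact funext fun β => hγ _ (hlt.trans_le β.2)

variable (S : GlobalDomain N) (hS : S.carrier.Nonempty)

/-- The restrictions of elements of a global domain, with the trivial projections. -/
abbrev GlobalDomain.projections : ProjectionSystem N := (S.localDomains hS).toProjectionSystem

/-- The restriction of an element of the domain, as an element of the local domain. -/
def GlobalDomain.res (x : S.carrier) (δ : Δ) : (S.projections hS).S δ :=
  ⟨x.1.restrict δ, x.1, x.2, rfl⟩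

/-- The sequence obtained from a coherent family by evaluating at the vertices of the cones. -/
def GlobalDomain.glue (f : ∀ δ, Equiv.Perm ((S.projections hS).S δ)) (x : S.carrier) :
    GlobalSeq N := fun δ => (f δ (S.res hS x δ)).1.value

variable {S hS}

theorem GlobalDomain.glue_restrict {f : ∀ δ, Equiv.Perm ((S.projections hS).S δ)}
    (hf : f ∈ projWreath (S.projections hS)) (x : S.carrier) (δ : Δ) :
    (S.glue hS f x).restrict δ = (f δ (S.res hS x δ)).1 := by
  funext ⟨γ, hγ⟩
  have h := congrArg Subtype.val (hf.1 δ γ hγ (S.res hS x δ))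
  exact congrFun h ⟨γ, le_refl γ⟩

/-- This is where local determination is needed: on each cone the glued sequence is a restriction of
some element of `S`, possibly a different one for each cone. -/
theorem GlobalDomain.glue_mem (hld : S.IsLocallyDetermined)
    {f : ∀ δ, Equiv.Perm ((S.projections hS).S δ)}
    (hf : f ∈ projWreath (S.projections hS)) (x : S.carrier) :
    S.glue hS f x ∈ S.carrier := by
  refine hld _ fun γ => ?_
  obtain ⟨y, hy, hyx⟩ := (f γ (S.res hS x γ)).2
  exact ⟨y, hy, (glue_restrict hf x γ).trans hyx.symm⟩

theorem GlobalSeq.ext_restrict {x y : GlobalSeq N} (h : ∀ δ, x.restrict δ = y.restrict δ) :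
    x = y :=
  funext fun δ => congrFun (h δ) ⟨δ, le_refl δ⟩

theorem GlobalDomain.res_glue (hld : S.IsLocallyDetermined)
    {f : ∀ δ, Equiv.Perm ((S.projections hS).S δ)}
    (hf : f ∈ projWreath (S.projections hS)) (x : S.carrier) (δ : Δ) :
    S.res hS ⟨S.glue hS f x, glue_mem hld hf x⟩ δ = f δ (S.res hS x δ) :=
  Subtype.ext (glue_restrict hf x δ)

theorem GlobalDomain.ext_res {x y : S.carrier} (h : ∀ δ, S.res hS x δ = S.res hS y δ) : x = y :=
  Subtype.ext (GlobalSeq.ext_restrict fun δ => congrArg Subtype.val (h δ))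

/-- The permutation of the domain glued from an element of the local wreath product. -/
def GlobalDomain.gluePerm (hld : S.IsLocallyDetermined)
    (f : projWreath (S.projections hS)) : Equiv.Perm S.carrier where
  toFun x := ⟨S.glue hS f.1 x, glue_mem hld f.2 x⟩
  invFun x := ⟨S.glue hS (f⁻¹).1 x, glue_mem hld (f⁻¹).2 x⟩
  left_inv x := ext_res (hS := hS) fun δ => by
    rw [res_glue hld (f⁻¹).2, res_glue hld f.2]
    exact (f.1 δ).symm_apply_apply _
  right_inv x := ext_res (hS := hS) fun δ => by
    rw [res_glue hld f.2, res_glue hld (f⁻¹).2]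
    exact (f.1 δ).apply_symm_apply _

theorem GlobalDomain.res_gluePerm (hld : S.IsLocallyDetermined)
    (f : projWreath (S.projections hS)) (x : S.carrier) (δ : Δ) :
    S.res hS (gluePerm hld f x) δ = f.1 δ (S.res hS x δ) :=
  res_glue hld f.2 x δ

theorem GlobalDomain.res_eq_iff {x y : S.carrier} {δ : Δ} :
    S.res hS x δ = S.res hS y δ ↔ x.1.restrict δ = y.1.restrict δ :=
  Subtype.ext_iff

theorem GlobalDomain.gluePerm_mem (hld : S.IsLocallyDetermined)
    (f : projWreath (S.projections hS)) : gluePerm hld f ∈ wreath S := by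
  have h : CondH1 S (gluePerm hld f) := fun x y δ => by
    rw [← res_eq_iff (hS := hS), ← res_eq_iff (hS := hS), res_gluePerm, res_gluePerm,
      (f.1 δ).injective.eq_iff]
  exact ⟨h, condH2_of_condH1 h⟩

/-- Gluing as a homomorphism. -/
def GlobalDomain.glueHom (hld : S.IsLocallyDetermined) :
    projWreath (S.projections hS) →* wreath S where
  toFun f := ⟨gluePerm hld f, gluePerm_mem hld f⟩
  map_one' := Subtype.ext <| Equiv.ext fun x => ext_res (hS := hS) fun δ => by
    rw [res_gluePerm]; rfl
  map_mul' f g := Subtype.ext <| Equiv.ext fun x => ext_res (hS := hS) fun δ => by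
    change _ = S.res hS (gluePerm hld f (gluePerm hld g x)) δ
    rw [res_gluePerm, res_gluePerm, res_gluePerm]; rfl

theorem GlobalDomain.exists_res (S : GlobalDomain N) (hS : S.carrier.Nonempty) {δ : Δ}
    (z : (S.projections hS).S δ) : ∃ x : S.carrier, S.res hS x δ = z := by
  obtain ⟨_, x, hx, rfl⟩ := z
  exact ⟨⟨x, hx⟩, rfl⟩

/-- By (H1) the restriction of `g x` to a cone depends only on the restriction of `x`, so `g` acts
on restrictions through arbitrary representatives. -/
theorem GlobalDomain.exists_localWreath (S : GlobalDomain N) (hS : S.carrier.Nonempty)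
    (g : Equiv.Perm S.carrier) (hg : g ∈ wreath S) :
    ∃ f ∈ projWreath (S.projections hS), ∀ x δ, f δ (S.res hS x δ) = S.res hS (g x) δ := by
  choose r hr using fun δ (z : (S.projections hS).S δ) => S.exists_res hS z
  have key : ∀ h ∈ wreath S, ∀ x δ,
      S.res hS (h (r δ (S.res hS x δ))) δ = S.res hS (h x) δ := fun h hh x δ =>
    res_eq_iff.2 ((hh.1 _ _ _).1 (res_eq_iff.1 (hr δ _)))
  let f : ∀ δ, Equiv.Perm ((S.projections hS).S δ) := fun δ =>
    { toFun := fun z => S.res hS (g (r δ z)) δ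
      invFun := fun z => S.res hS (g⁻¹ (r δ z)) δ
      left_inv := fun z => by
        beta_reduce
        rw [key _ (inv_mem hg)]
        exact (congrArg (S.res hS · δ) (g.symm_apply_apply _)).trans (hr δ z)
      right_inv := fun z => by
        beta_reduce
        rw [key _ hg]
        exact (congrArg (S.res hS · δ) (g.apply_symm_apply _)).trans (hr δ z) }
  have hf : ∀ x δ, f δ (S.res hS x δ) = S.res hS (g x) δ := fun x δ => key g hg x δ
  have hP1 : CondP1 (S.projections hS) f := by
    intro δ γ h z
    obtain ⟨x, rfl⟩ := S.exists_res hS z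
    exact (hf x γ).trans (congrArg ((S.projections hS).proj h) (hf x δ).symm)
  exact ⟨f, ⟨hP1, condP2_of_condP1 hP1⟩, hf⟩

theorem GlobalDomain.glueHom_bijective (hld : S.IsLocallyDetermined) :
    Function.Bijective (glueHom (hS := hS) hld) := by
  constructor
  · intro f g hfg
    refine Subtype.ext (funext fun δ => Equiv.ext fun z => ?_)
    obtain ⟨x, rfl⟩ := S.exists_res hS z
    rw [← res_gluePerm hld, ← res_gluePerm hld]
    exact congrArg (fun k : wreath S => S.res hS (k.1 x) δ) hfg
  · intro g
    obtain ⟨f, hf, hfg⟩ := S.exists_localWreath hS g.1 g.2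
    refine ⟨⟨f, hf⟩, Subtype.ext <| Equiv.ext fun x => ext_res (hS := hS) fun δ => ?_⟩
    exact (res_gluePerm hld ⟨f, hf⟩ x δ).trans (hfg x δ)

theorem GlobalDomain.nonempty_localWreath_equiv (hld : S.IsLocallyDetermined) :
    Nonempty (projWreath (S.projections hS) ≃ₜ* wreath S) := by
  refine nonempty_continuousMulEquiv (glueHom hld) (glueHom_bijective hld) ?_ ?_
  · refine continuous_wreath fun x w γ => ?_
    -- The basic open set is given by an arbitrary sequence `w`, whose restriction need not come
    -- from `S`; in that case the preimage is empty.
    by_cases h : ∃ y ∈ S.carrier, y.restrict γ = w.restrict γ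
    · obtain ⟨y, hy, hyw⟩ := h
      convert isOpen_projWreath (S.projections hS) γ (S.res hS x γ)
        (S.res hS ⟨y, hy⟩ γ) using 1
      ext f
      change _ = _ ↔ f.1 γ (S.res hS x γ) = _
      rw [← res_gluePerm hld, res_eq_iff, ← hyw]
      rfl
    · convert isOpen_empty
      refine Set.eq_empty_of_forall_notMem fun f hf => h ⟨_, Subtype.prop _, hf⟩
  · refine continuous_projWreath fun δ z w => ?_
    obtain ⟨x, rfl⟩ := S.exists_res hS z
    obtain ⟨y, rfl⟩ := S.exists_res hS w
    convert isOpen_wreath S x y.1 δ using 1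
    ext g
    change (_ : (S.projections hS).S δ) = _ ↔ _
    rw [← res_gluePerm hld, res_eq_iff]
    exact iff_of_eq (congrArg (fun k : wreath S => (k.1 x).1.restrict δ = y.1.restrict δ)
      (ofBijective_symm_eq (Φ := glueHom (hS := hS) hld) (hΦ := glueHom_bijective hld) g))

theorem GlobalDomain.localDomains_isLocallyHomogeneous (hah : S.IsApproxHomogeneous) :
    (S.localDomains hS).IsLocallyHomogeneous := by
  intro δ z w
  obtain ⟨x, rfl⟩ := S.exists_res hS z
  obtain ⟨y, rfl⟩ := S.exists_res hS w
  obtain ⟨g, hg, hgx⟩ := hah x y δ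
  obtain ⟨f, hf, hfg⟩ := S.exists_localWreath hS g hg
  exact ⟨f, hf, (hfg x δ).trans (res_eq_iff.2 hgx)⟩

theorem GlobalDomain.localDomains_isFull : (S.localDomains hS).IsFull := by
  rintro δ _ ⟨x, hx, rfl⟩
  exact ⟨x, rfl, fun γ => ⟨x, hx, rfl⟩⟩

theorem GlobalDomain.localDomains_isCountable [Countable Δ]
    (hsep : TopologicalSpace.SeparableSpace S.carrier) :
    (S.localDomains hS).IsCountable := by
  obtain ⟨Q, hQ, hd⟩ := hsep
  have : ∀ δ, Countable ((S.localDomains hS).S δ) := fun δ => by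
    have := hQ.to_subtype
    refine Function.Surjective.countable (f := fun q : Q => S.res hS q.1 δ) fun z => ?_
    obtain ⟨x, rfl⟩ := S.exists_res hS z
    obtain ⟨q, hqx, hq⟩ := hd.inter_open_nonempty _
      ((isOpen_restrict_eq x.1 δ).preimage continuous_subtype_val) ⟨x, rfl⟩
    exact ⟨⟨q, hq⟩, res_eq_iff.2 hqx⟩
  unfold LocalDomains.IsCountable
  infer_instance

theorem LocalDomains.isFull_toProjectionSystem {D : LocalDomains N} (hD : D.IsFull) :
    D.toProjectionSystem.IsFull := by
  intro δ z
  obtain ⟨x, hx, hx'⟩ := hD δ z.1 z.2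
  exact ⟨fun γ => ⟨x.restrict γ, hx' γ⟩, Subtype.ext hx, fun _ _ _ => rfl⟩

theorem GlobalDomain.IsLocallyDetermined.isClosed (hld : S.IsLocallyDetermined) :
    IsClosed S.carrier := by
  refine ⟨isOpen_iff_forall_mem_open.2 fun x hx => ?_⟩
  have : ∃ γ, ∀ y ∈ S.carrier, x.restrict γ ≠ y.restrict γ := by
    by_contra! h
    exact hx (hld x h)
  obtain ⟨γ, hγ⟩ := this
  exact ⟨_, fun y hy hyS => hγ y hyS hy.symm, isOpen_restrict_eq x γ, rfl⟩

end LocallyDetermined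

/-! ### The domain of sequences with locally finite support -/

section LocallyFinite

variable {Δ : Type} [PartialOrder Δ] {N : Δ → ℕ∞}

theorem domainLF_isLocallyDetermined : (domainLF N).IsLocallyDetermined := by
  intro x hx δ
  obtain ⟨y, hy, hxy⟩ := hx δ
  refine (hy δ).subset fun γ hγ => ⟨?_, hγ.2⟩
  have : x γ = y γ := congrFun hxy ⟨γ, hγ.2⟩
  exact fun h => hγ.1 ((congrArg Subtype.val this).trans h)

instance (δ : Δ) : DecidableEq (Coord N δ) := inferInstanceAs (DecidableEq {_n : ℕ // _})

/-- The zero sequence. -/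
def zeroSeq (hN : ∀ δ, N δ ≠ 0) : GlobalSeq N := fun δ => ⟨0, pos_iff_ne_zero.2 (hN δ)⟩

theorem zeroSeq_mem (hN : ∀ δ, N δ ≠ 0) : zeroSeq hN ∈ (domainLF N).carrier := by
  intro δ
  convert Set.finite_empty
  refine Set.eq_empty_of_forall_notMem fun γ hγ => hγ.1 rfl

/-- The coordinatewise action of a family of permutations that is locally almost trivial. -/
def coordPerm (p : ∀ δ, Equiv.Perm (Coord N δ))
    (hp : ∀ δ, ({γ | p γ ≠ 1} ∩ Set.Ici δ).Finite) : Equiv.Perm (domainLF N).carrier :=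
  have key : ∀ q : ∀ δ, Equiv.Perm (Coord N δ), (∀ δ, ({γ | q γ ≠ 1} ∩ Set.Ici δ).Finite) →
      ∀ x ∈ (domainLF N).carrier, (fun δ => q δ (x δ) : GlobalSeq N) ∈ (domainLF N).carrier := by
    intro q hq x hx δ
    refine ((hx δ).union (hq δ)).subset fun γ hγ => ?_
    by_cases h : q γ = 1
    · refine Or.inl ⟨fun h0 => hγ.1 ?_, hγ.2⟩
      simpa [h] using h0
    · exact Or.inr ⟨h, hγ.2⟩
  { toFun := fun x => ⟨fun δ => p δ (x.1 δ), key p hp x.1 x.2⟩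
    invFun := fun x => ⟨fun δ => (p δ)⁻¹ (x.1 δ),
      key (fun δ => (p δ)⁻¹) (by simpa [inv_eq_one] using hp) x.1 x.2⟩
    left_inv := fun x => Subtype.ext <| funext fun δ => (p δ).symm_apply_apply _
    right_inv := fun x => Subtype.ext <| funext fun δ => (p δ).apply_symm_apply _ }

theorem coordPerm_mem (p : ∀ δ, Equiv.Perm (Coord N δ))
    (hp : ∀ δ, ({γ | p γ ≠ 1} ∩ Set.Ici δ).Finite) : coordPerm p hp ∈ wreath (domainLF N) := by
  have h : CondH1 (domainLF N) (coordPerm p hp) := fun x y δ => by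
    rw [restrict_eq_iff, restrict_eq_iff]
    exact forall₂_congr fun γ _ => (p γ).injective.eq_iff.symm
  exact ⟨h, condH2_of_condH1 h⟩

/-- Transpose the values of `x` and `y` in each coordinate above `δ`. Where both values are 0 this
changes nothing, so only finitely many transpositions are nontrivial. -/
theorem domainLF_isApproxHomogeneous : (domainLF N).IsApproxHomogeneous := by
  classical
  intro x y δ
  let p : ∀ γ, Equiv.Perm (Coord N γ) := fun γ =>
    if δ ≤ γ then Equiv.swap (x.1 γ) (y.1 γ) else 1
  have hp : ∀ β, ({γ | p γ ≠ 1} ∩ Set.Ici β).Finite := fun β => by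
    refine ((x.2 δ).union (y.2 δ)).subset ?_
    rintro γ ⟨hγ, -⟩
    by_cases hδ : δ ≤ γ
    · by_contra hn
      have hx : (x.1 γ).1 = 0 := by by_contra h; exact hn (Or.inl ⟨h, hδ⟩)
      have hy : (y.1 γ).1 = 0 := by by_contra h; exact hn (Or.inr ⟨h, hδ⟩)
      have : x.1 γ = y.1 γ := Subtype.ext (hx.trans hy.symm)
      exact hγ (by simp [p, hδ, this, Equiv.Perm.one_def])
    · exact absurd (by simp [p, hδ]) hγ
  refine ⟨coordPerm p hp, coordPerm_mem p hp, ?_⟩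
  rw [restrict_eq_iff]
  intro γ hγ
  change p γ (x.1 γ) = _
  simp [p, hγ]

theorem countable_finite_supp {Δ : Type} {N : Δ → ℕ∞} [Countable Δ] :
    {x : GlobalSeq N | (supp x).Finite}.Countable := by
  let k : {x : GlobalSeq N | (supp x).Finite} → (Δ →₀ ℕ) := fun x =>
    Finsupp.ofSupportFinite (fun δ => (x.1 δ).1) x.2
  refine Set.countable_coe_iff.1 (Function.Injective.countable (f := k) fun x y hxy => ?_)
  exact Subtype.ext <| funext fun δ => Subtype.ext (DFunLike.congr_fun hxy δ)

/-- The sequences of finite support are dense: a basic open set prescribes values on finitely many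
cones, and each of them meets the support in a finite set, so a point can be truncated to zero
elsewhere. -/
theorem domainLF_separable [Countable Δ] (hN : ∀ δ, N δ ≠ 0) :
    TopologicalSpace.SeparableSpace (domainLF N).carrier := by
  classical
  refine ⟨{x | (supp x.1).Finite}, countable_finite_supp.preimage Subtype.val_injective, ?_⟩
  have hb := (TopologicalSpace.isTopologicalBasis_of_subbasis
    (rfl : (tauTopology : TopologicalSpace (GlobalSeq N)) = _)).induced
      (Subtype.val : (domainLF N).carrier → _)
  refine hb.dense_iff.2 ?_
  rintro _ ⟨_, ⟨f, ⟨hf, hfs⟩, rfl⟩, rfl⟩ ⟨x, hx⟩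
  choose w γ hwγ using hfs
  have := hf.to_subtype
  let A : Set Δ := ⋃ V : f, supp x.1 ∩ Set.Ici (γ V.2)
  have hA : A.Finite := Set.finite_iUnion fun V => x.2 _
  let y : GlobalSeq N := fun δ => if δ ∈ A then x.1 δ else zeroSeq hN δ
  have hy : (supp y).Finite := hA.subset fun δ hδ => by
    by_contra h
    exact hδ (by simp [y, h, zeroSeq])
  refine ⟨⟨y, fun δ => hy.subset Set.inter_subset_left⟩, fun V hV => ?_, hy⟩
  have hxV := hx V hV
  rw [hwγ hV] at hxV ⊢
  refine Eq.trans ?_ hxV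
  rw [restrict_eq_iff]
  intro δ hδ
  by_cases h : δ ∈ A
  · simp [y, h]
  · have h0 : (x.1 δ).1 = 0 := by
      by_contra h0
      exact h (Set.mem_iUnion.2 ⟨⟨V, hV⟩, h0, hδ⟩)
    simp only [y, h, if_false]
    exact Subtype.ext h0.symm

theorem subsetMax_domainLF (hS : (domainLF N).carrier.Nonempty) :
    SubsetMax ((domainLF N).localDomains hS).S := by
  rintro δ _ ⟨x, hx, rfl⟩
  exact ⟨x, lfSupports_subset_maxSupports hx, rfl⟩

end LocallyFinite

/-! ### Condensed trees -/

section CondensedTrees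

variable {T L : Type} [LE T] [LinearOrder L] {lev : T → L}

theorem Condensed.mk_eq_iff {t t' : T} :
    Condensed.mk lev t = Condensed.mk lev t' ↔ ∃ f ∈ treeAut lev, f t = t' :=
  Quotient.eq (r := orbitSetoid lev)

theorem Condensed.exists_rep (δ : Condensed lev) : ∃ t, Condensed.mk lev t = δ :=
  Quotient.exists_rep δ

theorem Condensed.mk_apply {f : Equiv.Perm T} (hf : f ∈ treeAut lev) (t : T) :
    Condensed.mk lev (f t) = Condensed.mk lev t :=
  (mk_eq_iff.2 ⟨f, hf, rfl⟩).symm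

theorem Condensed.mk_le_iff {t t' : T} :
    Condensed.mk lev t ≤ Condensed.mk lev t' ↔ ∃ f ∈ treeAut lev, f t ≤ t' := by
  constructor
  · rintro ⟨a, b, ha, hb, hab⟩
    obtain ⟨f, hf, rfl⟩ := mk_eq_iff.1 ha
    obtain ⟨g, hg, rfl⟩ := mk_eq_iff.1 hb
    refine ⟨g * f⁻¹, mul_mem hg (inv_mem hf), ?_⟩
    rw [Equiv.Perm.mul_apply, show f⁻¹ (f a) = a from f.symm_apply_apply a]
    exact (hg.2 a b).1 hab
  · rintro ⟨f, hf, h⟩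
    exact ⟨f t, t', mk_apply hf t, rfl, h⟩

theorem Condensed.mk_le_mk {t t' : T} (h : t ≤ t') :
    Condensed.mk lev t ≤ Condensed.mk lev t' :=
  ⟨t, t', rfl, rfl, h⟩

/-- Automorphisms carry a witness of the inequality between classes to the given representative.
This turns each axiom for the condensed tree into the one for the tree itself. -/
theorem Condensed.exists_ge {t : T} {δ : Condensed lev} (h : Condensed.mk lev t ≤ δ) :
    ∃ s, t ≤ s ∧ Condensed.mk lev s = δ := by
  obtain ⟨t', rfl⟩ := exists_rep δ
  obtain ⟨f, hf, hft⟩ := mk_le_iff.1 h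
  refine ⟨f⁻¹ t', ?_, mk_apply (inv_mem hf) t'⟩
  rw [hf.2, perm_apply_inv]
  exact hft

theorem Condensed.exists_le {t : T} {δ : Condensed lev} (h : δ ≤ Condensed.mk lev t) :
    ∃ s, s ≤ t ∧ Condensed.mk lev s = δ := by
  obtain ⟨t', rfl⟩ := exists_rep δ
  obtain ⟨f, hf, hft⟩ := mk_le_iff.1 h
  exact ⟨f t', hft, mk_apply hf t'⟩

theorem IsWeakLTree.condensed (h : IsWeakLTree lev) : IsWeakLTree (Condensed.lev lev) where
  le_refl δ := by
    obtain ⟨t, rfl⟩ := δ.exists_rep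
    exact Condensed.mk_le_mk (h.le_refl t)
  le_trans δ δ' δ'' h₁ h₂ := by
    obtain ⟨t, rfl⟩ := δ.exists_rep
    obtain ⟨s, hs, rfl⟩ := Condensed.exists_ge h₁
    obtain ⟨u, hu, rfl⟩ := Condensed.exists_ge h₂
    exact Condensed.mk_le_mk (h.le_trans _ _ _ hs hu)
  le_antisymm δ δ' h₁ h₂ := by
    obtain ⟨t, rfl⟩ := δ.exists_rep
    obtain ⟨s, hs, rfl⟩ := Condensed.exists_ge h₁
    obtain ⟨u, hu, hut⟩ := Condensed.exists_ge h₂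
    have h₁' := h.lev_mono hs
    have h₂' := h.lev_mono hu
    have : lev u = lev t := congrArg (Condensed.lev lev) hut
    rw [h.eq_of_lev_eq (h.le_refl t) hs (_root_.le_antisymm h₁' (this ▸ h₂'))]
  lev_surjective ℓ := by
    obtain ⟨t, rfl⟩ := h.lev_surjective ℓ
    exact ⟨Condensed.mk lev t, rfl⟩
  lev_lt δ δ' hle hne := by
    obtain ⟨t, rfl⟩ := δ.exists_rep
    obtain ⟨s, hs, rfl⟩ := Condensed.exists_ge hle
    exact h.lev_lt t s hs fun h => hne (h ▸ rfl)
  existsUnique_above δ ℓ hℓ := by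
    obtain ⟨t, rfl⟩ := δ.exists_rep
    obtain ⟨s, ⟨hs, rfl⟩, -⟩ := h.existsUnique_above t ℓ hℓ
    refine ⟨Condensed.mk lev s, ⟨Condensed.mk_le_mk hs, rfl⟩, ?_⟩
    rintro δ' ⟨hle, hlev⟩
    obtain ⟨u, hu, rfl⟩ := Condensed.exists_ge hle
    rw [h.eq_of_lev_eq hu hs hlev]
  exists_agree δ δ' := by
    obtain ⟨t, rfl⟩ := δ.exists_rep
    obtain ⟨t', rfl⟩ := δ'.exists_rep
    obtain ⟨ℓ, hℓ, s, hs, hs', rfl⟩ := h.exists_agree t t'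
    exact ⟨_, hℓ, Condensed.mk lev s, Condensed.mk_le_mk hs, Condensed.mk_le_mk hs', rfl⟩

/-- For incomparable classes `[t]` and `[t']`, property (⋆) provides a representative `s` of `[t']`
that joins `t` as early as the classes join. The largest splitting level of `t` and `s` is then also
that of the classes. -/
theorem IsLTree.isSpecial (h : IsLTree lev) (hstar : HasStar lev) : IsSpecial lev := by
  have hc := h.toIsWeakLTree.condensed
  refine ⟨hc, fun δ δ' hδ hδ' => ?_⟩
  obtain ⟨t, rfl⟩ := δ.exists_rep
  obtain ⟨t', rfl⟩ := δ'.exists_rep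
  let C : Set T := {c | t ≤ c ∧ Condensed.mk lev t' ≤ Condensed.mk lev c}
  obtain ⟨s, hst, hs⟩ := hstar C
    { chain := fun c hc' d hd => h.le_total_of_le hc'.1 hd.1
      upward_closed := fun c hc' d hd => ⟨h.le_trans _ _ _ hc'.1 hd,
        hc.le_trans _ _ _ hc'.2 (Condensed.mk_le_mk hd)⟩
      proper := ⟨t, fun c hc' => ⟨hc'.1, by rintro rfl; exact hδ' hc'.2⟩⟩ } t' fun c hc' => hc'.2
  rw [← hst] at hδ hδ' ⊢
  obtain ⟨ℓ, hℓ⟩ := h.exists_split t s (fun hle => hδ (Condensed.mk_le_mk hle))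
    fun hle => hδ' (Condensed.mk_le_mk hle)
  refine ⟨ℓ, ?_⟩
  convert hℓ using 1
  ext k
  refine and_congr_right fun _ => not_congr ⟨?_, ?_⟩
  · rintro ⟨γ, h₁, h₂, rfl⟩
    obtain ⟨c, hc', rfl⟩ := Condensed.exists_ge h₁
    exact ⟨c, hc', hs c ⟨hc', hst ▸ h₂⟩, rfl⟩
  · rintro ⟨c, h₁, h₂, rfl⟩
    exact ⟨Condensed.mk lev c, Condensed.mk_le_mk h₁, Condensed.mk_le_mk h₂, rfl⟩

theorem IsPruned.condensed (h : IsPruned lev) : IsPruned (Condensed.lev lev) := by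
  intro δ
  obtain ⟨t, rfl⟩ := δ.exists_rep
  obtain ⟨b, hb, hm, ht⟩ := h t
  exact ⟨fun ℓ => Condensed.mk lev (b ℓ), hb, fun ℓ ℓ' hle => Condensed.mk_le_mk (hm ℓ ℓ' hle),
    congrArg _ ht⟩

end CondensedTrees

/-! ### The tree of balls of an ultrametric space -/

section BallTree

variable {U L : Type} [MetricSpace U] [LinearOrder L]

/-- A set of radii, indexed by `L`, that is rich enough to recover the space `U` from its open
balls with these radii. -/
structure IsScale (U : Type) [MetricSpace U] (e : L → ℝ) : Prop where
  strictMono : StrictMono e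
  pos : ∀ ℓ, 0 < e ℓ
  exists_eq_dist : ∀ x y : U, x ≠ y → ∃ ℓ, e ℓ = dist x y
  exists_dist_lt : ∀ x y : U, ∃ ℓ, dist x y < e ℓ
  exists_ball_subset : ∀ ε : ℝ, 0 < ε → ∃ ℓ, ∀ x : U, Metric.ball x (e ℓ) ⊆ Metric.ball x ε

/-- The open balls with radii `e ℓ`, together with the index of the radius. -/
def BallNode (U : Type) [MetricSpace U] (e : L → ℝ) : Type :=
  {p : L × Set U // ∃ x, p.2 = Metric.ball x (e p.1)}

variable {e : L → ℝ}

instance : LE (BallNode U e) where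
  le s t := s.1.1 ≤ t.1.1 ∧ s.1.2 ⊆ t.1.2

/-- The index of the radius of a ball. -/
def BallNode.lev (t : BallNode U e) : L := t.1.1

/-- The ball with centre `x` and radius `e ℓ`. -/
def BallNode.node (e : L → ℝ) (x : U) (ℓ : L) : BallNode U e := ⟨(ℓ, Metric.ball x (e ℓ)), x, rfl⟩

theorem BallNode.exists_node (t : BallNode U e) : ∃ x ℓ, t = node e x ℓ := by
  obtain ⟨x, hx⟩ := t.2
  exact ⟨x, t.1.1, Subtype.ext (Prod.ext rfl hx)⟩

variable [IsUltrametricDist U]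

theorem BallNode.node_le_iff (he : IsScale U e) {x y : U} {ℓ ℓ' : L} :
    node e x ℓ ≤ node e y ℓ' ↔ ℓ ≤ ℓ' ∧ dist x y < e ℓ' := by
  refine and_congr_right fun hℓ => ⟨fun h => h (Metric.mem_ball_self (he.pos ℓ)), fun h => ?_⟩
  change Metric.ball x (e ℓ) ⊆ Metric.ball y (e ℓ')
  rw [IsUltrametricDist.ball_eq_of_mem (Metric.mem_ball.2 h)]
  exact Metric.ball_subset_ball (he.strictMono.monotone hℓ)

theorem BallNode.node_eq_iff (he : IsScale U e) {x y : U} {ℓ : L} :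
    node e x ℓ = node e y ℓ ↔ dist x y < e ℓ := by
  constructor
  · intro h
    have h' : Metric.ball x (e ℓ) = Metric.ball y (e ℓ) := congrArg (fun t => t.1.2) h
    exact Metric.mem_ball.1 (h' ▸ Metric.mem_ball_self (he.pos ℓ))
  · intro h
    exact Subtype.ext (Prod.ext rfl (IsUltrametricDist.ball_eq_of_mem (Metric.mem_ball.2 h)).symm)

theorem BallNode.agreeAt_iff (he : IsScale U e) {x y : U} {ℓ ℓ' k : L} (hk : max ℓ ℓ' ≤ k) :
    AgreeAt lev (node e x ℓ) (node e y ℓ') k ↔ dist x y < e k := by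
  constructor
  · rintro ⟨s, hx, hy, rfl⟩
    obtain ⟨w, k, rfl⟩ := s.exists_node
    have hx := ((node_le_iff he).1 hx).2
    have hy := ((node_le_iff he).1 hy).2
    rw [dist_comm] at hy
    exact (dist_triangle_max x w y).trans_lt (max_lt hx hy)
  · intro h
    exact ⟨node e y k, (node_le_iff he).2 ⟨(le_max_left _ _).trans hk, h⟩,
      (node_le_iff he).2 ⟨(le_max_right _ _).trans hk, by simpa using he.pos k⟩, rfl⟩

theorem BallNode.node_le_node (he : IsScale U e) (x : U) {ℓ ℓ' : L} (h : ℓ ≤ ℓ') :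
    node e x ℓ ≤ node e x ℓ' :=
  (node_le_iff he).2 ⟨h, by simpa using he.pos ℓ'⟩

theorem BallNode.isLTree [Nonempty U] (he : IsScale U e) :
    IsLTree (lev : BallNode U e → L) where
  le_refl t := ⟨le_rfl, Set.Subset.rfl⟩
  le_trans t t' t'' h h' := ⟨h.1.trans h'.1, h.2.trans h'.2⟩
  le_antisymm t t' h h' :=
    Subtype.ext (Prod.ext (h.1.antisymm h'.1) (h.2.antisymm h'.2))
  lev_surjective ℓ := ⟨node e (Classical.arbitrary U) ℓ, rfl⟩
  lev_lt t t' h hne := by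
    obtain ⟨x, ℓ, rfl⟩ := t.exists_node
    obtain ⟨y, ℓ', rfl⟩ := t'.exists_node
    obtain ⟨hℓ, hd⟩ := (node_le_iff he).1 h
    refine lt_of_le_of_ne hℓ ?_
    rintro rfl
    exact hne ((node_eq_iff he).2 hd)
  existsUnique_above t k hk := by
    obtain ⟨x, ℓ, rfl⟩ := t.exists_node
    refine ⟨node e x k, ⟨node_le_node he x hk, rfl⟩, ?_⟩
    rintro s ⟨hs, rfl⟩
    obtain ⟨y, k, rfl⟩ := s.exists_node
    exact ((node_eq_iff he).2 ((node_le_iff he).1 hs).2).symm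
  exists_agree t t' := by
    obtain ⟨x, ℓ, rfl⟩ := t.exists_node
    obtain ⟨y, ℓ', rfl⟩ := t'.exists_node
    obtain ⟨k, hk⟩ := he.exists_dist_lt x y
    refine ⟨max (max ℓ ℓ') k, le_max_left _ _, (agreeAt_iff he (le_max_left _ _)).2 ?_⟩
    exact hk.trans_le (he.strictMono.monotone (le_max_right _ _))
  exists_split t t' h h' := by
    obtain ⟨x, ℓ, rfl⟩ := t.exists_node
    obtain ⟨y, ℓ', rfl⟩ := t'.exists_node
    rw [node_le_iff he, not_and, not_lt] at h h'
    have hd : e (max ℓ ℓ') ≤ dist x y := by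
      rcases le_total ℓ ℓ' with hle | hle
      · rw [max_eq_right hle]
        exact h hle
      · rw [max_eq_left hle, dist_comm]
        exact h' hle
    -- Open balls of radius exactly `dist x y` around `x` and `y` still differ, and those of any
    -- larger radius agree.
    obtain ⟨k, hk⟩ := he.exists_eq_dist x y (dist_pos.1 ((he.pos _).trans_le hd))
    have hmax : max ℓ ℓ' ≤ k := he.strictMono.le_iff_le.1 (hk ▸ hd)
    refine ⟨k, ⟨hmax, fun hag => ?_⟩, ?_⟩
    · exact (((agreeAt_iff he hmax).1 hag).trans_eq hk).false
    · rintro j ⟨hj, hag⟩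
      have := fun hlt => hag ((agreeAt_iff he hj).2 hlt)
      exact he.strictMono.le_iff_le.1 (hk ▸ not_lt.1 this)

theorem BallNode.isPruned (he : IsScale U e) : IsPruned (lev : BallNode U e → L) := by
  intro t
  obtain ⟨x, ℓ, rfl⟩ := t.exists_node
  exact ⟨fun k => node e x k, fun _ => rfl, fun k k' h => node_le_node he x h, rfl⟩

theorem BallNode.countable (he : IsScale U e) [Countable L]
    [TopologicalSpace.SeparableSpace U] : Countable (BallNode U e) := by
  obtain ⟨Q, hQ, hd⟩ := TopologicalSpace.exists_countable_dense U
  have := hQ.to_subtype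
  refine Function.Surjective.countable (f := fun p : Q × L => node e p.1.1 p.2) fun t => ?_
  obtain ⟨x, ℓ, rfl⟩ := t.exists_node
  obtain ⟨q, hq, hxq⟩ := hd.exists_dist_lt x (he.pos ℓ)
  exact ⟨(⟨q, hq⟩, ℓ), (node_eq_iff he).2 (by rwa [dist_comm])⟩

/-- The action of an isometry on the balls. -/
def BallNode.map (e : L → ℝ) (φ : U ≃ᵢ U) : Equiv.Perm (BallNode U e) where
  toFun t := ⟨(t.1.1, φ '' t.1.2), by
    obtain ⟨x, hx⟩ := t.2
    exact ⟨φ x, by rw [hx, φ.image_ball]⟩⟩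
  invFun t := ⟨(t.1.1, φ.symm '' t.1.2), by
    obtain ⟨x, hx⟩ := t.2
    exact ⟨φ.symm x, by rw [hx, φ.symm.image_ball]⟩⟩
  left_inv t := Subtype.ext (Prod.ext rfl (φ.toEquiv.symm_image_image _))
  right_inv t := Subtype.ext (Prod.ext rfl (φ.symm.toEquiv.symm_image_image _))

theorem BallNode.map_node (φ : U ≃ᵢ U) (x : U) (ℓ : L) :
    map e φ (node e x ℓ) = node e (φ x) ℓ :=
  Subtype.ext (Prod.ext rfl (φ.image_ball x _))

theorem BallNode.map_mem (he : IsScale U e) (φ : U ≃ᵢ U) :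
    map e φ ∈ treeAut (lev : BallNode U e → L) := by
  refine ⟨fun t => rfl, fun t t' => ?_⟩
  obtain ⟨x, ℓ, rfl⟩ := t.exists_node
  obtain ⟨y, ℓ', rfl⟩ := t'.exists_node
  rw [map_node, map_node, node_le_iff he, node_le_iff he, φ.dist_eq]

/-- The action of isometries on balls, as a homomorphism. -/
def BallNode.mapHom (he : IsScale U e) : (U ≃ᵢ U) →* treeAut (lev : BallNode U e → L) where
  toFun φ := ⟨map e φ, map_mem he φ⟩
  map_one' := by
    refine Subtype.ext (Equiv.ext fun t => ?_)
    obtain ⟨x, ℓ, rfl⟩ := t.exists_node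
    exact map_node _ _ _
  map_mul' φ ψ := by
    refine Subtype.ext (Equiv.ext fun t => ?_)
    obtain ⟨x, ℓ, rfl⟩ := t.exists_node
    change map e (φ * ψ) _ = map e φ (map e ψ _)
    rw [map_node, map_node, map_node]
    rfl

theorem BallNode.eq_of_forall_node_eq (he : IsScale U e) {x y : U}
    (h : ∀ ℓ, node e x ℓ = node e y ℓ) : x = y := by
  by_contra hne
  obtain ⟨ℓ, hℓ⟩ := he.exists_ball_subset _ (dist_pos.2 hne)
  exact lt_irrefl _ (Metric.mem_ball.1 (hℓ y ((node_eq_iff he).1 (h ℓ))))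

/-- Centres of nested balls form a Cauchy filter as the radius decreases. In an ultrametric space
the limit stays in every ball, because open balls are closed. -/
theorem BallNode.exists_limit [Nonempty U] [CompleteSpace U] (he : IsScale U e) {y : L → U}
    (hy : ∀ ℓ ℓ', ℓ ≤ ℓ' → dist (y ℓ) (y ℓ') < e ℓ') :
    ∃ a, ∀ ℓ, dist (y ℓ) a < e ℓ := by
  have : Nonempty L := ⟨(he.exists_dist_lt (Classical.arbitrary U) (Classical.arbitrary U)).choose⟩
  have hc : Cauchy (Filter.map y Filter.atBot) := by
    refine Metric.cauchy_iff.2 ⟨inferInstance, fun ε hε => ?_⟩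
    obtain ⟨k, hk⟩ := he.exists_ball_subset ε hε
    refine ⟨y '' Set.Iic k, Filter.image_mem_map (Filter.Iic_mem_atBot k), ?_⟩
    rintro _ ⟨ℓ, hℓ, rfl⟩ _ ⟨ℓ', hℓ', rfl⟩
    refine hk (y ℓ') (Metric.mem_ball.2 ?_)
    refine (dist_triangle_max _ (y k) _).trans_lt (max_lt (hy _ _ hℓ) ?_)
    rw [dist_comm]
    exact hy _ _ hℓ'
  obtain ⟨a, ha⟩ := CompleteSpace.complete hc
  refine ⟨a, fun ℓ => ?_⟩
  have hev : ∀ᶠ k in Filter.atBot, dist (y k) a < e ℓ :=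
    (Metric.tendsto_nhds (f := Filter.atBot) (u := y)).1 ha _ (he.pos ℓ)
  obtain ⟨k, hk, hkℓ⟩ := (hev.and (Filter.Iic_mem_atBot ℓ)).exists
  refine (dist_triangle_max _ (y k) _).trans_lt (max_lt ?_ hk)
  rw [dist_comm]
  exact hy _ _ hkℓ

theorem BallNode.exists_point [Nonempty U] [CompleteSpace U] (he : IsScale U e)
    {f : Equiv.Perm (BallNode U e)} (hf : f ∈ treeAut (lev : BallNode U e → L)) (x : U) :
    ∃ a, ∀ ℓ, f (node e x ℓ) = node e a ℓ := by
  have : ∀ ℓ, ∃ y, f (node e x ℓ) = node e y ℓ := fun ℓ => by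
    obtain ⟨y, k, hk⟩ := (f (node e x ℓ)).exists_node
    have : k = ℓ := (congrArg lev hk).symm.trans (hf.1 _)
    exact ⟨y, this ▸ hk⟩
  choose y hy using this
  obtain ⟨a, ha⟩ := exists_limit he (y := y) fun ℓ ℓ' hle => by
    have := (hf.2 _ _).1 (node_le_node he x hle)
    rw [hy, hy, node_le_iff he] at this
    exact this.2
  exact ⟨a, fun ℓ => (hy ℓ).trans ((node_eq_iff he).2 (ha ℓ))⟩

theorem BallNode.mapHom_bijective [Nonempty U] [CompleteSpace U] (he : IsScale U e) :
    Function.Bijective (mapHom he) := by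
  constructor
  · intro φ ψ h
    refine IsometryEquiv.ext fun x => eq_of_forall_node_eq he fun ℓ => ?_
    rw [← map_node, ← map_node]
    exact congrArg (fun k : treeAut (lev : BallNode U e → L) => k.1 (node e x ℓ)) h
  · rintro ⟨f, hf⟩
    choose a ha using fun x => exists_point he hf x
    choose b hb using fun x => exists_point he (inv_mem hf) x
    have hab : ∀ x, a (b x) = x := fun x => eq_of_forall_node_eq he fun ℓ => by
      rw [← ha, ← hb, perm_apply_inv]
    have hba : ∀ x, b (a x) = x := fun x => eq_of_forall_node_eq he fun ℓ => by
      rw [← hb, ← ha]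
      exact f.symm_apply_apply _
    -- Balls only compare distances with the radii of the scale; this suffices, since every positive
    -- distance is itself such a radius.
    have hdist : ∀ x y ℓ, dist (a x) (a y) < e ℓ ↔ dist x y < e ℓ := fun x y ℓ => by
      rw [← node_eq_iff he, ← node_eq_iff he, ← ha, ← ha, f.injective.eq_iff]
    have hiso : ∀ x y, dist (a x) (a y) = dist x y := fun x y => by
      by_cases hxy : x = y
      · rw [hxy, dist_self, dist_self]
      have haxy : a x ≠ a y := fun h => hxy (by rw [← hba x, ← hba y, h])
      obtain ⟨ℓ, hℓ⟩ := he.exists_eq_dist x y hxy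
      obtain ⟨ℓ', hℓ'⟩ := he.exists_eq_dist _ _ haxy
      apply le_antisymm
      · rw [← hℓ', ← not_lt, ← hdist, hℓ']
        exact lt_irrefl _
      · rw [← hℓ, ← not_lt, hdist, hℓ]
        exact lt_irrefl _
    refine ⟨⟨⟨a, b, hba, hab⟩, Isometry.of_dist_eq hiso⟩, Subtype.ext (Equiv.ext fun t => ?_)⟩
    obtain ⟨x, ℓ, rfl⟩ := t.exists_node
    exact (map_node _ _ _).trans (ha x ℓ).symm

/-- The topologies match because fixing the image of the ball of index `ℓ` around `x` means fixing
the image of `x` up to an error below `e ℓ`. -/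
theorem BallNode.nonempty_equiv [Nonempty U] [CompleteSpace U] (he : IsScale U e) :
    Nonempty ((U ≃ᵢ U) ≃ₜ* treeAut (lev : BallNode U e → L)) := by
  refine nonempty_continuousMulEquiv (mapHom he) (mapHom_bijective he) ?_ ?_
  · refine continuous_treeAut fun t s => ?_
    obtain ⟨x, ℓ, rfl⟩ := t.exists_node
    refine isOpen_iff_forall_mem_open.2 fun φ hφ => ?_
    refine ⟨{ψ | dist (ψ x) (φ x) < e ℓ}, fun ψ hψ => ?_, ?_, by simpa using he.pos ℓ⟩
    · refine Eq.trans ?_ hφ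
      change map e ψ (node e x ℓ) = map e φ (node e x ℓ)
      rw [map_node, map_node, node_eq_iff he]
      exact hψ
    · exact isOpen_lt ((continuous_iso_apply x).dist continuous_const) continuous_const
  · refine continuous_iso fun x => Metric.continuous_iff'.2 fun f ε hε => ?_
    obtain ⟨ℓ, hℓ⟩ := he.exists_ball_subset ε hε
    filter_upwards [(isOpen_treeAut lev (node e x ℓ) (f.1 (node e x ℓ))).mem_nhds rfl] with g hg
    refine hℓ _ (Metric.mem_ball.2 ?_)
    rw [← node_eq_iff he, ← map_node, ← map_node]
    have key : ∀ k : treeAut (lev : BallNode U e → L),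
        map e ((MulEquiv.ofBijective (mapHom he) (mapHom_bijective he)).symm k) = k.1 := fun k =>
      congrArg Subtype.val (ofBijective_symm_eq (hΦ := mapHom_bijective he) k)
    rw [key, key]
    exact hg

/-- Let `x` lie in all balls of the chain. Each of these balls contains some point of the orbit of
`y`, hence also the point of that orbit nearest to `x`, which exists by exactness. The ball around
this single point serves the whole chain. -/
theorem BallNode.hasStar [Nonempty U] [CompleteSpace U] (he : IsScale U e) (hex : IsExact U) :
    HasStar (lev : BallNode U e → L) := by
  rintro C hC t ht
  obtain ⟨u, hu⟩ := hC.proper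
  obtain ⟨x, k, rfl⟩ := u.exists_node
  obtain ⟨y, ℓ, rfl⟩ := t.exists_node
  obtain ⟨_, ⟨φ, rfl⟩, _, ⟨ψ, rfl⟩, hmin⟩ := hex x y
  have hle : ∀ χ : U ≃ᵢ U, dist (φ x) (ψ y) ≤ dist x (χ y) := fun χ => by
    rw [hmin]
    exact csInf_le ⟨0, by rintro _ ⟨a, -, b, -, rfl⟩; exact dist_nonneg⟩
      ⟨x, ⟨1, rfl⟩, χ y, ⟨χ, rfl⟩, rfl⟩
  refine ⟨node e (φ.symm (ψ y)) ℓ, ?_, fun c hc => ?_⟩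
  · have := Condensed.mk_apply (map_mem he (ψ.trans φ.symm)) (node e y ℓ)
    rwa [map_node] at this
  · obtain ⟨w, j, rfl⟩ := c.exists_node
    obtain ⟨f, hf, hfle⟩ := Condensed.mk_le_iff.1 (ht _ hc)
    obtain ⟨χ, hχ⟩ := (mapHom_bijective he).2 ⟨f, hf⟩
    have hχ' : map e χ = f := congrArg Subtype.val hχ
    rw [← hχ', map_node, node_le_iff he] at hfle
    have hxw := ((node_le_iff he).1 (hu _ hc).1).2
    refine (node_le_iff he).2 ⟨hfle.1, ?_⟩
    refine (dist_triangle_max _ x _).trans_lt (max_lt ?_ hxw)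
    rw [← φ.dist_eq, φ.apply_symm_apply, dist_comm]
    refine (hle χ).trans_lt ((dist_triangle_max _ w _).trans_lt (max_lt hxw ?_))
    rw [dist_comm]
    exact hfle.2

end BallTree

/-! ### A strictly monotone measure of sets of levels -/

section LevelMass

variable {L : Type} (s : ℕ → L)

/-- The sum of `2⁻ⁿ` over all `n` with `s n ∈ D`. -/
noncomputable def levelMass (D : Set L) : ℝ := ∑' n, (s ⁻¹' D).indicator (fun n => (1 / 2 : ℝ) ^ n) n

theorem levelMass_summable (D : Set L) :
    Summable ((s ⁻¹' D).indicator fun n => (1 / 2 : ℝ) ^ n) :=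
  summable_geometric_two.indicator _

theorem levelMass_nonneg (D : Set L) : 0 ≤ levelMass s D :=
  tsum_nonneg fun n => Set.indicator_nonneg (fun n _ => by positivity) n

theorem levelMass_mono {D E : Set L} (h : D ⊆ E) : levelMass s D ≤ levelMass s E :=
  (levelMass_summable s D).tsum_le_tsum
    (Set.indicator_le_indicator_of_subset (Set.preimage_mono h) fun n => by positivity)
    (levelMass_summable s E)

theorem levelMass_lt {D E : Set L} (hs : Function.Surjective s) (h : D ⊆ E) {ℓ : L} (hE : ℓ ∈ E)
    (hD : ℓ ∉ D) : levelMass s D < levelMass s E := by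
  obtain ⟨n, rfl⟩ := hs ℓ
  refine (levelMass_summable s D).tsum_lt_tsum (i := n)
    (Set.indicator_le_indicator_of_subset (Set.preimage_mono h) fun n => by positivity) ?_
    (levelMass_summable s E)
  rw [Set.indicator_of_notMem (by exact hD), Set.indicator_of_mem (by exact hE)]
  positivity

/-- Lower sets are linearly ordered by inclusion, and the mass is strictly monotone since every
level has positive weight. -/
theorem levelMass_injOn [LinearOrder L] (hs : Function.Surjective s) {D E : Set L}
    (hD : IsLowerSet D) (hE : IsLowerSet E) (h : levelMass s D = levelMass s E) : D = E := by
  rcases hD.total hE with hle | hle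
  · refine hle.antisymm fun ℓ hℓ => ?_
    by_contra hn
    exact (levelMass_lt s hs hle hℓ hn).ne h
  · refine Set.Subset.antisymm (fun ℓ hℓ => ?_) hle
    by_contra hn
    exact (levelMass_lt s hs hle hℓ hn).ne' h

end LevelMass

/-! ### Systems of projections as trees -/

section Joins

variable {Δ : Type} [PartialOrder Δ] {N : Δ → ℕ∞}

theorem ProjectionSystem.proj_self (P : ProjectionSystem N) {δ : Δ} (h : δ ≤ δ) (z : P.S δ) :
    P.proj h z = z :=
  Subtype.ext ((P.proj_eq_iff h _ _).1 (P.proj_comp h h z))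

/-- The projections to `γ` of the two elements exist and coincide. -/
def ProjectionSystem.Joins (P : ProjectionSystem N) (p q : Σ δ, P.S δ) (γ : Δ) : Prop :=
  ∃ (h : p.1 ≤ γ) (h' : q.1 ≤ γ), P.proj h p.2 = P.proj h' q.2

/-- The levels at which two elements do not have the same projection. -/
def ProjectionSystem.disagree {L : Type} (P : ProjectionSystem N) (lev : Δ → L)
    (p q : Σ δ, P.S δ) : Set L := {ℓ | ¬ ∃ γ, lev γ = ℓ ∧ P.Joins p q γ}

variable {L : Type} [LinearOrder L] {P : ProjectionSystem N} {lev : Δ → L}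

theorem ProjectionSystem.Joins.symm {p q : Σ δ, P.S δ} {γ : Δ} (h : P.Joins p q γ) :
    P.Joins q p γ :=
  ⟨h.2.1, h.1, h.2.2.symm⟩

theorem ProjectionSystem.Joins.mono {p q : Σ δ, P.S δ} {γ γ' : Δ} (h : P.Joins p q γ)
    (hγ : γ ≤ γ') : P.Joins p q γ' := by
  obtain ⟨h₁, h₂, h₃⟩ := h
  refine ⟨h₁.trans hγ, h₂.trans hγ, ?_⟩
  rw [← P.proj_comp h₁ hγ, h₃, P.proj_comp]

theorem ProjectionSystem.Joins.trans {p q r : Σ δ, P.S δ} {γ : Δ} (h : P.Joins p q γ)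
    (h' : P.Joins q r γ) : P.Joins p r γ :=
  ⟨h.1, h'.2.1, h.2.2.trans h'.2.2⟩

theorem ProjectionSystem.disagree_comm (p q : Σ δ, P.S δ) :
    P.disagree lev p q = P.disagree lev q p :=
  Set.ext fun _ => not_congr (exists_congr fun _ => and_congr_right fun _ => ⟨Joins.symm, Joins.symm⟩)

theorem ProjectionSystem.disagree_isLowerSet (hT : IsWeakLTree lev) (p q : Σ δ, P.S δ) :
    IsLowerSet (P.disagree lev p q) := by
  rintro ℓ ℓ' hle hℓ ⟨γ, rfl, hγ⟩
  obtain ⟨γ', ⟨hγγ', hlev⟩, -⟩ := hT.existsUnique_above γ ℓ hle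
  exact hℓ ⟨γ', hlev, hγ.mono hγγ'⟩

theorem ProjectionSystem.disagree_subset_union (hT : IsWeakLTree lev) (p q r : Σ δ, P.S δ) :
    P.disagree lev p r ⊆ P.disagree lev p q ∪ P.disagree lev q r := by
  intro ℓ hℓ
  by_contra hn
  simp only [disagree, Set.mem_union, Set.mem_ofPred_eq, not_or, not_not] at hn
  obtain ⟨⟨γ, hγ, h₁⟩, ⟨γ', hγ', h₂⟩⟩ := hn
  obtain rfl := hT.eq_of_lev_eq h₁.2.1 h₂.1 (hγ.trans hγ'.symm)
  exact hℓ ⟨γ, hγ, h₁.trans h₂⟩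

end Joins

/-! ### Spaces with rigid fibres -/

/-- A sequence of ultrametrics with values below `1` on the same set that admit no isometric
self-maps but the identity, and no isometric maps between different ones. -/
structure RigidMetrics (K : Type) where
  /-- the `n`-th ultrametric -/
  d : ℕ → K → K → ℝ
  d_self : ∀ n a, d n a a = 0
  d_comm : ∀ n a b, d n a b = d n b a
  d_pos : ∀ n a b, a ≠ b → 0 < d n a b
  d_lt_one : ∀ n a b, d n a b < 1
  d_triangle : ∀ n a b c, d n a c ≤ max (d n a b) (d n b c)
  rigid : ∀ n m (f : K → K), (∀ a b, d m (f a) (f b) = d n a b) → n = m ∧ ∀ a, f a = a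

/-- A system of projections over a tree with enumerated levels and coded nodes. -/
structure CodedSystem (Δ : Type) [PartialOrder Δ] (L : Type) [LinearOrder L] (N : Δ → ℕ∞) where
  /-- the system of projections -/
  P : ProjectionSystem N
  /-- the level map -/
  lev : Δ → L
  tree : IsWeakLTree lev
  /-- an enumeration of the levels -/
  enum : ℕ → L
  enum_surjective : Function.Surjective enum
  /-- codes of the nodes -/
  code : Δ → ℕ
  code_injective : Function.Injective code

/-- The product of the nodes of the system with the fibre `K`. -/
structure FibreSpace {Δ : Type} [PartialOrder Δ] {L : Type} [LinearOrder L] {N : Δ → ℕ∞}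
    {K : Type} (D : CodedSystem Δ L N) (κ : RigidMetrics K) where
  /-- the node -/
  node : Σ δ, D.P.S δ
  /-- the position in the fibre -/
  pos : K

namespace FibreSpace

variable {Δ : Type} [PartialOrder Δ] {L : Type} [LinearOrder L] {N : Δ → ℕ∞} {K : Type}
  {D : CodedSystem Δ L N} {κ : RigidMetrics K}

open Classical in
noncomputable instance : Dist (FibreSpace D κ) where
  dist x y := if x.1 = y.1 then κ.d (D.code x.1.1) x.2 y.2
    else 1 + levelMass D.enum (D.P.disagree D.lev x.1 y.1)

theorem dist_same (p : Σ δ, D.P.S δ) (a b : K) :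
    dist (⟨p, a⟩ : FibreSpace D κ) (⟨p, b⟩ : FibreSpace D κ) = κ.d (D.code p.1) a b :=
  if_pos rfl

theorem dist_of_ne {p q : Σ δ, D.P.S δ} (h : p ≠ q) (a b : K) :
    dist (⟨p, a⟩ : FibreSpace D κ) (⟨q, b⟩ : FibreSpace D κ) =
      1 + levelMass D.enum (D.P.disagree D.lev p q) :=
  if_neg h

theorem dist_lt_one_iff {p q : Σ δ, D.P.S δ} {a b : K} :
    dist (⟨p, a⟩ : FibreSpace D κ) (⟨q, b⟩ : FibreSpace D κ) < 1 ↔ p = q := by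
  constructor
  · intro h
    by_contra hne
    rw [dist_of_ne hne] at h
    linarith [levelMass_nonneg D.enum (D.P.disagree D.lev p q)]
  · rintro rfl
    rw [dist_same]
    exact κ.d_lt_one _ _ _

/-- For distinct nodes the sets of disagreement are lower sets, so the union of two of them is one
of the two; monotonicity of the mass then gives the ultrametric inequality. Distances within a fibre
are below 1, all others are at least 1. -/
theorem dist_le_max (x y z : FibreSpace D κ) : dist x z ≤ max (dist x y) (dist y z) := by
  obtain ⟨p, a⟩ := x
  obtain ⟨q, b⟩ := y
  obtain ⟨r, c⟩ := z
  by_cases hpr : p = r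
  · subst hpr
    by_cases hpq : p = q
    · subst hpq
      rw [dist_same, dist_same, dist_same]
      exact κ.d_triangle _ _ _ _
    · refine ((dist_lt_one_iff.2 rfl).le.trans ?_).trans (le_max_left _ _)
      rw [dist_of_ne hpq]
      linarith [levelMass_nonneg D.enum (D.P.disagree D.lev p q)]
  · rw [dist_of_ne hpr]
    by_cases hpq : p = q
    · subst hpq
      rw [dist_of_ne hpr]
      exact le_max_right _ _
    by_cases hqr : q = r
    · subst hqr
      rw [dist_of_ne hpq]
      exact le_max_left _ _
    rw [dist_of_ne hpq, dist_of_ne hqr]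
    have hsub := ProjectionSystem.disagree_subset_union D.tree p q r
    rcases (ProjectionSystem.disagree_isLowerSet D.tree p q).total
      (ProjectionSystem.disagree_isLowerSet D.tree q r) with h | h
    · rw [Set.union_eq_self_of_subset_left h] at hsub
      exact le_max_of_le_right (by linarith [levelMass_mono D.enum hsub])
    · rw [Set.union_eq_self_of_subset_right h] at hsub
      exact le_max_of_le_left (by linarith [levelMass_mono D.enum hsub])

theorem dist_nonneg' (x y : FibreSpace D κ) : 0 ≤ dist x y := by
  obtain ⟨p, a⟩ := x
  obtain ⟨q, b⟩ := y
  by_cases hpq : p = q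
  · subst hpq
    rw [dist_same]
    by_cases hab : a = b
    · rw [hab, κ.d_self]
    · exact (κ.d_pos _ _ _ hab).le
  · rw [dist_of_ne hpq]
    linarith [levelMass_nonneg D.enum (D.P.disagree D.lev p q)]

noncomputable instance : MetricSpace (FibreSpace D κ) where
  dist_self x := (dist_same x.1 x.2 x.2).trans (κ.d_self _ _)
  dist_comm x y := by
    obtain ⟨p, a⟩ := x
    obtain ⟨q, b⟩ := y
    by_cases hpq : p = q
    · subst hpq
      rw [dist_same, dist_same, κ.d_comm]
    · rw [dist_of_ne hpq, dist_of_ne (Ne.symm hpq), ProjectionSystem.disagree_comm]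
  dist_triangle x y z := (dist_le_max x y z).trans
    (max_le_add_of_nonneg (dist_nonneg' x y) (dist_nonneg' y z))
  eq_of_dist_eq_zero := by
    rintro ⟨p, a⟩ ⟨q, b⟩ h
    obtain rfl : p = q := dist_lt_one_iff.1 (h.trans_lt one_pos)
    rw [dist_same] at h
    by_contra hne
    exact (κ.d_pos _ a b fun hab => hne (hab ▸ rfl)).ne' h

instance : IsUltrametricDist (FibreSpace D κ) := ⟨dist_le_max⟩

/-! #### The isometry group -/

theorem node_eq_iff {P : ProjectionSystem N} {δ : Δ} {z w : P.S δ} :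
    (⟨δ, z⟩ : Σ δ, P.S δ) = ⟨δ, w⟩ ↔ z = w := by
  simp

/-- The permutation of the nodes induced by an element of the wreath product. -/
@[reducible]
def nodeMap {P : ProjectionSystem N} (g : ∀ δ, Equiv.Perm (P.S δ)) (p : Σ δ, P.S δ) :
    Σ δ, P.S δ := ⟨p.1, g p.1 p.2⟩

theorem nodeMap_injective {P : ProjectionSystem N} (g : ∀ δ, Equiv.Perm (P.S δ)) :
    Function.Injective (nodeMap g) :=
  (Equiv.sigmaCongrRight g).injective

theorem joins_nodeMap {P : ProjectionSystem N} {g : ∀ δ, Equiv.Perm (P.S δ)}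
    (hg : g ∈ projWreath P) {p q : Σ δ, P.S δ} {γ : Δ} :
    P.Joins (nodeMap g p) (nodeMap g q) γ ↔ P.Joins p q γ := by
  refine exists_congr fun h => exists_congr fun h' => ?_
  rw [← hg.1, ← hg.1, (g γ).injective.eq_iff]

theorem dist_nodeMap {g : ∀ δ, Equiv.Perm (D.P.S δ)} (hg : g ∈ projWreath D.P)
    (x y : FibreSpace D κ) :
    dist (⟨nodeMap g x.1, x.2⟩ : FibreSpace D κ) ⟨nodeMap g y.1, y.2⟩ = dist x y := by
  obtain ⟨p, a⟩ := x
  obtain ⟨q, b⟩ := y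
  by_cases hpq : p = q
  · subst hpq
    rw [dist_same, dist_same]
  · rw [dist_of_ne hpq, dist_of_ne fun h => hpq (nodeMap_injective g h)]
    simp only [ProjectionSystem.disagree, joins_nodeMap hg]

/-- The isometry induced by an element of the wreath product. -/
def isom (g : projWreath D.P) : FibreSpace D κ ≃ᵢ FibreSpace D κ where
  toFun x := ⟨nodeMap g.1 x.1, x.2⟩
  invFun x := ⟨nodeMap (g⁻¹).1 x.1, x.2⟩
  left_inv x := by
    obtain ⟨p, a⟩ := x
    exact congrArg (FibreSpace.mk · a) ((Equiv.sigmaCongrRight g.1).symm_apply_apply p)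
  right_inv x := by
    obtain ⟨p, a⟩ := x
    exact congrArg (FibreSpace.mk · a) ((Equiv.sigmaCongrRight g.1).apply_symm_apply p)
  isometry_toFun := Isometry.of_dist_eq (dist_nodeMap g.2)

/-- The action of the wreath product by isometries. -/
def isomHom : projWreath D.P →* (FibreSpace D κ ≃ᵢ FibreSpace D κ) where
  toFun g := isom g
  map_one' := rfl
  map_mul' _ _ := rfl

/-- Fibres are the classes of points at distance below 1, so an isometry maps fibres into fibres.
Rigidity forces it to keep the position in the fibre and the code, hence the index in the skeleton.
-/
theorem exists_node_map [Nonempty K] (φ : FibreSpace D κ ≃ᵢ FibreSpace D κ)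
    {δ : Δ} (z : D.P.S δ) : ∃ w : D.P.S δ, ∀ a,
      φ (⟨⟨δ, z⟩, a⟩ : FibreSpace D κ) = (⟨⟨δ, w⟩, a⟩ : FibreSpace D κ) := by
  let a₀ : K := Classical.arbitrary K
  obtain ⟨q, hq⟩ : ∃ q, ∀ a, (φ (⟨⟨δ, z⟩, a⟩ : FibreSpace D κ)).1 = q := by
    refine ⟨(φ (⟨⟨δ, z⟩, a₀⟩ : FibreSpace D κ)).1, fun a => ?_⟩
    exact dist_lt_one_iff.1
      ((φ.dist_eq ⟨⟨δ, z⟩, a⟩ ⟨⟨δ, z⟩, a₀⟩).trans_lt (dist_lt_one_iff.2 rfl))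
  obtain ⟨f, hf⟩ : ∃ f : K → K, ∀ a, φ (⟨⟨δ, z⟩, a⟩ : FibreSpace D κ) = ⟨q, f a⟩ :=
    ⟨fun a => (φ (⟨⟨δ, z⟩, a⟩ : FibreSpace D κ)).2, fun a => by rw [← hq a]⟩
  obtain ⟨h₁, h₂⟩ := κ.rigid (D.code δ) (D.code q.1) f fun a b => by
    rw [← dist_same (D := D) q, ← hf, ← hf, φ.dist_eq, dist_same]
  obtain ⟨γ, w⟩ := q
  obtain rfl : δ = γ := D.code_injective h₁
  exact ⟨w, fun a => by rw [hf, h₂]⟩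

theorem isomHom_injective [Nonempty K] :
    Function.Injective (isomHom (D := D) (κ := κ)) := by
  intro g h hgh
  refine Subtype.ext (funext fun δ => Equiv.ext fun z => ?_)
  have := congrArg (fun φ : FibreSpace D κ ≃ᵢ FibreSpace D κ =>
    (φ (⟨⟨δ, z⟩, Classical.arbitrary K⟩ : FibreSpace D κ)).1) hgh
  exact node_eq_iff.1 this

/-- An isometry preserves masses, hence sets of disagreement, and these recover the projections: an
element of `S γ` is the projection of `z` exactly if the two do not disagree at the level of `γ`. -/
theorem isomHom_surjective [Nonempty K] :
    Function.Surjective (isomHom (D := D) (κ := κ)) := by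
  intro φ
  choose G hG using fun δ (z : D.P.S δ) => exists_node_map φ z
  choose G' hG' using fun δ (z : D.P.S δ) => exists_node_map φ.symm z
  have a₀ : K := Classical.arbitrary K
  have inj : ∀ δ (z w : D.P.S δ),
      (⟨⟨δ, z⟩, a₀⟩ : FibreSpace D κ) = (⟨⟨δ, w⟩, a₀⟩ : FibreSpace D κ) → z = w := fun δ z w h =>
    node_eq_iff.1 (congrArg FibreSpace.node h)
  let g : ∀ δ, Equiv.Perm (D.P.S δ) := fun δ =>
    { toFun := G δ
      invFun := G' δ
      left_inv := fun z => inj _ _ _ (by rw [← hG', ← hG, φ.symm_apply_apply])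
      right_inv := fun z => inj _ _ _ (by rw [← hG, ← hG', φ.apply_symm_apply]) }
  have hdis : ∀ p q : Σ δ, D.P.S δ, p ≠ q →
      D.P.disagree D.lev (nodeMap g p) (nodeMap g q) = D.P.disagree D.lev p q := by
    intro p q hpq
    refine levelMass_injOn D.enum D.enum_surjective
      (ProjectionSystem.disagree_isLowerSet D.tree _ _)
      (ProjectionSystem.disagree_isLowerSet D.tree _ _) ?_
    have h := φ.dist_eq (⟨p, a₀⟩ : FibreSpace D κ) ⟨q, a₀⟩
    rw [hG, hG, dist_of_ne hpq] at h
    have hne : nodeMap g p ≠ nodeMap g q := fun h => hpq (nodeMap_injective g h)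
    have h' := dist_of_ne (κ := κ) hne a₀ a₀
    exact add_left_cancel (h'.symm.trans h)
  have hP1 : CondP1 D.P g := by
    intro δ γ h z
    by_cases hδγ : δ = γ
    · subst hδγ
      rw [D.P.proj_self, D.P.proj_self]
    have hne : (⟨δ, z⟩ : Σ δ, D.P.S δ) ≠ ⟨γ, D.P.proj h z⟩ := fun h' =>
      hδγ (congrArg Sigma.fst h')
    have hmem : D.lev γ ∉ D.P.disagree D.lev ⟨δ, z⟩ ⟨γ, D.P.proj h z⟩ := fun hn =>
      hn ⟨γ, rfl, h, le_rfl, (D.P.proj_self _ _).symm⟩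
    rw [← hdis _ _ hne] at hmem
    obtain ⟨γ', hlev, h₁, h₂, h₃⟩ := not_not.1 hmem
    -- The common projection lives at a node above `γ` of the same level as `γ`, hence at `γ`
    -- itself.
    obtain rfl : γ = γ' := D.tree.eq_of_lev_eq (D.tree.le_refl _) h₂ hlev.symm
    exact ((D.P.proj_self _ _).symm.trans h₃.symm)
  refine ⟨⟨g, hP1, condP2_of_condP1 hP1⟩, IsometryEquiv.ext ?_⟩
  rintro ⟨⟨δ, z⟩, a⟩
  exact (hG δ z a).symm

variable (D κ) in
theorem nonempty_equiv [Nonempty K] :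
    Nonempty (projWreath D.P ≃ₜ* (FibreSpace D κ ≃ᵢ FibreSpace D κ)) := by
  refine nonempty_continuousMulEquiv isomHom ⟨isomHom_injective, isomHom_surjective⟩ ?_ ?_
  · refine continuous_iso fun u => Metric.continuous_iff'.2 fun g ε hε => ?_
    obtain ⟨p, a⟩ := u
    filter_upwards [(isOpen_projWreath D.P p.1 p.2 (g.1 p.1 p.2)).mem_nhds rfl] with g' hg'
    have : isomHom g' (⟨p, a⟩ : FibreSpace D κ) = isomHom g (⟨p, a⟩ : FibreSpace D κ) :=
      congrArg (FibreSpace.mk · a) (Sigma.ext rfl (heq_of_eq hg') :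
        nodeMap g'.1 p = nodeMap g.1 p)
    rwa [this, dist_self]
  · refine continuous_projWreath fun δ z w => ?_
    have a₀ : K := Classical.arbitrary K
    -- Being in the same fibre is an open condition, since the fibres are the open balls of radius
    -- 1.
    have hopen : IsOpen {φ : FibreSpace D κ ≃ᵢ FibreSpace D κ |
        dist (φ (⟨⟨δ, z⟩, a₀⟩ : FibreSpace D κ)) (⟨⟨δ, w⟩, a₀⟩ : FibreSpace D κ) < 1} :=
      isOpen_lt ((continuous_iso_apply _).dist continuous_const) continuous_const
    convert hopen using 1
    ext φ
    obtain ⟨g, rfl⟩ := isomHom_surjective φ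
    have hbij : Function.Bijective (isomHom (D := D) (κ := κ)) :=
      ⟨isomHom_injective, isomHom_surjective⟩
    change ((MulEquiv.ofBijective isomHom hbij).symm (MulEquiv.ofBijective isomHom hbij g)).1 δ z
        = w ↔
      dist (⟨⟨δ, g.1 δ z⟩, a₀⟩ : FibreSpace D κ) (⟨⟨δ, w⟩, a₀⟩ : FibreSpace D κ) < 1
    rw [MulEquiv.symm_apply_apply, dist_lt_one_iff]
    exact node_eq_iff.symm

/-! #### Exactness -/

theorem mem_component [Nonempty K] (hhom : D.P.IsLocallyHomogeneous) {δ : Δ} {z : D.P.S δ}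
    {a : K} {y : FibreSpace D κ} :
    y ∈ component (⟨⟨δ, z⟩, a⟩ : FibreSpace D κ) ↔ ∃ w, y = ⟨⟨δ, w⟩, a⟩ := by
  constructor
  · rintro ⟨φ, rfl⟩
    obtain ⟨w, hw⟩ := exists_node_map φ z
    exact ⟨w, hw a⟩
  · rintro ⟨w, rfl⟩
    obtain ⟨g, hg, rfl⟩ := hhom δ z w
    exact ⟨isom ⟨g, hg⟩, rfl⟩

/-- Components consist of all points with a given index and position. For different indices, two
members of one coherent family agree wherever the indices have a common upper bound. At the other
levels every pair disagrees, so this pair has minimal distance. -/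
theorem isExact [Nonempty K] (hhom : D.P.IsLocallyHomogeneous) (hfull : D.P.IsFull) :
    IsExact (FibreSpace D κ) := by
  suffices h : ∀ x y : FibreSpace D κ, ∃ x' ∈ component x, ∃ y' ∈ component y,
      ∀ x'' ∈ component x, ∀ y'' ∈ component y, dist x' y' ≤ dist x'' y'' by
    intro x y
    obtain ⟨x', hx', y', hy', hle⟩ := h x y
    have hmem : dist x' y' ∈ Set.image2 dist (component x) (component y) :=
      ⟨x', hx', y', hy', rfl⟩
    refine ⟨x', hx', y', hy', (IsLeast.csInf_eq ⟨hmem, ?_⟩).symm⟩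
    rintro _ ⟨x'', hx'', y'', hy'', rfl⟩
    exact hle x'' hx'' y'' hy''
  rintro ⟨⟨δ, z⟩, a⟩ ⟨⟨γ, w⟩, b⟩
  by_cases hδγ : δ = γ
  · subst hδγ
    refine ⟨_, (mem_component hhom).2 ⟨z, rfl⟩, _, (mem_component hhom).2 ⟨z, rfl⟩, ?_⟩
    intro x'' hx'' y'' hy''
    obtain ⟨z', rfl⟩ := (mem_component hhom).1 hx''
    obtain ⟨w', rfl⟩ := (mem_component hhom).1 hy''
    by_cases hzw : z' = w'
    · subst hzw
      exact ((dist_same ⟨δ, z⟩ _ _).trans (dist_same ⟨δ, z'⟩ _ _).symm).le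
    -- For equal indices the minimum is attained inside one fibre, by the distance of the two fixed
    -- positions.
    · refine (dist_lt_one_iff.2 rfl).le.trans (not_lt.1 fun h => hzw ?_)
      exact node_eq_iff.1 (dist_lt_one_iff.1 h)
  · obtain ⟨c, hc, hcoh⟩ := hfull δ z
    refine ⟨_, (mem_component hhom).2 ⟨z, rfl⟩, _, (mem_component hhom).2 ⟨c γ, rfl⟩, ?_⟩
    intro x'' hx'' y'' hy''
    obtain ⟨z', rfl⟩ := (mem_component hhom).1 hx''
    obtain ⟨w', rfl⟩ := (mem_component hhom).1 hy''
    have hne : ∀ (u : D.P.S δ) (v : D.P.S γ), (⟨δ, u⟩ : Σ δ, D.P.S δ) ≠ ⟨γ, v⟩ := fun u v h =>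
      hδγ (congrArg Sigma.fst h)
    rw [dist_of_ne (hne _ _), dist_of_ne (hne _ _)]
    refine add_le_add_right (levelMass_mono _ ?_) 1
    rintro ℓ hℓ ⟨β, hβ, h₁, h₂, -⟩
    refine hℓ ⟨β, hβ, h₁, h₂, ?_⟩
    change D.P.proj h₁ z = D.P.proj h₂ (c γ)
    rw [← hc, hcoh, hcoh]

/-! #### Discrete and compact fibres -/

theorem isUniformlyDiscrete (hκ : ∀ n a b, a ≠ b → 1 / 2 ≤ κ.d n a b) :
    IsUniformlyDiscrete (FibreSpace D κ) := by
  refine ⟨1 / 2, by norm_num, ?_⟩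
  rintro ⟨p, a⟩
  refine Set.Subset.antisymm ?_ (Set.singleton_subset_iff.2 (Metric.mem_ball_self (by norm_num)))
  rintro ⟨q, b⟩ hq
  have hq' := Metric.mem_ball.1 hq
  obtain rfl := dist_lt_one_iff.1 (hq'.trans one_half_lt_one)
  rw [dist_same] at hq'
  by_contra hne
  exact (hκ _ b a fun h => hne (h ▸ rfl)).not_gt hq'

theorem ball_one (p : Σ δ, D.P.S δ) (a : K) :
    Metric.ball (⟨p, a⟩ : FibreSpace D κ) 1 = Set.range fun b => (⟨p, b⟩ : FibreSpace D κ) := by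
  ext ⟨q, b⟩
  rw [Metric.mem_ball, dist_lt_one_iff]
  constructor
  · rintro rfl
    exact ⟨b, rfl⟩
  · rintro ⟨c, hc⟩
    exact (congrArg FibreSpace.node hc).symm

theorem isCompact_ball_one [TopologicalSpace K] [CompactSpace K]
    (hκ : ∀ n a (ε : ℝ), 0 < ε → ∀ᶠ b in nhds a, κ.d n b a < ε) (x : FibreSpace D κ) :
    IsCompact (Metric.ball x 1) := by
  obtain ⟨p, a⟩ := x
  rw [ball_one]
  refine isCompact_range (Metric.continuous_iff'.2 fun b ε hε => ?_)
  simp only [dist_same]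
  exact hκ _ b ε hε

end FibreSpace

/-- A Cauchy sequence is eventually in a single unit ball, and these are compact. The radius has to
be uniform: local compactness alone would not give completeness. -/
theorem completeSpace_of_isCompact_ball {X : Type*} [MetricSpace X]
    (h : ∀ x : X, IsCompact (Metric.ball x 1)) : CompleteSpace X := by
  refine Metric.complete_of_cauchySeq_tendsto fun u hu => ?_
  obtain ⟨n, hn⟩ := Metric.cauchySeq_iff'.1 hu 1 one_pos
  have hv : CauchySeq fun m => u (m + n) := hu.comp_tendsto (Filter.tendsto_add_atTop_nat n)
  obtain ⟨a, -, ha⟩ := cauchySeq_tendsto_of_isComplete (h (u n)).isComplete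
    (fun m => hn (m + n) (Nat.le_add_left _ _)) hv
  exact ⟨a, (Filter.tendsto_add_atTop_iff_nat n).1 ha⟩

theorem IsUniformlyDiscrete.completeSpace {X : Type} [MetricSpace X]
    (h : IsUniformlyDiscrete X) : CompleteSpace X := by
  obtain ⟨r, hr, hball⟩ := h
  refine Metric.complete_of_cauchySeq_tendsto fun u hu => ?_
  obtain ⟨n, hn⟩ := Metric.cauchySeq_iff'.1 hu r hr
  refine ⟨u n, tendsto_const_nhds.congr' ?_⟩
  filter_upwards [Filter.eventually_ge_atTop n] with m hm
  have := Metric.mem_ball.2 (hn m hm)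
  rw [hball] at this
  exact this.symm

/-! ### Rigid ultrametrics -/

/-- An injective enumeration of positive numbers below `1` that converges to `0` in the first
argument, uniformly in the second. -/
noncomputable def weight (k c : ℕ) : ℝ := (1 / 2) ^ (k + 1) * (1 + 1 / (c + 2))

theorem lt_weight (k c : ℕ) : (1 / 2 : ℝ) ^ (k + 1) < weight k c := by
  have : (0 : ℝ) < 1 / (c + 2) := by positivity
  exact lt_mul_of_one_lt_right (by positivity) (by linarith)

theorem weight_lt (k c : ℕ) : weight k c < (1 / 2 : ℝ) ^ k := by
  have h : (1 : ℝ) / (c + 2) < 1 := by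
    rw [div_lt_one (by positivity)]
    linarith [(Nat.cast_nonneg c : (0 : ℝ) ≤ c)]
  have hk : (0 : ℝ) < (1 / 2) ^ k := by positivity
  rw [weight, pow_succ]
  nlinarith

theorem weight_pos (k c : ℕ) : 0 < weight k c :=
  lt_trans (by positivity) (lt_weight k c)

theorem weight_lt_one (k c : ℕ) : weight k c < 1 :=
  (weight_lt k c).trans_le (pow_le_one₀ (by norm_num) (by norm_num))

theorem weight_lt_weight {k k' : ℕ} (h : k < k') (c c' : ℕ) : weight k' c' < weight k c :=
  (weight_lt k' c').trans_le
    ((pow_le_pow_of_le_one (by norm_num) (by norm_num) h).trans (lt_weight k c).le)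

/-- The weights with first argument `k` fill disjoint intervals from `2^-(k+1)` to `2^-k`, so the
size determines `k`, and within the interval the weight determines `c`. -/
theorem weight_inj {k c k' c' : ℕ} (h : weight k c = weight k' c') : k = k' ∧ c = c' := by
  obtain rfl : k = k' := by
    rcases lt_trichotomy k k' with hlt | heq | hlt
    · exact absurd h (weight_lt_weight hlt _ _).ne'
    · exact heq
    · exact absurd h (weight_lt_weight hlt _ _).ne
  refine ⟨rfl, ?_⟩
  have h1 := mul_left_cancel₀ (by positivity) h
  have h2 : ((c : ℝ) + 2) = c' + 2 := by
    have := add_left_cancel h1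
    rw [one_div, one_div] at this
    exact inv_injective this
  exact_mod_cast add_right_cancel h2

/-- Rigid uniformly discrete ultrametrics on `ℕ`. -/
noncomputable def discreteRigid : RigidMetrics ℕ where
  d n a b := if a = b then 0 else 1 / 2 + weight (min a b) n / 2
  d_self n a := if_pos rfl
  d_comm n a b := by simp only [eq_comm, min_comm]
  d_pos n a b h := by
    rw [if_neg h]
    linarith [weight_pos (min a b) n]
  d_lt_one n a b := by
    split_ifs
    · exact one_pos
    · linarith [weight_lt_one (min a b) n]
  d_triangle n a b c := by
    have hw : ∀ k k', k ≤ k' → weight k' n ≤ weight k n := fun k k' h =>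
      h.eq_or_lt.elim (fun h => h ▸ le_rfl) fun h => (weight_lt_weight h n n).le
    by_cases hac : a = c
    · rw [if_pos hac]
      refine le_max_of_le_left ?_
      split_ifs
      · exact le_rfl
      · linarith [weight_pos (min a b) n]
    by_cases hab : a = b
    · subst hab
      exact le_max_right _ _
    by_cases hbc : b = c
    · subst hbc
      exact le_max_left _ _
    rw [if_neg hac, if_neg hab, if_neg hbc]
    rcases le_total a c with h | h
    · refine le_max_of_le_left ?_
      linarith [hw (min a b) (min a c) (by omega)]
    · refine le_max_of_le_right ?_
      linarith [hw (min b c) (min a c) (by omega)]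
  rigid n m f hf := by
    -- The distance reveals both the smaller of the two points and the number of the metric.
    have key : ∀ a b, a ≠ b → f a ≠ f b ∧ min (f a) (f b) = min a b ∧ m = n := by
      intro a b hab
      have h := hf a b
      rw [if_neg hab] at h
      by_cases hfab : f a = f b
      · rw [if_pos hfab] at h
        linarith [weight_pos (min a b) n]
      · rw [if_neg hfab] at h
        obtain ⟨h₁, h₂⟩ := weight_inj (by linarith : weight (min (f a) (f b)) m = _)
        exact ⟨hfab, h₁, h₂⟩
    refine ⟨(key 0 1 zero_ne_one).2.2.symm, fun a => ?_⟩
    -- If `f a` were not `a`, the minima would force both `f (a + 1)` and `f (a + 2)` to be `a`,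
    -- contrary to injectivity.
    have h₁ := key a (a + 1) (by omega)
    have h₂ := key a (a + 2) (by omega)
    have h₃ := key (a + 1) (a + 2) (by omega)
    omega

theorem discreteRigid_half_le (n a b : ℕ) (h : a ≠ b) : 1 / 2 ≤ discreteRigid.d n a b := by
  change 1 / 2 ≤ if a = b then (0 : ℝ) else 1 / 2 + weight (min a b) n / 2
  rw [if_neg h]
  linarith [weight_pos (min a b) n]

/-- The initial segment of length `k`. -/
def initSeg (a : ℕ → Bool) (k : ℕ) : List Bool := (List.range k).map a

theorem initSeg_eq_iff {a b : ℕ → Bool} {k : ℕ} :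
    initSeg a k = initSeg b k ↔ ∀ i < k, a i = b i := by
  simp [initSeg]

theorem firstDiff_lt_or_eq {a b c : ℕ → Bool} (hac : a ≠ c) :
    PiNat.firstDiff a b < PiNat.firstDiff a c ∨ PiNat.firstDiff b c < PiNat.firstDiff a c ∨
      PiNat.firstDiff a b = PiNat.firstDiff a c ∨ PiNat.firstDiff b c = PiNat.firstDiff a c := by
  have := PiNat.min_firstDiff_le a b c hac
  omega

/-- The distance of two sequences, if they are different. -/
noncomputable def cantorDist (n : ℕ) (a b : ℕ → Bool) : ℝ :=
  weight (PiNat.firstDiff a b) (Encodable.encode (n, initSeg a (PiNat.firstDiff a b)))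

theorem cantorDist_comm (n : ℕ) (a b : ℕ → Bool) : cantorDist n a b = cantorDist n b a := by
  have : initSeg a (PiNat.firstDiff a b) = initSeg b (PiNat.firstDiff a b) :=
    initSeg_eq_iff.2 fun i hi => PiNat.apply_eq_of_lt_firstDiff hi
  rw [cantorDist, cantorDist, this, PiNat.firstDiff_comm]

open Classical in
/-- Rigid compact perfect ultrametrics on the Cantor space. -/
noncomputable def cantorRigid : RigidMetrics (ℕ → Bool) where
  d n a b := if a = b then 0 else cantorDist n a b
  d_self n a := if_pos rfl
  d_comm n a b := by
    rw [cantorDist_comm]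
    simp only [eq_comm]
  d_pos n a b h := by
    rw [if_neg h]
    exact weight_pos _ _
  d_lt_one n a b := by
    split_ifs
    · exact one_pos
    · exact weight_lt_one _ _
  d_triangle n a b c := by
    by_cases hac : a = c
    · rw [if_pos hac]
      refine le_max_of_le_left ?_
      split_ifs
      · exact le_rfl
      · exact (weight_pos _ _).le
    by_cases hab : a = b
    · subst hab
      exact le_max_right _ _
    by_cases hbc : b = c
    · subst hbc
      exact le_max_left _ _
    rw [if_neg hac, if_neg hab, if_neg hbc]
    rcases firstDiff_lt_or_eq (b := b) hac with h | h | h | h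
    · exact le_max_of_le_left (weight_lt_weight h _ _).le
    · exact le_max_of_le_right (weight_lt_weight h _ _).le
    · refine le_max_of_le_left ?_
      rw [cantorDist, cantorDist, h]
    · refine le_max_of_le_right ?_
      rw [cantorDist_comm n a c, cantorDist_comm n b c, cantorDist, cantorDist,
        PiNat.firstDiff_comm c a, PiNat.firstDiff_comm c b, h]
  rigid n m f hf := by
    -- The distance encodes the number of the metric and the longest common initial segment of the
    -- two sequences.
    have key : ∀ a b, a ≠ b → n = m ∧
        initSeg (f a) (PiNat.firstDiff a b) = initSeg a (PiNat.firstDiff a b) := by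
      intro a b hab
      have h := hf a b
      rw [if_neg hab] at h
      by_cases hfab : f a = f b
      · rw [if_pos hfab] at h
        exact absurd h (weight_pos _ _).ne
      · rw [if_neg hfab] at h
        obtain ⟨h₁, h₂⟩ := weight_inj h
        have h₃ := Encodable.encode_injective h₂
        rw [h₁] at h₃
        exact ⟨(congrArg Prod.fst h₃).symm, congrArg Prod.snd h₃⟩
    -- Every initial segment of `a` is the longest common one with some other sequence, so `f a` has
    -- the same initial segments as `a`.
    have flip : ∀ (a : ℕ → Bool) k, ∃ b, a ≠ b ∧ PiNat.firstDiff a b = k := by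
      intro a k
      have hne : a ≠ Function.update a k (!a k) := fun h => by
        have := congrFun h k
        simp at this
      refine ⟨_, hne, le_antisymm ?_ ?_⟩
      · by_contra! hlt
        have := PiNat.apply_eq_of_lt_firstDiff hlt
        simp at this
      · by_contra! hlt
        have := PiNat.apply_firstDiff_ne hne
        rw [Function.update_of_ne hlt.ne] at this
        exact this rfl
    obtain ⟨b, hb, -⟩ := flip (fun _ => false) 0
    refine ⟨(key _ b hb).1, fun a => funext fun i => ?_⟩
    obtain ⟨b, hb, hk⟩ := flip a (i + 1)
    have := (key a b hb).2
    rw [hk] at this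
    exact initSeg_eq_iff.1 this i (Nat.lt_succ_self i)

theorem cantorRigid_lt (n : ℕ) {a b : ℕ → Bool} {k : ℕ} (h : ∀ i < k, a i = b i) :
    cantorRigid.d n a b < (1 / 2) ^ k := by
  classical
  change (if a = b then (0 : ℝ) else cantorDist n a b) < _
  split_ifs with hab
  · positivity
  · refine (weight_lt _ _).trans_le (pow_le_pow_of_le_one (by norm_num) (by norm_num) ?_)
    by_contra! hlt
    exact PiNat.apply_firstDiff_ne hab (h _ hlt)

theorem cantorRigid_eventually (n : ℕ) (a : ℕ → Bool) (ε : ℝ) (hε : 0 < ε) :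
    ∀ᶠ b in nhds a, cantorRigid.d n b a < ε := by
  obtain ⟨k, hk⟩ := exists_pow_lt_of_lt_one hε (by norm_num : (1 / 2 : ℝ) < 1)
  have : ∀ᶠ b in nhds a, ∀ i ∈ Set.Iio k, b i = a i :=
    (Filter.eventually_all_finite (Set.finite_Iio k)).2 fun i _ =>
      (continuous_apply i).continuousAt.eventually 
        (mem_nhds_discrete.2 rfl : {c | c = a i} ∈ nhds (a i))
  filter_upwards [this] with b hb
  exact (cantorRigid_lt n hb).trans hk

/-! ### Isometry groups from systems of projections -/

section Spaces

variable {Δ : Type} [PartialOrder Δ] {N : Δ → ℕ∞}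

theorem exists_codedSystem (hN : IsCountableTreeable N) (P : ProjectionSystem N) :
    ∃ (L : Type) (_ : LinearOrder L) (D : CodedSystem Δ L N), D.P = P := by
  obtain ⟨L, _, lev, hT, -⟩ := hN.treeable
  have := hN.nonempty
  have := hN.countable
  have : Nonempty L := hN.nonempty.map lev
  have : Countable L := hT.lev_surjective.countable
  obtain ⟨s, hs⟩ := exists_surjective_nat L
  obtain ⟨c, hc⟩ := Countable.exists_injective_nat Δ
  exact ⟨L, _, ⟨P, lev, hT.toIsWeakLTree, s, hs, c, hc⟩, rfl⟩

theorem exists_uniformlyDiscrete (hN : IsCountableTreeable N) (P : ProjectionSystem N)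
    (hc : P.IsCountable) (hhom : P.IsLocallyHomogeneous) (hfull : P.IsFull) :
    ∃ (U : Type) (_ : MetricSpace U), IsPolishUltrametric U ∧ IsExact U ∧
      IsUniformlyDiscrete U ∧ Nonempty (projWreath P ≃ₜ* (U ≃ᵢ U)) := by
  obtain ⟨L, _, D, rfl⟩ := exists_codedSystem hN P
  have hd : IsUniformlyDiscrete (FibreSpace D discreteRigid) :=
    FibreSpace.isUniformlyDiscrete discreteRigid_half_le
  have : Countable (Σ δ, D.P.S δ) := hc
  have : Countable (FibreSpace D discreteRigid) :=
    Function.Injective.countable (f := fun x => (x.node, x.pos)) fun ⟨_, _⟩ ⟨_, _⟩ h => by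
      cases h
      rfl
  exact ⟨FibreSpace D discreteRigid, inferInstance, ⟨inferInstance, hd.completeSpace,
    UniformSpace.secondCountable_of_separable _⟩, FibreSpace.isExact hhom hfull, hd,
    FibreSpace.nonempty_equiv D discreteRigid⟩

theorem exists_perfect_locallyCompact (hN : IsCountableTreeable N) (P : ProjectionSystem N)
    (hc : P.IsCountable) (hhom : P.IsLocallyHomogeneous) (hfull : P.IsFull) :
    ∃ (U : Type) (_ : MetricSpace U), IsPolishUltrametric U ∧ IsExact U ∧
      PerfectSpace U ∧ LocallyCompactSpace U ∧ Nonempty (projWreath P ≃ₜ* (U ≃ᵢ U)) := by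
  obtain ⟨L, _, D, rfl⟩ := exists_codedSystem hN P
  have : Countable (Σ δ, D.P.S δ) := hc
  have hcpt : ∀ x : FibreSpace D cantorRigid, IsCompact (Metric.ball x 1) :=
    FibreSpace.isCompact_ball_one cantorRigid_eventually
  have hsep : TopologicalSpace.SeparableSpace (FibreSpace D cantorRigid) := by
    -- Finite words, padded with `false`, are dense in each fibre.
    refine ⟨Set.range fun p : (Σ δ, D.P.S δ) × List Bool =>
      (⟨p.1, fun i => p.2.getD i false⟩ : FibreSpace D cantorRigid), Set.countable_range _, ?_⟩
    rintro ⟨p, a⟩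
    refine Metric.mem_closure_iff.2 fun ε hε => ?_
    obtain ⟨k, hk⟩ := exists_pow_lt_of_lt_one hε (by norm_num : (1 / 2 : ℝ) < 1)
    refine ⟨_, ⟨(p, initSeg a k), rfl⟩, ?_⟩
    rw [FibreSpace.dist_same]
    refine (cantorRigid_lt _ fun i hi => ?_).trans hk
    simp [initSeg, hi]
  have hperf : PerfectSpace (FibreSpace D cantorRigid) := by
    refine perfectSpace_iff_forall_not_isolated.2 ?_
    rintro ⟨p, a⟩
    refine mem_closure_iff_nhdsWithin_neBot.1 (Metric.mem_closure_iff.2 fun ε hε => ?_)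
    obtain ⟨k, hk⟩ := exists_pow_lt_of_lt_one hε (by norm_num : (1 / 2 : ℝ) < 1)
    -- Changing one digit far out gives a nearby but different point of the fibre.
    refine ⟨⟨p, Function.update a k (!a k)⟩, fun h => ?_, ?_⟩
    · have := congrFun (congrArg FibreSpace.pos h) k
      simp at this
    · rw [FibreSpace.dist_same]
      refine (cantorRigid_lt _ fun i hi => ?_).trans hk
      rw [Function.update_of_ne hi.ne]
  have : WeaklyLocallyCompactSpace (FibreSpace D cantorRigid) :=
    ⟨fun x => ⟨_, hcpt x, Metric.ball_mem_nhds x one_pos⟩⟩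
  exact ⟨FibreSpace D cantorRigid, inferInstance, ⟨inferInstance,
    completeSpace_of_isCompact_ball hcpt, UniformSpace.secondCountable_of_separable _⟩,
    FibreSpace.isExact hhom hfull, hperf, inferInstance, FibreSpace.nonempty_equiv D cantorRigid⟩

end Spaces

/-! ### Automorphism groups as projective wreath products -/

section AutWreath

variable {T L : Type} [LE T] [LinearOrder L] {lev : T → L} {Δ : Type} [PartialOrder Δ]
  {N : Δ → ℕ∞}

/-- An identification of the fibres of an invariant map `m` with the pieces of a system of
projections that turns the order into the projections. -/
structure Identification (lev : T → L) (P : ProjectionSystem N) where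
  /-- the class of a node -/
  m : T → Δ
  m_apply : ∀ f ∈ treeAut lev, ∀ t, m (f t) = m t
  lev_eq : ∀ t t', m t = m t' → lev t = lev t'
  m_mono : ∀ t t', t ≤ t' → m t ≤ m t'
  /-- the bijections -/
  E : ∀ δ, {t // m t = δ} ≃ P.S δ
  le_iff : ∀ {δ γ : Δ} (h : δ ≤ γ) (t : {t // m t = δ}) (s : {t // m t = γ}),
    t.1 ≤ s.1 ↔ P.proj h (E δ t) = E γ s

variable {P : ProjectionSystem N} (I : Identification lev P)

namespace Identification

/-- The family of permutations induced by a tree automorphism. -/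
def perm (f : treeAut lev) (δ : Δ) : Equiv.Perm (P.S δ) :=
  (I.E δ).permCongr (f.1.subtypePerm fun t => by rw [I.m_apply f.1 f.2])

theorem perm_E (f : treeAut lev) {δ : Δ} (t : {t // I.m t = δ}) :
    I.perm f δ (I.E δ t) = I.E δ ⟨f.1 t.1, (I.m_apply f.1 f.2 t.1).trans t.2⟩ := by
  simp [perm, Equiv.permCongr_apply, Equiv.Perm.subtypePerm]

theorem perm_mem (f : treeAut lev) : I.perm f ∈ projWreath P := by
  have h : CondP1 P (I.perm f) := by
    intro δ γ h z
    obtain ⟨t, rfl⟩ := (I.E δ).surjective z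
    obtain ⟨s, hs⟩ := (I.E γ).surjective (P.proj h (I.E δ t))
    rw [← hs, perm_E, perm_E]
    have := (f.2.2 _ _).1 ((I.le_iff h t s).2 hs.symm)
    exact ((I.le_iff h ⟨f.1 t.1, _⟩ ⟨f.1 s.1, _⟩).1 this).symm
  exact ⟨h, condP2_of_condP1 h⟩

/-- The homomorphism from the automorphism group to the wreath product. -/
def hom : treeAut lev →* projWreath P where
  toFun f := ⟨I.perm f, I.perm_mem f⟩
  map_one' := by
    refine Subtype.ext (funext fun δ => Equiv.ext fun z => ?_)
    obtain ⟨t, rfl⟩ := (I.E δ).surjective z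
    exact I.perm_E 1 t
  map_mul' f g := by
    refine Subtype.ext (funext fun δ => Equiv.ext fun z => ?_)
    obtain ⟨t, rfl⟩ := (I.E δ).surjective z
    change I.perm (f * g) δ _ = I.perm f δ (I.perm g δ _)
    rw [perm_E, perm_E, perm_E]
    rfl

theorem hom_injective : Function.Injective I.hom := by
  intro f g h
  refine Subtype.ext (Equiv.ext fun t => ?_)
  have h' : I.perm f (I.m t) (I.E _ ⟨t, rfl⟩) = I.perm g (I.m t) (I.E _ ⟨t, rfl⟩) :=
    congrArg (fun k : projWreath P => k.1 (I.m t) (I.E _ ⟨t, rfl⟩)) h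
  rw [perm_E, perm_E] at h'
  exact congrArg Subtype.val ((I.E _).injective h')

/-- The map of nodes induced by an element of the wreath product. -/
def nodeFun (g : ∀ δ, Equiv.Perm (P.S δ)) (t : T) : T :=
  ((I.E (I.m t)).symm (g (I.m t) (I.E (I.m t) ⟨t, rfl⟩))).1

theorem m_nodeFun (g : ∀ δ, Equiv.Perm (P.S δ)) (t : T) : I.m (I.nodeFun g t) = I.m t :=
  ((I.E (I.m t)).symm (g (I.m t) (I.E (I.m t) ⟨t, rfl⟩))).2

theorem E_nodeFun (g : ∀ δ, Equiv.Perm (P.S δ)) {δ : Δ} (t : {t // I.m t = δ}) :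
    I.E δ ⟨I.nodeFun g t.1, (I.m_nodeFun g t.1).trans t.2⟩ = g δ (I.E δ t) := by
  obtain ⟨t, rfl⟩ := t
  exact (I.E _).apply_symm_apply _

theorem nodeFun_nodeFun {g h : ∀ δ, Equiv.Perm (P.S δ)} (hgh : ∀ δ z, g δ (h δ z) = z) (t : T) :
    I.nodeFun g (I.nodeFun h t) = t := by
  have h₁ := I.E_nodeFun h (δ := I.m t) ⟨t, rfl⟩
  have h₂ := I.E_nodeFun g (δ := I.m t) ⟨I.nodeFun h t, I.m_nodeFun h t⟩
  rw [h₁, hgh] at h₂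
  exact congrArg Subtype.val ((I.E _).injective h₂)

theorem hom_surjective : Function.Surjective I.hom := by
  rintro ⟨g, hg⟩
  let f : Equiv.Perm T :=
    { toFun := I.nodeFun g
      invFun := I.nodeFun g⁻¹
      left_inv := I.nodeFun_nodeFun fun δ z => (g δ).symm_apply_apply z
      right_inv := I.nodeFun_nodeFun fun δ z => (g δ).apply_symm_apply z }
  have hf : f ∈ treeAut lev := by
    refine ⟨fun t => I.lev_eq _ _ (I.m_nodeFun g t), fun t t' => ?_⟩
    -- The identification describes the order only between comparable classes; otherwise neither
    -- pair of nodes can be comparable.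
    by_cases h : I.m t ≤ I.m t'
    · rw [I.le_iff h ⟨t, rfl⟩ ⟨t', rfl⟩]
      change _ ↔ I.nodeFun g t ≤ I.nodeFun g t'
      rw [I.le_iff h ⟨_, I.m_nodeFun g t⟩ ⟨_, I.m_nodeFun g t'⟩,
        I.E_nodeFun g (δ := I.m t) ⟨t, rfl⟩, I.E_nodeFun g (δ := I.m t') ⟨t', rfl⟩, ← hg.1,
        (g _).injective.eq_iff]
    · refine iff_of_false (fun h' => h (I.m_mono _ _ h')) fun h' => h ?_
      have := I.m_mono _ _ h'
      exact (I.m_nodeFun g t).ge.trans (this.trans (I.m_nodeFun g t').le)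
  refine ⟨⟨f, hf⟩, Subtype.ext (funext fun δ => Equiv.ext fun z => ?_)⟩
  obtain ⟨t, rfl⟩ := (I.E δ).surjective z
  exact (I.perm_E ⟨f, hf⟩ t).trans (I.E_nodeFun g t)

theorem nonempty_equiv (I : Identification lev P) : Nonempty (treeAut lev ≃ₜ* projWreath P) := by
  refine nonempty_continuousMulEquiv I.hom ⟨I.hom_injective, I.hom_surjective⟩ ?_ ?_
  · refine continuous_projWreath fun δ z w => ?_
    obtain ⟨t, rfl⟩ := (I.E δ).surjective z
    obtain ⟨s, rfl⟩ := (I.E δ).surjective w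
    convert isOpen_treeAut lev t.1 s.1 using 1
    ext f
    change I.perm f δ _ = _ ↔ _
    rw [perm_E, (I.E δ).injective.eq_iff, Subtype.ext_iff]
    rfl
  · refine continuous_treeAut fun t s => ?_
    have hbij : Function.Bijective I.hom := ⟨I.hom_injective, I.hom_surjective⟩
    have key : ∀ g : projWreath P,
        ((MulEquiv.ofBijective I.hom hbij).symm g).1 t = I.nodeFun g.1 t := by
      intro g
      obtain ⟨f, rfl⟩ := hbij.2 g
      have h₁ : (MulEquiv.ofBijective I.hom hbij).symm (I.hom f) = f :=
        (MulEquiv.ofBijective I.hom hbij).symm_apply_apply f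
      have h₂ := I.E_nodeFun (I.perm f) (δ := I.m t) ⟨t, rfl⟩
      rw [perm_E] at h₂
      rw [h₁]
      exact congrArg Subtype.val ((I.E _).injective h₂).symm
    simp only [key]
    by_cases hm : I.m s = I.m t
    · convert isOpen_projWreath P (I.m t) (I.E _ ⟨t, rfl⟩) (I.E _ ⟨s, hm⟩) using 1
      ext g
      change I.nodeFun g.1 t = s ↔ g.1 (I.m t) (I.E _ ⟨t, rfl⟩) = _
      rw [← I.E_nodeFun g.1 (δ := I.m t) ⟨t, rfl⟩, (I.E _).injective.eq_iff, Subtype.ext_iff]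
    · convert isOpen_empty
      refine Set.eq_empty_of_forall_notMem fun g hg => hm ?_
      rw [← show I.nodeFun g.1 t = s from hg, m_nodeFun]

end Identification

end AutWreath

/-! ### Sections of the condensation map -/

section Sections

variable {T L : Type} [LE T] [LinearOrder L] {lev : T → L}

theorem eq_of_mk_eq (h : IsWeakLTree lev) {t c d : T} (hc : t ≤ c) (hd : t ≤ d)
    (hcd : Condensed.mk lev c = Condensed.mk lev d) : c = d :=
  h.eq_of_lev_eq hc hd (congrArg (Condensed.lev lev) hcd)

/-- Two nodes are coherent if the nodes above them with the same class coincide. -/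
def Coherent (lev : T → L) (s t : T) : Prop :=
  ∀ c d, s ≤ c → t ≤ d → Condensed.mk lev c = Condensed.mk lev d → c = d

/-- This is the one-step extension in the construction of sections. The nodes above `F` with class
above `δ` form an upward closed chain, and any node of class `δ` below the whole chain will do. If
the chain has a least element, such a node exists below it; otherwise the chain has a strict lower
bound in `F`, and (⋆) applies. -/
theorem exists_coherent (h : IsWeakLTree lev) (hstar : HasStar lev) (F : Finset T)
    (hne : F.Nonempty) (hF : ∀ s ∈ F, ∀ t ∈ F, Coherent lev s t) (δ : Condensed lev) :
    ∃ t, Condensed.mk lev t = δ ∧ ∀ s ∈ F, Coherent lev s t := by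
  have hc := h.condensed
  let C : Set T := {c | (∃ s ∈ F, s ≤ c) ∧ δ ≤ Condensed.mk lev c}
  have hupper : ∀ c ∈ C, ∀ d, c ≤ d → d ∈ C := by
    rintro c ⟨⟨s, hs, hsc⟩, hδ⟩ d hcd
    exact ⟨⟨s, hs, h.le_trans _ _ _ hsc hcd⟩, hc.le_trans _ _ _ hδ (Condensed.mk_le_mk hcd)⟩
  have hle : ∀ c ∈ C, ∀ d ∈ C, lev c ≤ lev d → c ≤ d := by
    rintro c ⟨⟨s, hs, hsc⟩, hδ⟩ d ⟨⟨s', hs', hsd⟩, hδ'⟩ hlev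
    obtain ⟨u, hu, hud⟩ := Condensed.exists_ge (hc.le_of_lev_le hδ hδ' hlev)
    exact hF s hs s' hs' u d (h.le_trans _ _ _ hsc hu) hsd hud ▸ hu
  suffices hlow : ∃ t, Condensed.mk lev t = δ ∧ ∀ c ∈ C, t ≤ c by
    obtain ⟨t, rfl, ht⟩ := hlow
    refine ⟨t, rfl, fun s hs c d hsc htd hcd => ?_⟩
    have hcC : c ∈ C := ⟨⟨s, hs, hsc⟩, hcd ▸ Condensed.mk_le_mk htd⟩
    exact eq_of_mk_eq h (ht c hcC) htd hcd
  by_cases hmin : ∃ c ∈ C, ∀ d ∈ C, c ≤ d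
  · obtain ⟨c, hcC, hcd⟩ := hmin
    obtain ⟨t, htc, ht⟩ := Condensed.exists_le hcC.2
    exact ⟨t, ht, fun d hd => h.le_trans _ _ _ htc (hcd d hd)⟩
  -- Finiteness of `F` enters here. If each `s` failed to be below some `c s` in the chain, the
  -- lowest of these nodes would lie above some `s'` in `F`, and then so would `c s'`.
  · have hlower : ∃ s ∈ F, ∀ c ∈ C, s ≤ c := by
      by_contra! hno
      choose! c hcC hcs using hno
      obtain ⟨s, hs, hsmin⟩ := F.exists_min_image (fun s => lev (c s)) hne
      obtain ⟨s', hs', hle'⟩ := (hcC s hs).1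
      exact hcs s' hs' (h.le_trans _ _ _ hle' (hle _ (hcC s hs) _ (hcC s' hs') (hsmin s' hs')))
    obtain ⟨s, -, hsC⟩ := hlower
    obtain ⟨t₀, rfl⟩ := δ.exists_rep
    obtain ⟨t, ht, htC⟩ := hstar C
      { chain := fun c hcC d hdC =>
          (le_total (lev c) (lev d)).imp (hle c hcC d hdC) (hle d hdC c hcC)
        upward_closed := hupper
        proper := ⟨s, fun c hcC => ⟨hsC c hcC, by rintro rfl; exact hmin ⟨s, hcC, hsC⟩⟩⟩ } t₀
      fun c hcC => hcC.2
    exact ⟨t, ht, htC⟩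

/-- A monotone choice of a node in each class. -/
structure IsSection (lev : T → L) (σ : Condensed lev → T) : Prop where
  mk_eq : ∀ δ, Condensed.mk lev (σ δ) = δ
  mono : ∀ δ γ, δ ≤ γ → σ δ ≤ σ γ

/-- A Rasiowa–Sikorski argument: finite coherent sets of nodes are extended step by step so as to
meet each of the countably many classes. Coherence of the chosen nodes makes the choice monotone. -/
theorem exists_section [Countable T] (h : IsWeakLTree lev) (hstar : HasStar lev) (t : T) :
    ∃ σ, IsSection lev σ ∧ σ (Condensed.mk lev t) = t := by
  classical
  let Q := {F : Finset T // F.Nonempty ∧ ∀ s ∈ F, ∀ t ∈ F, Coherent lev s t}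
  have hsymm : ∀ {s t}, Coherent lev s t → Coherent lev t s := fun hst c d hc hd hcd =>
    (hst d c hd hc hcd.symm).symm
  have hrefl : ∀ t, Coherent lev t t := fun t c d => eq_of_mk_eq h
  let 𝒟 : Condensed lev → Order.Cofinal Q := fun δ =>
    { carrier := {F | ∃ t ∈ F.1, Condensed.mk lev t = δ}
      isCofinal := by
        rintro ⟨F, hne, hF⟩
        obtain ⟨t, ht, htF⟩ := exists_coherent h hstar F hne hF δ
        refine ⟨⟨insert t F, Finset.insert_nonempty _ _, ?_⟩, ⟨t, Finset.mem_insert_self _ _, ht⟩,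
          Finset.subset_insert _ _⟩
        intro a ha b hb
        rcases Finset.mem_insert.1 ha with rfl | ha' <;>
          rcases Finset.mem_insert.1 hb with rfl | hb'
        · exact hrefl _
        · exact hsymm (htF b hb')
        · exact htF a ha'
        · exact hF a ha' b hb' }
  have : Countable (Condensed lev) := inferInstanceAs (Countable (Quotient _))
  have := Encodable.ofCountable (Condensed lev)
  let p : Q := ⟨{t}, Finset.singleton_nonempty t, fun a ha b hb => by
    rw [Finset.mem_singleton.1 ha, Finset.mem_singleton.1 hb]
    exact hrefl t⟩
  let F := Order.sequenceOfCofinals p 𝒟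
  have hcoh : ∀ n m, ∀ a ∈ (F n).1, ∀ b ∈ (F m).1, Coherent lev a b := fun n m a ha b hb =>
    (F (max n m)).2.2 a (Order.sequenceOfCofinals.monotone p 𝒟 (le_max_left n m) ha) b
      (Order.sequenceOfCofinals.monotone p 𝒟 (le_max_right n m) hb)
  choose σ hσF hσ using fun δ => Order.sequenceOfCofinals.encode_mem p 𝒟 δ
  refine ⟨σ, ⟨hσ, fun δ γ hδγ => ?_⟩, ?_⟩
  · obtain ⟨u, hu, huγ⟩ := Condensed.exists_ge ((hσ δ).symm ▸ hδγ)
    have := hcoh _ _ _ (hσF δ) _ (hσF γ) u (σ γ) hu (h.le_refl _) (huγ.trans (hσ γ).symm)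
    exact this ▸ hu
  · exact hcoh _ 0 _ (hσF _) t (Finset.mem_singleton_self t) _ _ (h.le_refl _) (h.le_refl _) (hσ _)

open Classical in
/-- The node of class `γ` above `t`. -/
noncomputable def up (lev : T → L) (t : T) (γ : Condensed lev) : T :=
  if h : Condensed.mk lev t ≤ γ then (Condensed.exists_ge h).choose else t

theorem le_up {t : T} {γ : Condensed lev} (h : Condensed.mk lev t ≤ γ) : t ≤ up lev t γ := by
  rw [up, dif_pos h]
  exact (Condensed.exists_ge h).choose_spec.1

theorem mk_up {t : T} {γ : Condensed lev} (h : Condensed.mk lev t ≤ γ) :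
    Condensed.mk lev (up lev t γ) = γ := by
  rw [up, dif_pos h]
  exact (Condensed.exists_ge h).choose_spec.2

theorem up_eq (h : IsWeakLTree lev) {t s : T} {γ : Condensed lev} (hts : t ≤ s)
    (hs : Condensed.mk lev s = γ) : up lev t γ = s := by
  subst hs
  exact eq_of_mk_eq h (le_up (Condensed.mk_le_mk hts)) hts (mk_up (Condensed.mk_le_mk hts))

theorem IsSection.up_eq (h : IsWeakLTree lev) {σ : Condensed lev → T} (hσ : IsSection lev σ)
    {δ γ : Condensed lev} (hδγ : δ ≤ γ) : up lev (σ δ) γ = σ γ :=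
  UltraIso.up_eq h (hσ.mono _ _ hδγ) (hσ.mk_eq γ)

end Sections

/-! ### Siblings and their labels -/

section Siblings

variable {T L : Type} [LE T] [LinearOrder L] {lev : T → L}

/-- The nodes of the same class as `t` below all nodes that are strictly above `t`. -/
def siblings (lev : T → L) (t : T) : Set T :=
  {t' | Condensed.mk lev t' = Condensed.mk lev t ∧ ∀ s, t ≤ s → t ≠ s → t' ≤ s}

theorem self_mem_siblings (t : T) : t ∈ siblings lev t := ⟨rfl, fun _ hs _ => hs⟩

theorem ne_of_siblings (h : IsWeakLTree lev) {t t' s : T} (ht : t' ∈ siblings lev t)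
    (hs : t ≤ s) (hne : t ≠ s) : t' ≠ s := by
  rintro rfl
  have : lev t' = lev t := congrArg (Condensed.lev lev) ht.1
  exact (h.lev_lt t t' hs hne).ne' this

theorem siblings_symm (h : IsWeakLTree lev) {t t' : T} (ht : t' ∈ siblings lev t) :
    t ∈ siblings lev t' := by
  refine ⟨ht.1.symm, fun s hs hne => ?_⟩
  have hle : Condensed.mk lev t ≤ Condensed.mk lev s := ht.1 ▸ Condensed.mk_le_mk hs
  have hu := le_up hle
  have hmk := mk_up hle
  have hne' : t ≠ up lev t (Condensed.mk lev s) := fun heq => by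
    rw [← heq] at hmk
    have h₁ : lev t' = lev t := congrArg (Condensed.lev lev) ht.1
    have h₂ : lev t = lev s := congrArg (Condensed.lev lev) hmk
    exact (h.lev_lt t' s hs hne).ne (h₁.trans h₂)
  rw [← eq_of_mk_eq h (ht.2 _ hu hne') hs hmk]
  exact hu

theorem siblings_eq (h : IsWeakLTree lev) {t t' : T} (ht : t' ∈ siblings lev t) :
    siblings lev t' = siblings lev t := by
  have trans : ∀ {a b c}, b ∈ siblings lev a → c ∈ siblings lev b → c ∈ siblings lev a :=
    fun {a b c} hab hbc => ⟨hbc.1.trans hab.1, fun s hs hne =>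
      hbc.2 s (hab.2 s hs hne) (ne_of_siblings h hab hs hne)⟩
  exact Set.Subset.antisymm (fun c hc => trans ht hc) fun c hc => trans (siblings_symm h ht) hc

theorem apply_mem_siblings {f : Equiv.Perm T} (hf : f ∈ treeAut lev) {t t' : T}
    (ht : t' ∈ siblings lev t) : f t' ∈ siblings lev (f t) := by
  refine ⟨by rw [Condensed.mk_apply hf, Condensed.mk_apply hf, ht.1], fun s hs hne => ?_⟩
  have hs' : f (f⁻¹ s) = s := perm_apply_inv f s
  rw [← hs'] at hs hne ⊢
  exact (hf.2 _ _).1 (ht.2 _ ((hf.2 _ _).2 hs) fun h => hne (congrArg f h))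

theorem encard_siblings_le {f : Equiv.Perm T} (hf : f ∈ treeAut lev) (t : T) :
    (siblings lev t).encard ≤ (siblings lev (f t)).encard := by
  rw [← f.injective.encard_image]
  refine Set.encard_le_encard ?_
  rintro _ ⟨t', ht, rfl⟩
  exact apply_mem_siblings hf ht

/-- The number of siblings of the nodes of a class. -/
noncomputable def sibCount (lev : T → L) (δ : Condensed lev) : ℕ∞ :=
  (siblings lev δ.exists_rep.choose).encard

theorem sibCount_mk (t : T) : sibCount lev (Condensed.mk lev t) = (siblings lev t).encard := by
  obtain ⟨f, hf, hft⟩ := Condensed.mk_eq_iff.1 (Condensed.mk lev t).exists_rep.choose_spec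
  have hft' : f⁻¹ t = (Condensed.mk lev t).exists_rep.choose := by
    rw [Equiv.Perm.inv_eq_iff_eq, hft]
  refine le_antisymm ?_ ?_
  · have := encard_siblings_le hf (Condensed.mk lev t).exists_rep.choose
    rwa [hft] at this
  · have := encard_siblings_le (inv_mem hf) t
    rwa [hft'] at this

/-- A node counts among its own siblings, so the label is at least 1 and 0 is always an admissible
coordinate. -/
theorem sibCount_ne_zero (δ : Condensed lev) : sibCount lev δ ≠ 0 :=
  Set.encard_ne_zero.2 ⟨_, self_mem_siblings _⟩

theorem exists_bijOn_encard {A : Set T} (hA : A.Countable) :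
    ∃ k : T → ℕ, Set.BijOn k A {n | (n : ℕ∞) < A.encard} := by
  classical
  by_cases hfin : A.Finite
  · refine hfin.exists_bijOn_of_encard_eq ?_
    have : {n : ℕ | (n : ℕ∞) < A.encard} = (Finset.range A.ncard : Set ℕ) := by
      ext n
      rw [← hfin.cast_ncard_eq]
      simp
    rw [this, Set.encard_coe_eq_coe_finsetCard, Finset.card_range, hfin.cast_ncard_eq]
  · have := hA.to_subtype
    have : Infinite A := Set.infinite_coe_iff.2 hfin
    obtain ⟨e⟩ := nonempty_equiv_of_countable (α := A) (β := ℕ)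
    refine ⟨fun t => if h : t ∈ A then e ⟨t, h⟩ else 0, fun t _ => ?_, ?_, ?_⟩
    · simp [Set.Infinite.encard_eq hfin]
    · intro t ht t' ht' heq
      simp only [dif_pos ht, dif_pos ht'] at heq
      exact congrArg Subtype.val (e.injective heq)
    · intro n _
      refine ⟨(e.symm n).1, (e.symm n).2, ?_⟩
      simp

theorem exists_pointed_bijOn {A : Set T} (hA : A.Countable) {a : T} (ha : a ∈ A) :
    ∃ k : T → ℕ, Set.BijOn k A {n | (n : ℕ∞) < A.encard} ∧ k a = 0 := by
  obtain ⟨k, hk⟩ := exists_bijOn_encard hA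
  have h0 : (0 : ℕ) ∈ {n : ℕ | (n : ℕ∞) < A.encard} :=
    pos_iff_ne_zero.2 (Set.encard_ne_zero.2 ⟨a, ha⟩)
  have hka := hk.mapsTo ha
  have hmaps : ∀ n ∈ {n : ℕ | (n : ℕ∞) < A.encard},
      Equiv.swap (k a) 0 n ∈ {n : ℕ | (n : ℕ∞) < A.encard} := fun n hn => by
    rw [Equiv.swap_apply_def]
    split_ifs
    exacts [h0, hka, hn]
  refine ⟨Equiv.swap (k a) 0 ∘ k, Set.BijOn.comp ⟨hmaps, (Equiv.injective _).injOn, ?_⟩ hk, by simp⟩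
  exact fun n hn => ⟨_, hmaps n hn, by simp⟩

end Siblings

/-! ### Coordinates of the nodes of a tree -/

section Coordinates

variable {T L : Type} [LE T] [LinearOrder L] {lev : T → L}

/-- A sequence of sections that passes through every node. -/
structure IsCover (lev : T → L) (σ : ℕ → Condensed lev → T) : Prop where
  isSection : ∀ n, IsSection lev (σ n)
  exists_eq : ∀ t, ∃ n, σ n (Condensed.mk lev t) = t

theorem exists_cover [Countable T] [Nonempty T] (h : IsWeakLTree lev) (hstar : HasStar lev) :
    ∃ σ, IsCover lev σ := by
  obtain ⟨a, ha⟩ := exists_surjective_nat T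
  choose σ hσ hσa using fun n => exists_section h hstar (a n)
  refine ⟨σ, hσ, fun t => ?_⟩
  obtain ⟨n, rfl⟩ := ha t
  exact ⟨n, hσa n⟩

/-- The index of the first section that passes through the siblings of `t`. -/
noncomputable def firstIndex (σ : ℕ → Condensed lev → T) (t : T) : ℕ :=
  sInf {n | σ n (Condensed.mk lev t) ∈ siblings lev t}

/-- The sibling of `t` on the first section that passes through its siblings. -/
noncomputable def baseSibling (σ : ℕ → Condensed lev → T) (t : T) : T :=
  σ (firstIndex σ t) (Condensed.mk lev t)

variable {σ : ℕ → Condensed lev → T}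

theorem IsCover.baseSibling_mem (hσ : IsCover lev σ) (t : T) :
    baseSibling σ t ∈ siblings lev t := by
  obtain ⟨n, hn⟩ := hσ.exists_eq t
  exact Nat.sInf_mem (s := {n | σ n (Condensed.mk lev t) ∈ siblings lev t})
    ⟨n, by rw [Set.mem_ofPred_eq, hn]; exact self_mem_siblings t⟩

theorem firstIndex_le {t : T} {n : ℕ} (h : σ n (Condensed.mk lev t) ∈ siblings lev t) :
    firstIndex σ t ≤ n :=
  Nat.sInf_le h

theorem firstIndex_congr (h : IsWeakLTree lev) {t t' : T} (ht : t' ∈ siblings lev t) :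
    firstIndex σ t' = firstIndex σ t := by
  rw [firstIndex, siblings_eq h ht, ht.1]
  rfl

theorem baseSibling_congr (h : IsWeakLTree lev) {t t' : T} (ht : t' ∈ siblings lev t) :
    baseSibling σ t' = baseSibling σ t := by
  rw [baseSibling, baseSibling, firstIndex_congr h ht, ht.1]

/-- A labelling of the nodes that enumerates each set of siblings, starting with the base. -/
structure IsLabelling (lev : T → L) (σ : ℕ → Condensed lev → T) (lab : T → ℕ) : Prop where
  lt : ∀ t, (lab t : ℕ∞) < sibCount lev (Condensed.mk lev t)
  inj : ∀ t, ∀ t' ∈ siblings lev t, lab t = lab t' → t = t'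
  surj : ∀ t (n : ℕ), (n : ℕ∞) < sibCount lev (Condensed.mk lev t) →
    ∃ t' ∈ siblings lev t, lab t' = n
  eq_zero_iff : ∀ t, lab t = 0 ↔ baseSibling σ t = t

theorem IsCover.exists_labelling [Countable T] (h : IsWeakLTree lev) (hσ : IsCover lev σ) :
    ∃ lab, IsLabelling lev σ lab := by
  -- The enumeration is chosen as a function of the set of siblings and its base, so that all
  -- siblings use the same one.
  have hex : ∀ (A : Set T) (a : T), ∃ k : T → ℕ, a ∈ A →
      Set.BijOn k A {n | (n : ℕ∞) < A.encard} ∧ k a = 0 := fun A a => by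
    by_cases ha : a ∈ A
    · obtain ⟨k, hk⟩ := exists_pointed_bijOn A.to_countable ha
      exact ⟨k, fun _ => hk⟩
    · exact ⟨fun _ => 0, fun ha' => absurd ha' ha⟩
  choose k hk using hex
  have hkt := fun t => hk (siblings lev t) (baseSibling σ t) (hσ.baseSibling_mem t)
  have hcongr : ∀ t, ∀ t' ∈ siblings lev t,
      k (siblings lev t') (baseSibling σ t') t' = k (siblings lev t) (baseSibling σ t) t' :=
    fun t t' ht => by rw [siblings_eq h ht, baseSibling_congr h ht]
  refine ⟨fun t => k (siblings lev t) (baseSibling σ t) t, fun t => ?_, fun t t' ht heq => ?_,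
    fun t n hn => ?_, fun t => ⟨fun h0 => ?_, fun hb => ?_⟩⟩
  · rw [sibCount_mk]
    exact (hkt t).1.mapsTo (self_mem_siblings t)
  · rw [hcongr t t' ht] at heq
    exact (hkt t).1.injOn (self_mem_siblings t) ht heq
  · rw [sibCount_mk] at hn
    obtain ⟨t', ht, hn'⟩ := (hkt t).1.surjOn hn
    exact ⟨t', ht, (hcongr t t' ht).trans hn'⟩
  · exact (hkt t).1.injOn (hσ.baseSibling_mem t) (self_mem_siblings t) ((hkt t).2.trans h0.symm)
  · have h0 := (hkt t).2
    rwa [congrArg (k (siblings lev t) (baseSibling σ t)) hb] at h0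

variable {lab : T → ℕ}

theorem up_up (h : IsWeakLTree lev) {t : T} {γ β : Condensed lev}
    (hγ : Condensed.mk lev t ≤ γ) (hβ : γ ≤ β) : up lev (up lev t γ) β = up lev t β := by
  have hβ' : Condensed.mk lev (up lev t γ) ≤ β := (mk_up hγ).symm ▸ hβ
  exact (up_eq h (h.le_trans _ _ _ (le_up hγ) (le_up hβ')) (mk_up hβ')).symm

/-- If `t` lies on the `n`-th section, all nodes above it have first index at most `n`. If two of
them share the first index `m`, the section `m` meets the siblings of the lower one and hence passes
through the upper one, whose label is therefore 0. So each index contributes at most one nonzero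
label. -/
theorem IsLabelling.finite_support (h : IsWeakLTree lev) (hσ : IsCover lev σ)
    (hlab : IsLabelling lev σ lab) (t : T) :
    {γ | Condensed.mk lev t ≤ γ ∧ lab (up lev t γ) ≠ 0}.Finite := by
  have hc := h.condensed
  obtain ⟨n, hn⟩ := hσ.exists_eq t
  refine Set.Finite.of_finite_image (f := fun γ => firstIndex σ (up lev t γ))
    ((Set.finite_Iic n).subset ?_) ?_
  · rintro _ ⟨γ, ⟨hγ, -⟩, rfl⟩
    refine firstIndex_le ?_
    have hup := (hσ.isSection n).up_eq h hγ
    rw [hn] at hup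
    rw [mk_up hγ, ← hup]
    exact self_mem_siblings _
  · have key : ∀ γ γ', Condensed.mk lev t ≤ γ → γ ≤ γ' → γ ≠ γ' →
        firstIndex σ (up lev t γ) = firstIndex σ (up lev t γ') → lab (up lev t γ') = 0 := by
      intro γ γ' hγ hγγ' hne hfi
      have hγ' := hc.le_trans _ _ _ hγ hγγ'
      rw [hlab.eq_zero_iff, baseSibling, ← hfi, mk_up hγ']
      have hb := hσ.baseSibling_mem (up lev t γ)
      rw [baseSibling, mk_up hγ] at hb
      have hle : up lev t γ ≤ up lev t γ' := by
        rw [← up_up h hγ hγγ']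
        exact le_up ((mk_up hγ).symm ▸ hγγ')
      have hlt := hb.2 _ hle fun heq => hne (by rw [← mk_up hγ, heq, mk_up hγ'])
      rw [← (hσ.isSection _).up_eq h hγγ', up_eq h hlt (mk_up hγ')]
    rintro γ ⟨hγ, hγ0⟩ γ' ⟨hγ', hγ'0⟩ hfi
    by_contra hne
    rcases hc.le_total_of_le hγ hγ' with hle | hle
    · exact hγ'0 (key γ γ' hγ hle hne hfi)
    · exact hγ0 (key γ' γ hγ' hle (Ne.symm hne) hfi.symm)

/-- This is where the splitting axiom of `L`-trees is used: at the largest level of disagreement the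
two nodes above `t` and `t'` are siblings, and siblings are separated by their labels. -/
theorem IsLabelling.eq_of_labels_eq (h : IsLTree lev) (hlab : IsLabelling lev σ lab) {t t' : T}
    (htt : Condensed.mk lev t = Condensed.mk lev t')
    (heq : ∀ γ, Condensed.mk lev t ≤ γ → lab (up lev t γ) = lab (up lev t' γ)) : t = t' := by
  have hw := h.toIsWeakLTree
  have hlev : lev t = lev t' := congrArg (Condensed.lev lev) htt
  by_contra hne
  obtain ⟨ℓ, ⟨hℓ, hag⟩, hmax⟩ := h.exists_split t t' (fun hle => (hw.lev_lt _ _ hle hne).ne hlev)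
    fun hle => (hw.lev_lt _ _ hle (Ne.symm hne)).ne hlev.symm
  obtain ⟨u, ⟨htu, rfl⟩, -⟩ := hw.existsUnique_above t ℓ ((le_max_left _ _).trans hℓ)
  obtain ⟨u', ⟨htu', hlev'⟩, -⟩ := hw.existsUnique_above t' _ ((le_max_right _ _).trans hℓ)
  have hmk : Condensed.mk lev u' = Condensed.mk lev u :=
    hw.condensed.eq_of_lev_eq (htt ▸ Condensed.mk_le_mk htu') (Condensed.mk_le_mk htu) hlev'
  have hsib : u' ∈ siblings lev u := by
    refine ⟨hmk, fun s hs hus => ?_⟩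
    have hlt := hw.lev_lt u s hs hus
    have : AgreeAt lev t t' (lev s) := by
      by_contra hna
      exact (hmax ⟨hℓ.trans hlt.le, hna⟩).not_gt hlt
    obtain ⟨c, hc, hc', hcs⟩ := this
    obtain rfl := hw.eq_of_lev_eq hc (hw.le_trans _ _ _ htu hs) hcs
    exact hw.le_of_lev_le htu' hc' (hlev'.le.trans hlt.le)
  have hl := heq (Condensed.mk lev u) (Condensed.mk_le_mk htu)
  rw [up_eq hw htu rfl, up_eq hw htu' hmk] at hl
  have := hlab.inj u u' hsib hl
  subst this
  exact hag ⟨u, htu, htu', rfl⟩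

/-- Induction on the number of nonzero values: realize the pattern from the lowest nonzero class
upwards, then descend along the first section through the node obtained, which produces only zeros.
The function `z` is total so that `δ` can be moved up in the induction; its values outside the cone
play no role. -/
theorem IsLabelling.exists_node (h : IsWeakLTree lev) (hσ : IsCover lev σ)
    (hlab : IsLabelling lev σ lab) (k : ℕ) : ∀ (δ : Condensed lev) (z : Condensed lev → ℕ),
      (∀ γ, (z γ : ℕ∞) < sibCount lev γ) → {γ | δ ≤ γ ∧ z γ ≠ 0}.Finite →
      {γ | δ ≤ γ ∧ z γ ≠ 0}.ncard = k →
      ∃ t, Condensed.mk lev t = δ ∧ ∀ γ, δ ≤ γ → lab (up lev t γ) = z γ := by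
  classical
  have hc := h.condensed
  -- If a section earlier than `n` met the siblings of `σ n δ`, it would also pass through `s`,
  -- contrary to the minimality of `n`. So `σ n δ` is the base of its siblings.
  have hbase : ∀ n δ γ s, Condensed.mk lev s = γ → δ ≤ γ → δ ≠ γ → σ n γ = s →
      (∀ m, σ m γ = s → n ≤ m) → lab (σ n δ) = 0 := by
    intro n δ γ s hs hδγ hne hns hmin
    have hmk := (hσ.isSection n).mk_eq δ
    rw [hlab.eq_zero_iff, baseSibling, hmk]
    have hself : σ n (Condensed.mk lev (σ n δ)) ∈ siblings lev (σ n δ) := by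
      rw [hmk]
      exact self_mem_siblings _
    have hb := hσ.baseSibling_mem (σ n δ)
    rw [baseSibling, hmk] at hb
    have hlt : σ (firstIndex σ (σ n δ)) δ ≤ s := by
      refine hb.2 s (hns ▸ (hσ.isSection n).mono _ _ hδγ) fun heq => hne ?_
      rw [← hmk, heq, hs]
    have hm : σ (firstIndex σ (σ n δ)) γ = s := by
      rw [← (hσ.isSection _).up_eq h hδγ, up_eq h hlt hs]
    rw [le_antisymm (firstIndex_le hself) (hmin _ hm)]
  induction k with
  | zero =>
    intro δ z hz hfin hcard
    have hempty := (Set.ncard_eq_zero hfin).1 hcard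
    have hz0 : ∀ γ, δ ≤ γ → z γ = 0 := fun γ hγ => by
      by_contra h0
      exact (hempty ▸ (⟨hγ, h0⟩ : γ ∈ {γ | δ ≤ γ ∧ z γ ≠ 0}) : γ ∈ (∅ : Set _))
    refine ⟨σ 0 δ, (hσ.isSection 0).mk_eq δ, fun γ hγ => ?_⟩
    have hmk := (hσ.isSection 0).mk_eq γ
    rw [(hσ.isSection 0).up_eq h hγ, hz0 γ hγ, hlab.eq_zero_iff, baseSibling, hmk]
    have : σ 0 (Condensed.mk lev (σ 0 γ)) ∈ siblings lev (σ 0 γ) := by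
      rw [hmk]
      exact self_mem_siblings _
    rw [Nat.le_zero.1 (firstIndex_le this)]
  | succ k ih =>
    intro δ z hz hfin hcard
    have hne : {γ | δ ≤ γ ∧ z γ ≠ 0}.Nonempty :=
      Set.nonempty_of_ncard_ne_zero (by omega)
    obtain ⟨γ₁, ⟨hδ, hγ₁⟩, hmin⟩ := Set.exists_min_image _ (Condensed.lev lev) hfin hne
    -- With the value at `γ₁` reset, the induction hypothesis gives a node with the right labels
    -- strictly above `γ₁`; passing to a sibling then corrects the label at `γ₁` alone.
    let z' := Function.update z γ₁ 0
    have hset : {γ | γ₁ ≤ γ ∧ z' γ ≠ 0} = {γ | δ ≤ γ ∧ z γ ≠ 0} \ {γ₁} := by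
      ext γ
      constructor
      · rintro ⟨hle, h0⟩
        have hne : γ ≠ γ₁ := by
          rintro rfl
          exact h0 (Function.update_self ..)
        refine ⟨⟨hc.le_trans _ _ _ hδ hle, ?_⟩, hne⟩
        rwa [show z' γ = z γ from Function.update_of_ne hne ..] at h0
      · rintro ⟨⟨hle, h0⟩, hne⟩
        refine ⟨hc.le_of_lev_le hδ hle (hmin γ ⟨hle, h0⟩), ?_⟩
        rwa [show z' γ = z γ from Function.update_of_ne hne ..]
    obtain ⟨s', hs', hlab'⟩ := ih γ₁ z' (fun γ => by
        by_cases hγ : γ = γ₁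
        · subst hγ
          rw [show z' γ = 0 from Function.update_self ..]
          exact pos_iff_ne_zero.2 (sibCount_ne_zero γ)
        · rw [show z' γ = z γ from Function.update_of_ne hγ ..]
          exact hz γ) (hset ▸ hfin.sdiff) (by
        rw [hset, Set.ncard_sdiff_singleton_of_mem (by exact ⟨hδ, hγ₁⟩), hcard]
        rfl)
    obtain ⟨s, hss, hsz⟩ := hlab.surj s' (z γ₁) (hs' ▸ hz γ₁)
    have hs : Condensed.mk lev s = γ₁ := hss.1.trans hs'
    have hlabs : ∀ γ, γ₁ ≤ γ → lab (up lev s γ) = z γ := by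
      intro γ hγ
      by_cases heq : γ = γ₁
      · subst heq
        rw [up_eq h (h.le_refl s) hs, hsz]
      · have hγs : Condensed.mk lev s' ≤ γ := hs'.symm ▸ hγ
        have hlt := hss.2 _ (le_up hγs) fun h' => heq (by rw [← mk_up hγs, ← h', hs'])
        rw [up_eq h hlt (mk_up hγs), hlab' γ hγ]
        exact Function.update_of_ne heq ..
    have hexn : ∃ n, σ n γ₁ = s := hs ▸ hσ.exists_eq s
    have hfind := Nat.find_spec hexn
    set n := Nat.find hexn with hn
    refine ⟨σ n δ, (hσ.isSection n).mk_eq δ, fun γ hγ => ?_⟩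
    rw [(hσ.isSection n).up_eq h hγ]
    by_cases hle : γ₁ ≤ γ
    · rw [← hlabs γ hle, ← (hσ.isSection n).up_eq h hle, hfind]
    · have hle' : γ ≤ γ₁ := (hc.le_total_of_le hδ hγ).resolve_left hle
      rw [hbase n γ γ₁ s hs hle' (fun h' => hle (h' ▸ hc.le_refl _)) hfind
        fun m hm => Nat.find_min' hexn hm]
      by_contra h0
      exact hle (hc.le_of_lev_le hδ hγ (hmin γ ⟨hγ, Ne.symm h0⟩))

/-- The partial order on the condensed tree. -/
@[reducible]
def condensedOrder (h : IsWeakLTree lev) : PartialOrder (Condensed lev) where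
  le_refl := h.condensed.le_refl
  le_trans := h.condensed.le_trans
  le_antisymm := h.condensed.le_antisymm

theorem isCountableTreeable_condensed [Countable T] [Nonempty T] (h : IsLTree lev)
    (hp : IsPruned lev) (hstar : HasStar lev) :
    @IsCountableTreeable _ (condensedOrder h.toIsWeakLTree) (sibCount lev) :=
  let _ := condensedOrder h.toIsWeakLTree
  { nonempty := ‹Nonempty T›.map (Condensed.mk lev)
    countable := inferInstanceAs (Countable (Quotient _))
    label_ne_zero := sibCount_ne_zero
    treeable := ⟨L, inferInstance, Condensed.lev lev, h.isSpecial hstar, hp.condensed⟩ }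

/-- A node is sent to the labels of the nodes above it, a sequence on the cone of its class. Moving
up in the tree becomes restriction of sequences. -/
theorem exists_wreath_equiv [Countable T] [Nonempty T] (h : IsLTree lev) (hp : IsPruned lev)
    (hstar : HasStar lev) :
    ∃ (Δ : Type) (_ : PartialOrder Δ) (N : Δ → ℕ∞), IsCountableTreeable N ∧
      Nonempty (treeAut lev ≃ₜ* wreath (domainLF N)) := by
  classical
  have hw := h.toIsWeakLTree
  have hc := hw.condensed
  let _ := condensedOrder hw
  obtain ⟨σ, hσ⟩ := exists_cover hw hstar
  obtain ⟨lab, hlab⟩ := hσ.exists_labelling hw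
  let N := sibCount lev
  have hN : ∀ δ, N δ ≠ 0 := sibCount_ne_zero
  have hS : (domainLF N).carrier.Nonempty := ⟨zeroSeq hN, zeroSeq_mem hN⟩
  let P := (domainLF N).projections hS
  have hbound : ∀ {t : T} {γ : Condensed lev}, Condensed.mk lev t ≤ γ →
      (lab (up lev t γ) : ℕ∞) < N γ := fun {t γ} hγ => by
    have := hlab.lt (up lev t γ)
    rwa [mk_up hγ] at this
  let z : ∀ δ, {t // Condensed.mk lev t = δ} → LocalSeq N δ := fun δ t γ =>
    ⟨lab (up lev t.1 γ.1), hbound (t.2.symm ▸ γ.2)⟩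
  have hz : ∀ δ t, z δ t ∈ P.S δ := by
    rintro δ ⟨t, rfl⟩
    -- Outside the cone the sequence of labels is extended by zeros, so its support is even finite.
    refine ⟨fun γ => if hγ : Condensed.mk lev t ≤ γ then ⟨lab (up lev t γ), hbound hγ⟩
      else zeroSeq hN γ, fun β => ?_, funext fun γ => dif_pos γ.2⟩
    refine (hlab.finite_support hw hσ t).subset ?_
    rintro γ ⟨hγ, -⟩
    by_cases hle : Condensed.mk lev t ≤ γ
    · refine ⟨hle, fun h0 => hγ ?_⟩
      simpa [hle] using h0
    · refine absurd ?_ hγ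
      simp [hle, zeroSeq]
  have hbij : ∀ δ, Function.Bijective fun t => (⟨z δ t, hz δ t⟩ : P.S δ) := by
    refine fun δ => ⟨fun t t' heq => ?_, ?_⟩
    · obtain ⟨t, rfl⟩ := t
      obtain ⟨t', ht'⟩ := t'
      refine Subtype.ext (hlab.eq_of_labels_eq h ht'.symm fun γ hγ => ?_)
      exact congrArg Subtype.val (congrFun (congrArg Subtype.val heq) ⟨γ, hγ⟩)
    · rintro ⟨_, x, hx, rfl⟩
      have hfin : {γ | δ ≤ γ ∧ (x γ).1 ≠ 0}.Finite := (hx δ).subset fun γ hγ => ⟨hγ.2, hγ.1⟩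
      obtain ⟨t, rfl, ht⟩ := hlab.exists_node hw hσ _ δ (fun γ => (x γ).1) (fun γ => (x γ).2)
        hfin rfl
      exact ⟨⟨t, rfl⟩, Subtype.ext (funext fun γ => Subtype.ext (ht γ.1 γ.2))⟩
  let I : Identification lev P :=
    { m := Condensed.mk lev
      m_apply := fun f hf t => Condensed.mk_apply hf t
      lev_eq := fun t t' htt => congrArg (Condensed.lev lev) htt
      m_mono := fun t t' htt => Condensed.mk_le_mk htt
      E := fun δ => Equiv.ofBijective _ (hbij δ)
      le_iff := by
        rintro δ γ hδγ ⟨t, rfl⟩ s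
        have hup : P.proj hδγ ⟨z _ ⟨t, rfl⟩, hz _ _⟩ =
            ⟨z γ ⟨up lev t γ, mk_up hδγ⟩, hz _ _⟩ :=
          Subtype.ext (funext fun β => Subtype.ext (congrArg lab (up_up hw hδγ β.2).symm))
        change _ ↔ P.proj hδγ ⟨z _ ⟨t, rfl⟩, hz _ _⟩ = ⟨z γ s, hz _ _⟩
        rw [hup]
        constructor
        · intro hts
          have : (⟨up lev t γ, mk_up hδγ⟩ : {t // Condensed.mk lev t = γ}) = s :=
            Subtype.ext (up_eq hw hts s.2)
          rw [this]
        · intro heq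
          have := congrArg Subtype.val ((hbij γ).1 heq)
          exact this ▸ le_up hδγ }
  obtain ⟨e₁⟩ := I.nonempty_equiv
  obtain ⟨e₂⟩ := GlobalDomain.nonempty_localWreath_equiv (hS := hS)
    (domainLF_isLocallyDetermined (N := N))
  exact ⟨_, _, N, isCountableTreeable_condensed h hp hstar, ⟨e₁.trans e₂⟩⟩

end Coordinates

/-! ### Trees from exact spaces -/

section TreesFromSpaces

variable {U : Type} [MetricSpace U]

/-- The set of positive distances. -/
def distances (U : Type) [MetricSpace U] : Set ℝ := {r | ∃ x y : U, x ≠ y ∧ dist x y = r}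

/-- By the isosceles property, points sufficiently close to `x` and `y` have exactly the same
distance, so all positive distances already occur in a countable dense set. -/
theorem countable_distances (hU : IsPolishUltrametric U) : (distances U).Countable := by
  have := hU.ultrametric
  have := hU.secondCountable
  obtain ⟨Q, hQ, hd⟩ := TopologicalSpace.exists_countable_dense U
  refine (hQ.image2 hQ dist).mono ?_
  rintro _ ⟨x, y, hxy, rfl⟩
  obtain ⟨p, hp, hxp⟩ := hd.exists_dist_lt x (dist_pos.2 hxy)
  obtain ⟨q, hq, hyq⟩ := hd.exists_dist_lt y (dist_pos.2 hxy)
  refine ⟨p, hp, q, hq, le_antisymm ?_ ?_⟩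
  · refine (dist_triangle_max p x q).trans (max_le (dist_comm x p ▸ hxp.le) ?_)
    exact (dist_triangle_max x y q).trans (max_le le_rfl hyq.le)
  · by_contra! hlt
    have h₁ : dist x q < dist x y := (dist_triangle_max x p q).trans_lt (max_lt hxp hlt)
    have h₂ := (dist_triangle_max x q y).trans_lt (max_lt h₁ (dist_comm y q ▸ hyq))
    exact h₂.false

theorem exists_tree_of_isScale [Nonempty U] (hU : IsPolishUltrametric U) (hex : IsExact U)
    {L : Type} [LinearOrder L] [Countable L] {e : L → ℝ} (he : IsScale U e) :
    ∃ (T : Type) (_ : LE T) (lev : T → L), IsLTree lev ∧ Countable T ∧ IsPruned lev ∧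
      IsSpecial lev ∧ HasStar lev ∧ Nonempty ((U ≃ᵢ U) ≃ₜ* treeAut lev) := by
  have := hU.ultrametric
  have := hU.complete
  have := hU.secondCountable
  have hT := BallNode.isLTree he
  have hstar := BallNode.hasStar he hex
  exact ⟨BallNode U e, inferInstance, BallNode.lev, hT, BallNode.countable he,
    BallNode.isPruned he, hT.isSpecial hstar, hstar, BallNode.nonempty_equiv he⟩

theorem exists_ratTree [Nonempty U] (hU : IsPolishUltrametric U) (hex : IsExact U) :
    ∃ (T : Type) (_ : LE T) (lev : T → ℚ), IsLTree lev ∧ Countable T ∧ IsPruned lev ∧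
      IsSpecial lev ∧ HasStar lev ∧ Nonempty ((U ≃ᵢ U) ≃ₜ* treeAut lev) := by
  -- The positive rationals make the scale dense and without endpoints, so it is isomorphic to `ℚ`
  -- by Cantor's theorem; they also supply arbitrarily small and arbitrarily large radii.
  let R : Set ℝ := distances U ∪ {r | 0 < r ∧ r ∈ Set.range ((↑) : ℚ → ℝ)}
  have hpos : ∀ r ∈ R, 0 < r := by
    rintro r (⟨x, y, hxy, rfl⟩ | hr)
    · exact dist_pos.2 hxy
    · exact hr.1
  have hR : R.Countable := (countable_distances hU).union
    ((Set.countable_range _).mono fun r hr => hr.2)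
  have hbetween : ∀ a b : ℝ, 0 ≤ a → a < b → ∃ r ∈ R, a < r ∧ r < b := fun a b ha hab => by
    obtain ⟨q, haq, hqb⟩ := exists_rat_btwn hab
    exact ⟨q, Or.inr ⟨ha.trans_lt haq, q, rfl⟩, haq, hqb⟩
  have hRc : Countable R := hR.to_subtype
  have : DenselyOrdered R := ⟨fun a b hab => by
    obtain ⟨r, hr, har, hrb⟩ := hbetween a b (hpos a a.2).le hab
    exact ⟨⟨r, hr⟩, har, hrb⟩⟩
  have : NoMinOrder R := ⟨fun a => by
    obtain ⟨r, hr, -, hra⟩ := hbetween 0 a le_rfl (hpos a a.2)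
    exact ⟨⟨r, hr⟩, hra⟩⟩
  have : NoMaxOrder R := ⟨fun a => by
    obtain ⟨r, hr, hra, -⟩ := hbetween a (a + 1) (hpos a a.2).le (lt_add_one _)
    exact ⟨⟨r, hr⟩, hra⟩⟩
  have : Nonempty R := by
    obtain ⟨r, hr, -⟩ := hbetween 0 1 le_rfl one_pos
    exact ⟨⟨r, hr⟩⟩
  obtain ⟨i⟩ := Order.iso_of_countable_dense ℚ R
  have hi : ∀ r ∈ R, ∃ q, (i q : ℝ) = r := fun r hr =>
    ⟨i.symm ⟨r, hr⟩, by rw [i.apply_symm_apply]⟩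
  refine exists_tree_of_isScale hU hex (e := fun q => (i q : ℝ))
    { strictMono := fun a b hab => i.strictMono hab
      pos := fun q => hpos _ (i q).2
      exists_eq_dist := fun x y hxy => hi _ (Or.inl ⟨x, y, hxy, rfl⟩)
      exists_dist_lt := fun x y => ?_
      exists_ball_subset := fun ε hε => ?_ }
  · obtain ⟨r, hr, hlt, -⟩ := hbetween (dist x y) (dist x y + 1) dist_nonneg (lt_add_one _)
    obtain ⟨q, hq⟩ := hi r hr
    exact ⟨q, hq ▸ hlt⟩
  · obtain ⟨r, hr, -, hlt⟩ := hbetween 0 ε le_rfl hε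
    obtain ⟨q, hq⟩ := hi r hr
    exact ⟨q, fun x => Metric.ball_subset_ball (hq ▸ hlt.le)⟩

theorem IsUniformlyDiscrete.exists_tree [Nonempty U] (hU : IsPolishUltrametric U)
    (hex : IsExact U) (hd : IsUniformlyDiscrete U) :
    ∃ (L : Type) (_ : LinearOrder L) (T : Type) (_ : LE T) (lev : T → L),
      (∃ ℓ₀ : L, ∀ ℓ, ℓ₀ ≤ ℓ) ∧ IsLTree lev ∧ Countable T ∧ IsPruned lev ∧
      IsSpecial lev ∧ HasStar lev ∧ Nonempty ((U ≃ᵢ U) ≃ₜ* treeAut lev) := by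
  obtain ⟨r, hr, hball⟩ := hd
  have hle : ∀ x y : U, x ≠ y → r ≤ dist x y := fun x y hxy => by
    by_contra! hlt
    have : x ∈ Metric.ball y r := hlt
    rw [hball] at this
    exact hxy this
  -- The radius `r` is the minimum of the scale and its balls are already singletons; the numbers `r
  -- + n` make the scale unbounded even if the distances are bounded.
  let R : Set ℝ := {s | r ≤ s ∧ (s ∈ distances U ∨ s ∈ Set.range fun n : ℕ => r + n)}
  have hR : R.Countable := ((countable_distances hU).union (Set.countable_range _)).mono
    fun s hs => hs.2
  have hRc : Countable R := hR.to_subtype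
  have hrn : ∀ n : ℕ, r + n ∈ R := fun n => ⟨le_add_of_nonneg_right n.cast_nonneg, Or.inr ⟨n, rfl⟩⟩
  have hr0 : r ∈ R := by simpa using hrn 0
  have he : IsScale U (Subtype.val : R → ℝ) :=
    { strictMono := fun a b hab => hab
      pos := fun s => hr.trans_le s.2.1
      exists_eq_dist := fun x y hxy =>
        ⟨⟨dist x y, hle x y hxy, Or.inl ⟨x, y, hxy, rfl⟩⟩, rfl⟩
      exists_dist_lt := fun x y => by
        obtain ⟨n, hn⟩ := exists_nat_gt (dist x y)
        exact ⟨⟨r + n, hrn n⟩, by change dist x y < r + n; linarith⟩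
      exists_ball_subset := fun ε hε => ⟨⟨r, hr0⟩, fun x => by
        change Metric.ball x r ⊆ _
        rw [hball]
        exact Set.singleton_subset_iff.2 (Metric.mem_ball_self hε)⟩ }
  obtain ⟨T, _, lev, hT⟩ := exists_tree_of_isScale hU hex he
  exact ⟨R, inferInstance, T, _, lev, ⟨⟨r, hr0⟩, fun s => s.2.1⟩, hT⟩

end TreesFromSpaces

/-! ### The trivial group -/

theorem nonempty_equiv_of_subsingleton (G H : Type*) [Group G] [Group H] [TopologicalSpace G]
    [TopologicalSpace H] [Subsingleton G] [Subsingleton H] : Nonempty (G ≃ₜ* H) :=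
  nonempty_continuousMulEquiv 1
    ⟨fun _ _ _ => Subsingleton.elim _ _, fun _ => ⟨1, Subsingleton.elim _ _⟩⟩
    (continuous_of_const fun _ _ => Subsingleton.elim _ _)
    (continuous_of_const fun _ _ => Subsingleton.elim _ _)

theorem isPolishUltrametric_unit : IsPolishUltrametric Unit :=
  ⟨⟨fun _ _ _ => by simp⟩, inferInstance, inferInstance⟩

theorem isExact_unit : IsExact Unit := by
  rintro ⟨⟩ ⟨⟩
  refine ⟨(), ⟨1, rfl⟩, (), ⟨1, rfl⟩, ?_⟩
  have : Set.image2 dist (component ()) (component ()) = {0} := by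
    refine Set.Subset.antisymm ?_ ?_
    · rintro _ ⟨x, -, y, -, rfl⟩
      exact dist_self ()
    · rintro _ rfl
      exact ⟨(), ⟨1, rfl⟩, (), ⟨1, rfl⟩, dist_self ()⟩
  rw [this, csInf_singleton, dist_self]

theorem isUniformlyDiscrete_unit : IsUniformlyDiscrete Unit :=
  ⟨1, one_pos, fun _ => Set.eq_singleton_iff_unique_mem.2
    ⟨Metric.mem_ball_self one_pos, fun _ _ => rfl⟩⟩

theorem subsingleton_isometryEquiv (U : Type) [MetricSpace U] [Subsingleton U] :
    Subsingleton (U ≃ᵢ U) :=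
  ⟨fun _ _ => IsometryEquiv.ext fun _ => Subsingleton.elim _ _⟩

/-- An isometry group of an exact space is the isometry group of a nonempty exact space. -/
theorem exists_nonempty_exact {G : Type*} [Group G] [TopologicalSpace G] {U : Type}
    [MetricSpace U] (hU : IsPolishUltrametric U) (hex : IsExact U)
    (hG : Nonempty (G ≃ₜ* (U ≃ᵢ U))) :
    ∃ (V : Type) (_ : MetricSpace V), Nonempty V ∧ IsPolishUltrametric V ∧ IsExact V ∧
      (IsUniformlyDiscrete U → IsUniformlyDiscrete V) ∧ Nonempty (G ≃ₜ* (V ≃ᵢ V)) := by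
  rcases isEmpty_or_nonempty U with hempty | hne
  · obtain ⟨e⟩ := hG
    have := subsingleton_isometryEquiv U
    have := subsingleton_isometryEquiv Unit
    have : Subsingleton G := e.injective.subsingleton
    exact ⟨Unit, inferInstance, inferInstance, isPolishUltrametric_unit, isExact_unit,
      fun _ => isUniformlyDiscrete_unit, nonempty_equiv_of_subsingleton _ _⟩
  · exact ⟨U, inferInstance, hne, hU, hex, id, hG⟩

end UltraIso

/-! ### The implications between the eleven descriptions. -/

open UltraIso in
theorem mainTheorem2 (G : Type*) [Group G] [TopologicalSpace G] [IsTopologicalGroup G] :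
      List.TFAE [
        -- isometry groups of exact Polish ultrametric spaces
        ∃ (U : Type) (_ : MetricSpace U), IsPolishUltrametric U ∧ IsExact U ∧
          Nonempty (G ≃ₜ* (U ≃ᵢ U)),
        -- perfect locally compact spaces
        ∃ (U : Type) (_ : MetricSpace U), IsPolishUltrametric U ∧ IsExact U ∧
          PerfectSpace U ∧ LocallyCompactSpace U ∧ Nonempty (G ≃ₜ* (U ≃ᵢ U)),
        -- uniformly discrete spaces
        ∃ (U : Type) (_ : MetricSpace U), IsPolishUltrametric U ∧ IsExact U ∧
          IsUniformlyDiscrete U ∧ Nonempty (G ≃ₜ* (U ≃ᵢ U)),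
        -- automorphism groups of countable pruned `L`-trees with property (⋆)
        ∃ (L : Type) (_ : LinearOrder L) (T : Type) (_ : LE T) (lev : T → L),
          IsLTree lev ∧ Countable T ∧ IsPruned lev ∧ HasStar lev ∧
            Nonempty (G ≃ₜ* treeAut lev),
        -- special `L`-trees, where `L` has a minimum
        ∃ (L : Type) (_ : LinearOrder L) (T : Type) (_ : LE T) (lev : T → L),
          (∃ ℓ₀ : L, ∀ ℓ, ℓ₀ ≤ ℓ) ∧
          IsLTree lev ∧ Countable T ∧ IsPruned lev ∧ IsSpecial lev ∧ HasStar lev ∧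
            Nonempty (G ≃ₜ* treeAut lev),
        -- special `ℚ`-trees
        ∃ (T : Type) (_ : LE T) (lev : T → ℚ),
          IsLTree lev ∧ Countable T ∧ IsPruned lev ∧ IsSpecial lev ∧ HasStar lev ∧
            Nonempty (G ≃ₜ* treeAut lev),
        -- wreath products with locally finite supports
        ∃ (Δ : Type) (_ : PartialOrder Δ) (N : Δ → ℕ∞), IsCountableTreeable N ∧
          Nonempty (G ≃ₜ* wreath (domainLF N)),
        -- Malicki's wreath products
        ∃ (Δ : Type) (_ : PartialOrder Δ) (N : Δ → ℕ∞), IsCountableTreeable N ∧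
          Nonempty (G ≃ₜ* wreath (domainWsp N)),
        -- wreath products over global domains
        ∃ (Δ : Type) (_ : PartialOrder Δ) (N : Δ → ℕ∞) (S : GlobalDomain N),
          IsCountableTreeable N ∧ S.IsApproxHomogeneous ∧ IsClosed S.carrier ∧
            S.IsLocallyDetermined ∧ TopologicalSpace.SeparableSpace S.carrier ∧
            Nonempty (G ≃ₜ* wreath S),
        -- wreath products over local domains
        ∃ (Δ : Type) (_ : PartialOrder Δ) (N : Δ → ℕ∞) (D : LocalDomains N),
          IsCountableTreeable N ∧ D.IsCountable ∧ D.IsLocallyHomogeneous ∧ D.IsFull ∧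
            SubsetMax D.S ∧ Nonempty (G ≃ₜ* localWreath D),
        -- projective wreath products
        ∃ (Δ : Type) (_ : PartialOrder Δ) (N : Δ → ℕ∞) (P : ProjectionSystem N),
          IsCountableTreeable N ∧ P.IsCountable ∧ P.IsLocallyHomogeneous ∧ P.IsFull ∧
            SubsetMax P.S ∧ Nonempty (G ≃ₜ* projWreath P)] ∧
    -- the two support conditions define the same domain over a countable treeable skeleton
    ∀ (Δ : Type) [PartialOrder Δ] (N : Δ → ℕ∞), IsCountableTreeable N →
      domainLF N = domainWsp N := by
  refine ⟨?_, fun Δ _ N hN => domainLF_eq_domainWsp hN⟩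
  tfae_have 2 → 1 := by
    rintro ⟨U, _, hU, hex, -, -, hG⟩
    exact ⟨U, _, hU, hex, hG⟩
  tfae_have 3 → 1 := by
    rintro ⟨U, _, hU, hex, -, hG⟩
    exact ⟨U, _, hU, hex, hG⟩
  tfae_have 1 → 6 := by
    rintro ⟨U, _, hU, hex, hG⟩
    obtain ⟨V, _, hne, hV, hVex, -, ⟨e⟩⟩ := exists_nonempty_exact hU hex hG
    obtain ⟨T, _, lev, h₁, h₂, h₃, h₄, h₅, ⟨e'⟩⟩ := exists_ratTree hV hVex
    exact ⟨T, _, lev, h₁, h₂, h₃, h₄, h₅, ⟨e.trans e'⟩⟩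
  tfae_have 3 → 5 := by
    rintro ⟨U, _, hU, hex, hd, hG⟩
    obtain ⟨V, _, hne, hV, hVex, hVd, ⟨e⟩⟩ := exists_nonempty_exact hU hex hG
    obtain ⟨L, _, T, _, lev, h₀, h₁, h₂, h₃, h₄, h₅, ⟨e'⟩⟩ := (hVd hd).exists_tree hV hVex
    exact ⟨L, _, T, _, lev, h₀, h₁, h₂, h₃, h₄, h₅, ⟨e.trans e'⟩⟩
  tfae_have 5 → 4 := by
    rintro ⟨L, _, T, _, lev, -, h₁, h₂, h₃, -, h₅, hG⟩
    exact ⟨L, _, T, _, lev, h₁, h₂, h₃, h₅, hG⟩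
  tfae_have 6 → 4 := by
    rintro ⟨T, _, lev, h₁, h₂, h₃, -, h₅, hG⟩
    exact ⟨ℚ, _, T, _, lev, h₁, h₂, h₃, h₅, hG⟩
  tfae_have 4 → 7 := by
    rintro ⟨L, _, T, _, lev, h₁, h₂, h₃, h₄, ⟨e⟩⟩
    -- An empty tree (over an empty order of levels) has a trivial group but no admissible skeleton,
    -- so the tree of the one-point space replaces it.
    rcases isEmpty_or_nonempty T with hempty | hne
    · have : Subsingleton (treeAut lev) :=
        ⟨fun f g => Subtype.ext (Equiv.ext fun t => isEmptyElim t)⟩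
      have : Subsingleton G := e.injective.subsingleton
      have := subsingleton_isometryEquiv Unit
      obtain ⟨e₁⟩ := nonempty_equiv_of_subsingleton G (Unit ≃ᵢ Unit)
      obtain ⟨T', _, lev', k₁, k₂, k₃, -, k₅, ⟨e₂⟩⟩ :=
        exists_ratTree isPolishUltrametric_unit isExact_unit
      have : Nonempty T' := (k₁.lev_surjective 0).nonempty
      obtain ⟨Δ, _, N, hN, ⟨e₃⟩⟩ := exists_wreath_equiv k₁ k₃ k₅
      exact ⟨Δ, _, N, hN, ⟨(e₁.trans e₂).trans e₃⟩⟩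
    · obtain ⟨Δ, _, N, hN, ⟨e'⟩⟩ := exists_wreath_equiv h₁ h₃ h₄
      exact ⟨Δ, _, N, hN, ⟨e.trans e'⟩⟩
  tfae_have 7 → 8 := by
    rintro ⟨Δ, _, N, hN, hG⟩
    exact ⟨Δ, _, N, hN, domainLF_eq_domainWsp hN ▸ hG⟩
  tfae_have 8 → 9 := by
    rintro ⟨Δ, _, N, hN, hG⟩
    have := hN.countable
    rw [← domainLF_eq_domainWsp hN] at hG
    exact ⟨Δ, _, N, domainLF N, hN, domainLF_isApproxHomogeneous,
      domainLF_isLocallyDetermined.isClosed, domainLF_isLocallyDetermined,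
      domainLF_separable hN.label_ne_zero, hG⟩
  tfae_have 9 → 3 := by
    rintro ⟨Δ, _, N, S, hN, hah, -, hld, hsep, ⟨e⟩⟩
    have := hN.countable
    -- Global domains may be empty, whereas the pieces of a system of projections may not.
    rcases S.carrier.eq_empty_or_nonempty with hempty | hS
    · have : IsEmpty S.carrier := Set.isEmpty_coe_sort.2 hempty
      have : Subsingleton (wreath S) :=
        ⟨fun f g => Subtype.ext (Equiv.ext fun t => isEmptyElim t)⟩
      have : Subsingleton G := e.injective.subsingleton
      have := subsingleton_isometryEquiv Unit
      exact ⟨Unit, _, isPolishUltrametric_unit, isExact_unit, isUniformlyDiscrete_unit,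
        nonempty_equiv_of_subsingleton _ _⟩
    · obtain ⟨e₁⟩ := GlobalDomain.nonempty_localWreath_equiv (hS := hS) hld
      obtain ⟨U, _, hU, hex, hd, ⟨e₂⟩⟩ := exists_uniformlyDiscrete hN (S.projections hS)
        (GlobalDomain.localDomains_isCountable (hS := hS) hsep)
        (GlobalDomain.localDomains_isLocallyHomogeneous (hS := hS) hah)
        (LocalDomains.isFull_toProjectionSystem
          (GlobalDomain.localDomains_isFull (S := S) (hS := hS)))
      exact ⟨U, _, hU, hex, hd, ⟨(e.trans e₁.symm).trans e₂⟩⟩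
  tfae_have 7 → 10 := by
    rintro ⟨Δ, _, N, hN, ⟨e⟩⟩
    have := hN.countable
    have hS : (domainLF N).carrier.Nonempty := ⟨_, zeroSeq_mem hN.label_ne_zero⟩
    obtain ⟨e₁⟩ := GlobalDomain.nonempty_localWreath_equiv (hS := hS)
      (domainLF_isLocallyDetermined (N := N))
    exact ⟨Δ, _, N, (domainLF N).localDomains hS, hN,
      GlobalDomain.localDomains_isCountable (domainLF_separable hN.label_ne_zero),
      GlobalDomain.localDomains_isLocallyHomogeneous domainLF_isApproxHomogeneous,
      GlobalDomain.localDomains_isFull, subsetMax_domainLF hS, ⟨e.trans e₁.symm⟩⟩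
  tfae_have 10 → 11 := by
    rintro ⟨Δ, _, N, D, hN, hc, hh, hf, hm, hG⟩
    exact ⟨Δ, _, N, D.toProjectionSystem, hN, hc, hh, LocalDomains.isFull_toProjectionSystem hf,
      hm, hG⟩
  tfae_have 11 → 2 := by
    rintro ⟨Δ, _, N, P, hN, hc, hh, hf, -, ⟨e⟩⟩
    obtain ⟨U, _, hU, hex, hp, hl, ⟨e'⟩⟩ := exists_perfect_locallyCompact hN P hc hh hf
    exact ⟨U, _, hU, hex, hp, hl, ⟨e.trans e'⟩⟩
  tfae_finish
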